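/- Let $d\ge 2$ and let $\mathcal R\subset\mathbb R^d$ be a finite root system, normalized so that $\langle v,v\rangle=2$ for all $v\in\mathcal R$; that is, $\mathcal R$ is a finite set with $\sigma_u v\in\mathcal R$ for all $u,v\in\mathcal R$, where $\sigma_u x=x-\frac{2\langle x,u\rangle}{\|u\|^2}u$. Let $G\subset O(d)$ be the reflection group generated by $\{\sigma_v: v\in\mathcal R\}$ and let $\kappa:\mathcal R\to[0,\infty)$ be a $G$-invariant function. Then there is a constant $C_{\kappa,d}>0$ depending only on $d$ and $\kappa$ such that the following holds. Let $\mathcal R_+=\{v\in\mathcal R:\langle v,\beta\rangle>0\}$ be any positive subsystem of $\mathcal R$ (here $\beta\in\mathbb R^d$ is such that $\langle v,\beta\rangle\ne0$ for all $v\in\mathcal R$), put $$h_\kappa(x)=\prod_{v\in\mathcal R_+}|\langle x,v\rangle|^{\kappa_v},$$ let $d\sigma$ be the surface measure on the unit sphere $\mathbb S^{d-1}$ of $\mathbb R^d$, and let $$\mathcal D_iF(x)=\partial_iF(x)+\sum_{v\in\mathcal R_+}\kappa_v\langle v,e_i\rangle\frac{F(x)-F(\sigma_vx)}{\langle x,v\rangle},\qquad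 1\le i\le d,$$ be the Dunkl operators (the quotient being extended continuously to the hyperplane $\langle x,v\rangle=0$). For $f\in C^1(\mathbb S^{d-1})$ define the tangential Dunkl gradient by $$\nabla_{\kappa,0}f(x)=(\mathcal D_1F,\dots,\mathcal D_dF)(x),\quad x\in\mathbb S^{d-1},\qquad F(z)=f\Big(\frac z{\|z\|}\Big).$$ If $f\in C^1(\mathbb S^{d-1})$ is real- or complex-valued and satisfies $\int_{\mathbb S^{d-1}}f(x)h_\kappa^2(x)\,d\sigma(x)=0$ and $\int_{\mathbb S^{d-1}}|f(x)|^2h_\kappa^2(x)\,d\sigma(x)=1$, then the minimum below is attained and $$\Big(\min_{y\in\mathbb S^{d-1}}\int_{\mathbb S^{d-1}}(1-\langle x,y\rangle)|f(x)|^2h_\kappa^2(x)\,d\sigma(x)\Big)\Big(\int_{\mathbb S^{d-1}}\|\nabla_{\kappa,0}f(x)\|^2h_\kappa^2(x)\,d\sigma(x)\Big)\ge C_{\kappa,d}.$$ -/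

import Mathlib

open MeasureTheory Metric
open scoped Manifold ContDiff RealInnerProductSpace

noncomputable section

namespace DunklSphere

/-- Euclidean space `ℝ^d`, with the Euclidean inner product and norm. -/
abbrev E (d : ℕ) : Type := EuclideanSpace ℝ (Fin d)

/-- The unit sphere `S^{d-1}` of `ℝ^d`. -/
abbrev S (d : ℕ) : Type := sphere (0 : E d) 1

/-- The reflection `σ_v` in the hyperplane perpendicular to `v`,
`σ_v x = x - (2⟨x,v⟩/‖v‖²) v`. -/
def refl {d : ℕ} (v : E d) : E d ≃ₗᵢ[ℝ] E d := (ℝ ∙ v)ᗮ.reflection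

theorem refl_apply {d : ℕ} (v x : E d) :
    refl v x = x - (2 * ⟪x, v⟫ / ‖v‖ ^ 2) • v := by
  rw [refl, Submodule.reflection_orthogonal_apply, Submodule.reflection_singleton_apply,
    real_inner_comm]
  simp only [RCLike.ofReal_real_eq_id, id_eq, neg_sub, two_smul, ← add_smul]
  congr 2
  ring

/-- A (finite) root system in `ℝ^d`, normalized so that `⟨v,v⟩ = 2` for every root. It is stable
under `v ↦ -v = σ_v v`, and with this normalization the only multiples of a root `v` that are roots
are `v` and `-v`. -/
structure IsRootSystem {d : ℕ} (R : Finset (E d)) : Prop where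
  inner_self_eq_two : ∀ v ∈ R, ⟪v, v⟫ = 2
  refl_mem : ∀ u ∈ R, ∀ v ∈ R, refl u v ∈ R

/-- The reflection group of `R`: the subgroup of `O(d)` generated by the `σ_v`, `v ∈ R`. -/
def reflectionGroup {d : ℕ} (R : Finset (E d)) : Subgroup (E d ≃ₗᵢ[ℝ] E d) :=
  Subgroup.closure {g | ∃ v ∈ R, g = refl v}

/-- `P` is a positive subsystem of `R`: the set of those roots that lie on the positive side of a
hyperplane through the origin that contains no root. In particular `R` is the disjoint union of
`P` and `-P`. -/
def IsPositiveSubsystem {d : ℕ} (R P : Finset (E d)) : Prop :=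
  ∃ β : E d, (∀ v ∈ R, ⟪v, β⟫ ≠ 0) ∧ ∀ v, v ∈ P ↔ v ∈ R ∧ 0 < ⟪v, β⟫

/-- `κ` is a nonnegative multiplicity function on `R`, i.e. nonnegative and invariant under the
reflection group of `R` (only the values of `κ` on `R` matter). -/
structure IsMultiplicity {d : ℕ} (R : Finset (E d)) (κ : E d → ℝ) : Prop where
  nonneg : ∀ v ∈ R, 0 ≤ κ v
  invariant : ∀ g ∈ reflectionGroup R, ∀ v ∈ R, κ (g v) = κ v

/-- The weight `h_κ(x) = ∏_{v ∈ R₊} |⟨x,v⟩|^{κ_v}`, where `P = R₊`. -/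
def weight {d : ℕ} (P : Finset (E d)) (κ : E d → ℝ) (x : E d) : ℝ :=
  ∏ v ∈ P, |⟪x, v⟫| ^ κ v

/-- The surface measure `dσ` on the unit sphere. -/
def surfaceMeasure (d : ℕ) : Measure (S d) := (volume : Measure (E d)).toSphere

section Operators

variable {𝕜 : Type*} [RCLike 𝕜] {d : ℕ}

/-- The difference quotient `(F(x) - F(σ_v x)) / ⟨x,v⟩`. On the hyperplane `⟨x,v⟩ = 0` it is given
the value by which it extends continuously there when `F` is `C¹` near `x`, namely
`(2/‖v‖²) ∂_v F(x)`. -/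
def reflQuotient (v : E d) (F : E d → 𝕜) (x : E d) : 𝕜 :=
  open Classical in
  if ⟪x, v⟫ = 0 then (2 / ‖v‖ ^ 2 : ℝ) • fderiv ℝ F x v
  else (⟪x, v⟫)⁻¹ • (F x - F (refl v x))

/-- The Dunkl operator
`D_i F(x) = ∂_i F(x) + ∑_{v ∈ R₊} κ_v ⟨v,e_i⟩ (F(x) - F(σ_v x)) / ⟨x,v⟩`, where `P = R₊`. -/
def dunklOp (P : Finset (E d)) (κ : E d → ℝ) (i : Fin d) (F : E d → 𝕜) (x : E d) : 𝕜 :=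
  fderiv ℝ F x (EuclideanSpace.single i 1) + ∑ v ∈ P, (κ v * v i) • reflQuotient v F x

/-- The Dunkl gradient `∇_κ F = (D_1 F, …, D_d F)`. -/
def dunklGrad (P : Finset (E d)) (κ : E d → ℝ) (F : E d → 𝕜) (x : E d) :
    EuclideanSpace 𝕜 (Fin d) :=
  WithLp.toLp 2 fun i => dunklOp P κ i F x

/-- The extension `F(z) = f(z/‖z‖)` of a function on the sphere to `ℝ^d ∖ {0}` (and `F(0) = 0`). -/
def radialExt (f : S d → 𝕜) (z : E d) : 𝕜 :=
  open Classical in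
  if hz : z ≠ 0 then f ⟨‖z‖⁻¹ • z, by simp [norm_smul, hz]⟩ else 0

/-- The tangential Dunkl gradient `∇_{κ,0} f(x) = ∇_κ F(z)|_{z=x}` with `F(z) = f(z/‖z‖)`. -/
def sphereGrad (P : Finset (E d)) (κ : E d → ℝ) (f : S d → 𝕜) (x : S d) :
    EuclideanSpace 𝕜 (Fin d) :=
  dunklGrad P κ (radialExt f) x

end Operators

end DunklSphere

end

namespace DunklSphere

variable {d : ℕ}

theorem refl_refl (v x : E d) : refl v (refl v x) = x := by
  simp [refl]

theorem refl_self (v : E d) : refl v v = -v :=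
  Submodule.reflection_orthogonalComplement_singleton_eq_neg v

theorem inner_refl_left (v x y : E d) : ⟪refl v x, y⟫ = ⟪x, refl v y⟫ := by
  rw [← (refl v).inner_map_map x, refl_refl]

theorem inner_refl_self (v x : E d) : ⟪refl v x, v⟫ = -⟪x, v⟫ := by
  rw [inner_refl_left, refl_self, inner_neg_right]

/-- The reflections are conjugated by reflections to reflections. -/
theorem refl_refl_apply (u v x : E d) : refl (refl u v) x = refl u (refl v (refl u x)) := by
  rw [refl_apply (refl u v), refl_apply v (refl u x), map_sub, map_smul, refl_refl,
    LinearIsometryEquiv.norm_map, inner_refl_left]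

theorem refl_neg (v : E d) : refl (-v) = refl v := by
  ext1 x
  simp [refl_apply, neg_div, sub_eq_add_neg]

/-- A finite set of vectors of squared length two, stable under its reflections, with a positive
invariant multiplicity on it. -/
structure IsWeighted (R : Finset (E d)) (k : E d → ℝ) : Prop where
  inner_self : ∀ v ∈ R, ⟪v, v⟫ = 2
  refl_mem : ∀ u ∈ R, ∀ v ∈ R, refl u v ∈ R
  pos : ∀ v ∈ R, 0 < k v
  invariant : ∀ u ∈ R, ∀ v ∈ R, k (refl u v) = k v

/-- The weight `∏ |⟨x,v⟩|^{2k_v}` over all roots. -/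
noncomputable def wt (R : Finset (E d)) (k : E d → ℝ) (x : E d) : ℝ :=
  ∏ v ∈ R, |⟪x, v⟫| ^ (2 * k v)

/-- The complement of the root hyperplanes. -/
def regular (R : Finset (E d)) : Set (E d) := {x | ∀ v ∈ R, ⟪x, v⟫ ≠ 0}

namespace IsWeighted

variable {R : Finset (E d)} {k : E d → ℝ} (hR : IsWeighted R k)
include hR

theorem norm_sq {v : E d} (hv : v ∈ R) : ‖v‖ ^ 2 = 2 := by
  rw [← real_inner_self_eq_norm_sq, hR.inner_self v hv]

theorem refl_eq {v : E d} (hv : v ∈ R) (x : E d) : refl v x = x - ⟪x, v⟫ • v := by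
  rw [refl_apply, hR.norm_sq hv, mul_comm, mul_div_assoc, div_self two_ne_zero, mul_one]

theorem ne_zero {v : E d} (hv : v ∈ R) : v ≠ 0 := by
  rintro rfl
  simpa using hR.inner_self 0 hv

theorem neg_mem {v : E d} (hv : v ∈ R) : -v ∈ R := by
  rw [← refl_self]
  exact hR.refl_mem v hv v hv

theorem sum_refl {M : Type*} [AddCommMonoid M] {u : E d} (hu : u ∈ R) (φ : E d → M) :
    ∑ v ∈ R, φ (refl u v) = ∑ v ∈ R, φ v :=
  Finset.sum_nbij' (refl u) (refl u) (fun v hv => hR.refl_mem u hu v hv)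
    (fun v hv => hR.refl_mem u hu v hv) (fun v _ => refl_refl u v) (fun v _ => refl_refl u v)
    (fun _ _ => rfl)

theorem prod_refl {M : Type*} [CommMonoid M] {u : E d} (hu : u ∈ R) (φ : E d → M) :
    ∏ v ∈ R, φ (refl u v) = ∏ v ∈ R, φ v :=
  Finset.prod_nbij' (refl u) (refl u) (fun v hv => hR.refl_mem u hu v hv)
    (fun v hv => hR.refl_mem u hu v hv) (fun v _ => refl_refl u v) (fun v _ => refl_refl u v)
    (fun _ _ => rfl)

theorem wt_refl {u : E d} (hu : u ∈ R) (x : E d) : wt R k (refl u x) = wt R k x := by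
  unfold wt
  rw [← hR.prod_refl hu]
  refine Finset.prod_congr rfl fun v hv => ?_
  rw [hR.invariant u hu v hv, inner_refl_left, refl_refl]

theorem one : IsWeighted R (fun _ => 1) :=
  ⟨hR.inner_self, hR.refl_mem, fun _ _ => one_pos, fun _ _ _ _ => rfl⟩

theorem k_neg {v : E d} (hv : v ∈ R) : k (-v) = k v := by
  rw [← refl_self]
  exact hR.invariant v hv v hv

theorem inner_sq_lt {u v : E d} (hu : u ∈ R) (hv : v ∈ R) (h1 : u ≠ v) (h2 : u ≠ -v) :
    ⟪u, v⟫ ^ 2 < 4 := by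
  have a : 0 < ⟪u - v, u - v⟫ := by
    rw [real_inner_self_eq_norm_sq]
    have := norm_pos_iff.2 (sub_ne_zero.2 h1)
    positivity
  have b : 0 < ⟪u + v, u + v⟫ := by
    rw [real_inner_self_eq_norm_sq]
    have := norm_pos_iff.2 (fun h => h2 (eq_neg_of_add_eq_zero_left h) : u + v ≠ 0)
    positivity
  rw [real_inner_sub_sub_self, hR.inner_self u hu, hR.inner_self v hv] at a
  rw [real_inner_add_add_self, hR.inner_self u hu, hR.inner_self v hv] at b
  nlinarith

/-- Dunkl's cancellation lemma: sums over pairs of roots whose product of reflections is a given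
rotation vanish. -/
theorem sum_sum_rotation {x : E d} (hx : x ∈ regular R) (H : (E d → E d) → ℝ) (H1 : H id = 0) :
    ∑ u ∈ R, ∑ v ∈ R, k u * k v * ⟪u, v⟫ / (⟪x, u⟫ * ⟪x, v⟫) * H (refl u ∘ refl v) = 0 := by
  classical
  have key : ∀ p : E d × E d → ℝ, ∑ q ∈ R ×ˢ R, p (q.2, -refl q.2 q.1) = ∑ q ∈ R ×ˢ R, p q := by
    intro p
    refine Finset.sum_nbij' (fun q => (q.2, -refl q.2 q.1)) (fun q => (-refl q.1 q.2, q.1))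
      ?_ ?_ ?_ ?_ (fun _ _ => rfl)
    · intro q hq
      rw [Finset.mem_product] at hq ⊢
      exact ⟨hq.2, hR.neg_mem (hR.refl_mem _ hq.2 _ hq.1)⟩
    · intro q hq
      rw [Finset.mem_product] at hq ⊢
      exact ⟨hR.neg_mem (hR.refl_mem _ hq.1 _ hq.2), hq.1⟩
    · intro q _
      simp [refl_refl]
    · intro q _
      simp [refl_refl]
  rw [← Finset.sum_product' R R
    (fun u v => k u * k v * ⟪u, v⟫ / (⟪x, u⟫ * ⟪x, v⟫) * H (refl u ∘ refl v))]
  set Q : E d × E d → ℝ := fun q => ⟪x, q.1⟫ ^ 2 - ⟪q.1, q.2⟫ * ⟪x, q.1⟫ * ⟪x, q.2⟫ + ⟪x, q.2⟫ ^ 2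
    with hQ
  set s : E d × E d → ℝ := fun q =>
    k q.1 * k q.2 * ⟪q.1, q.2⟫ / Q q * H (refl q.1 ∘ refl q.2) * (⟪x, q.2⟫ / ⟪x, q.1⟫) with hs
  have : ∀ q ∈ R ×ˢ R, k q.1 * k q.2 * ⟪q.1, q.2⟫ / (⟪x, q.1⟫ * ⟪x, q.2⟫)
      * H (refl q.1 ∘ refl q.2) = s q - s (q.2, -refl q.2 q.1) := by
    rintro ⟨u, v⟩ hq
    rw [Finset.mem_product] at hq
    obtain ⟨hu, hv⟩ := hq
    simp only at hu hv
    have hcomp : ((refl v : E d → E d) ∘ refl (-refl v u)) = refl u ∘ refl v := by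
      funext z
      rw [refl_neg]
      simp [refl_refl_apply, refl_refl]
    have hk : k (-refl v u) = k u := by
      rw [hR.k_neg (hR.refl_mem _ hv _ hu), hR.invariant _ hv _ hu]
    by_cases h1 : u = v
    · subst h1
      have : ((refl u : E d → E d) ∘ refl u) = id := funext fun z => refl_refl u z
      simp only [hs, hcomp, this, H1]
      simp
    by_cases h2 : u = -v
    · have : ((refl u : E d → E d) ∘ refl v) = id := by
        subst h2
        rw [refl_neg]
        exact funext fun z => refl_refl v z
      simp only [hs, hcomp, this, H1]
      simp
    have hc := hR.inner_sq_lt hu hv h1 h2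
    have ha := hx u hu
    have hb := hx v hv
    have hw : -refl v u = ⟪u, v⟫ • v - u := by
      rw [hR.refl_eq hv, neg_sub]
    have e1 : ⟪v, -refl v u⟫ = ⟪u, v⟫ := by
      rw [hw, inner_sub_right, inner_smul_right, hR.inner_self v hv, real_inner_comm]
      ring
    have e2 : ⟪x, -refl v u⟫ = ⟪u, v⟫ * ⟪x, v⟫ - ⟪x, u⟫ := by
      rw [hw, inner_sub_right, inner_smul_right]
    have e3 : Q (v, -refl v u) = Q (u, v) := by
      simp only [hQ, e1, e2]
      ring
    have hQ0 : Q (u, v) ≠ 0 := by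
      have : 0 < Q (u, v) := by
        simp only [hQ]
        set c := ⟪u, v⟫
        set a := ⟪x, u⟫
        set b := ⟪x, v⟫
        have hb2 : 0 < b ^ 2 := by positivity
        nlinarith [sq_nonneg (a - c / 2 * b), mul_pos hb2 (sub_pos.2 hc)]
      exact this.ne'
    have e4 : Q (u, v) = ⟪x, u⟫ ^ 2 - ⟪u, v⟫ * ⟪x, u⟫ * ⟪x, v⟫ + ⟪x, v⟫ ^ 2 := rfl
    simp only [hs, e1, e2, e3, hcomp, hk]
    set q := Q (u, v)
    set h := H (refl u ∘ refl v)
    set c := ⟪u, v⟫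
    set a := ⟪x, u⟫
    set b := ⟪x, v⟫
    have : k v * k u * c / q * h * ((c * b - a) / b)
      = k u * k v * c * h / q * ((c * b - a) / b) := by ring
    rw [this, show k u * k v * c / q * h * (b / a) = k u * k v * c * h / q * (b / a) by ring,
      ← mul_sub, show b / a - (c * b - a) / b = q / (a * b) by rw [e4]; field_simp; ring]
    field_simp
  rw [Finset.sum_congr rfl this, Finset.sum_sub_distrib, key s, sub_self]

end IsWeighted

end DunklSphere
namespace DunklSphere

variable {d : ℕ}

section RadialExtension

variable {𝕜 : Type*} [RCLike 𝕜]

theorem radialExt_smul (f : S d → 𝕜) {r : ℝ} (hr : 0 < r) (z : E d) :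
    radialExt f (r • z) = radialExt f z := by
  unfold radialExt
  by_cases hz : z = 0
  · simp [hz]
  · have h2 : r • z ≠ 0 := smul_ne_zero hr.ne' hz
    rw [dif_pos hz, dif_pos h2]
    congr 2
    rw [norm_smul, Real.norm_of_nonneg hr.le, smul_smul]
    congr 1
    field_simp

theorem radialExt_coe (f : S d → 𝕜) (x : S d) : radialExt f (x : E d) = f x := by
  have h1 : ‖(x : E d)‖ = 1 := by simp
  have h2 : (x : E d) ≠ 0 := by
    intro h
    simp [h] at h1
  unfold radialExt
  rw [dif_pos h2]
  congr 1
  ext1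
  simp [h1]

/-- A function that is `C¹` off the origin and homogeneous of degree zero. -/
structure IsZeroHom {G : Type*} [NormedAddCommGroup G] [NormedSpace ℝ G] (F : E d → G) : Prop where
  contDiffAt : ∀ z, z ≠ 0 → ContDiffAt ℝ 1 F z
  smul : ∀ r : ℝ, 0 < r → ∀ z, F (r • z) = F z

theorem isZeroHom_radialExt {n : ℕ} {f : S (n + 1) → 𝕜} (hf : ContMDiff (𝓡 n) 𝓘(ℝ, 𝕜) 1 f) :
    IsZeroHom (radialExt f) := by
  refine ⟨fun z hz => ?_, fun r hr z => radialExt_smul f hr z⟩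
  have : Fact (Module.finrank ℝ (E (n + 1)) = n + 1) := ⟨by simp⟩
  let U : TopologicalSpace.Opens (E (n + 1)) := ⟨{0}ᶜ, isOpen_compl_singleton⟩
  have hU : ∀ x : U, (x : E (n + 1)) ≠ 0 := fun x => x.2
  let g : U → E (n + 1) := fun x => ‖(x : E (n + 1))‖⁻¹ • (x : E (n + 1))
  have hg : ContMDiff 𝓘(ℝ, E (n + 1)) 𝓘(ℝ, E (n + 1)) 1 g := by
    intro x
    have : ContDiffAt ℝ 1 (fun x : E (n + 1) => ‖x‖⁻¹ • x) x := by
      have := (contDiffAt_norm ℝ (hU x) (n := 1)).inv (norm_ne_zero_iff.2 (hU x))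
      exact this.smul contDiffAt_id
    exact contMDiffAt_subtype_iff.2 this.contMDiffAt
  have hg1 : ∀ x, g x ∈ sphere (0 : E (n + 1)) 1 := fun x => by
    simp [g, norm_smul, hU x]
  have h := hf.comp (hg.codRestrict_sphere hg1)
  have h1 := h ⟨z, hz⟩
  have h2 : (f ∘ Set.codRestrict (fun x => g x) (sphere (0 : E (n + 1)) 1) hg1)
      = fun x : U => radialExt f x := by
    funext x
    simp only [Function.comp, radialExt]
    rw [dif_pos (hU x)]
    rfl
  rw [h2] at h1
  exact (contMDiffAt_subtype_iff (U := U) (x := ⟨z, hz⟩).1 h1).contDiffAt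

end RadialExtension

section Polar

/-- The radial weight in polar coordinates. -/
theorem integral_polar (hd : 0 < d) {h : E d → ℝ} {φ : ℝ → ℝ} {g : S d → ℝ}
    (H : ∀ r : ℝ, 0 < r → ∀ x : S d, h (r • (x : E d)) = φ r * g x) :
    ∫ z, h z = (∫ r in Set.Ioi (0 : ℝ), r ^ (d - 1) * φ r) * ∫ x, g x ∂surfaceMeasure d := by
  have : Nonempty (Fin d) := ⟨⟨0, hd⟩⟩
  have : Nontrivial (E d) := inferInstance
  have mp := (volume : Measure (E d)).measurePreserving_homeomorphUnitSphereProd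
  have e1 : ∫ z, h z = ∫ z : ({0}ᶜ : Set (E d)), h z ∂(Measure.comap (↑) (volume : Measure (E d))) := by
    rw [integral_subtype_comap (measurableSet_singleton _).compl h,
      restrict_compl_singleton]
  have e2 : ∀ z : ({0}ᶜ : Set (E d)), h z =
      (fun p : S d × Set.Ioi (0 : ℝ) => g p.1 * φ p.2) (homeomorphUnitSphereProd (E d) z) := by
    intro z
    have hz : (z : E d) ≠ 0 := z.2
    have := H ‖(z : E d)‖ (norm_pos_iff.2 hz) (homeomorphUnitSphereProd (E d) z).1
    simp only
    rw [mul_comm, homeomorphUnitSphereProd_apply_snd_coe, ← this]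
    congr 1
    simp [smul_smul, hz]
  rw [e1]
  simp_rw [e2]
  rw [mp.integral_comp (homeomorphUnitSphereProd (E d)).measurableEmbedding
    (fun p : S d × Set.Ioi (0 : ℝ) => g p.1 * φ p.2),
    integral_prod_mul g (fun r : Set.Ioi (0 : ℝ) => φ r), mul_comm, surfaceMeasure]
  congr 1
  rw [Measure.volumeIoiPow]
  rw [integral_withDensity_eq_integral_toReal_smul₀ (by fun_prop) (by simp)]
  rw [integral_subtype_comap measurableSet_Ioi
    (fun r : ℝ => (ENNReal.ofReal (r ^ (Module.finrank ℝ (E d) - 1))).toReal • φ r)]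
  refine setIntegral_congr_fun measurableSet_Ioi fun r hr => ?_
  have hr : (0 : ℝ) < r := hr
  simp [ENNReal.toReal_ofReal (pow_nonneg hr.le _)]

theorem lintegral_polar (hd : 0 < d) {h : E d → ENNReal} {φ : ℝ → ENNReal} {g : S d → ENNReal}
    (hφ : Measurable φ) (hg : AEMeasurable g (surfaceMeasure d))
    (H : ∀ r : ℝ, 0 < r → ∀ x : S d, h (r • (x : E d)) = φ r * g x) :
    ∫⁻ z, h z = (∫⁻ r in Set.Ioi (0 : ℝ), ENNReal.ofReal (r ^ (d - 1)) * φ r)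
      * ∫⁻ x, g x ∂surfaceMeasure d := by
  have : Nonempty (Fin d) := ⟨⟨0, hd⟩⟩
  have : Nontrivial (E d) := inferInstance
  have mp := (volume : Measure (E d)).measurePreserving_homeomorphUnitSphereProd
  have e1 : ∫⁻ z, h z = ∫⁻ z : ({0}ᶜ : Set (E d)), h z ∂(Measure.comap (↑) (volume : Measure (E d))) := by
    rw [lintegral_subtype_comap (measurableSet_singleton _).compl h,
      restrict_compl_singleton]
  have e2 : ∀ z : ({0}ᶜ : Set (E d)), h z =
      (fun p : S d × Set.Ioi (0 : ℝ) => g p.1 * φ p.2) (homeomorphUnitSphereProd (E d) z) := by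
    intro z
    have hz : (z : E d) ≠ 0 := z.2
    have := H ‖(z : E d)‖ (norm_pos_iff.2 hz) (homeomorphUnitSphereProd (E d) z).1
    simp only
    rw [mul_comm, homeomorphUnitSphereProd_apply_snd_coe, ← this]
    congr 1
    simp [smul_smul, hz]
  rw [e1]
  simp_rw [e2]
  rw [mp.lintegral_comp_emb (homeomorphUnitSphereProd (E d)).measurableEmbedding
    (fun p : S d × Set.Ioi (0 : ℝ) => g p.1 * φ p.2),
    lintegral_prod_mul (f := g) (g := fun r : Set.Ioi (0 : ℝ) => φ r)
      (show AEMeasurable g ((volume : Measure (E d)).toSphere) from hg)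
      (hφ.comp measurable_subtype_coe).aemeasurable, mul_comm, surfaceMeasure]
  congr 1
  rw [Measure.volumeIoiPow]
  rw [lintegral_withDensity_eq_lintegral_mul _ (by fun_prop) (by fun_prop)]
  simp only [Pi.mul_apply]
  rw [lintegral_subtype_comap measurableSet_Ioi
    (fun r : ℝ => ENNReal.ofReal (r ^ (Module.finrank ℝ (E d) - 1)) * φ r)]
  simp

end Polar

instance : IsFiniteMeasure (surfaceMeasure d) := by
  unfold surfaceMeasure
  infer_instance

theorem volume_hyperplane {v : E d} (hv : v ≠ 0) : volume {x : E d | ⟪x, v⟫ = 0} = 0 := by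
  have : {x : E d | ⟪x, v⟫ = 0} = ((ℝ ∙ v)ᗮ : Submodule ℝ (E d)) := by
    ext x
    simp [Submodule.mem_orthogonal_singleton_iff_inner_left]
  rw [this]
  refine Measure.addHaar_submodule _ _ fun h => hv ?_
  have : v ∈ (ℝ ∙ v)ᗮ := h ▸ Submodule.mem_top
  rwa [Submodule.mem_orthogonal_singleton_iff_inner_left, inner_self_eq_zero] at this

theorem ae_mem_regular {R : Finset (E d)} (hR : ∀ v ∈ R, v ≠ 0) : ∀ᵐ x : E d, x ∈ regular R := by
  have : ∀ v ∈ R, ∀ᵐ x : E d, ⟪x, v⟫ ≠ 0 := fun v hv => by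
    rw [ae_iff]
    simpa using volume_hyperplane (hR v hv)
  filter_upwards [(Filter.eventually_all_finset R).2 this] with x hx using hx

theorem ae_sphere_mem_regular {R : Finset (E d)} (hR : ∀ v ∈ R, v ≠ 0) :
    ∀ᵐ x : S d ∂surfaceMeasure d, (x : E d) ∈ regular R := by
  have : ∀ v ∈ R, ∀ᵐ x : S d ∂surfaceMeasure d, ⟪(x : E d), v⟫ ≠ 0 := fun v hv => by
    rw [ae_iff]
    have hm : MeasurableSet {x : S d | ¬ ⟪(x : E d), v⟫ ≠ 0} := by
      simp only [ne_eq, not_not]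
      exact (measurableSet_singleton (0 : ℝ)).preimage (by fun_prop : Continuous fun x : S d => ⟪(x : E d), v⟫).measurable
    rw [surfaceMeasure, Measure.toSphere_apply' _ hm]
    refine mul_eq_zero_of_right _ (measure_mono_null ?_ (volume_hyperplane (hR v hv)))
    rintro _ ⟨r, _, _, ⟨x, hx, rfl⟩, rfl⟩
    simp only [ne_eq, not_not, Set.mem_ofPred_eq] at hx ⊢
    simp [inner_smul_left, hx]
  filter_upwards [(Filter.eventually_all_finset R).2 this] with x hx using hx

namespace IsZeroHom

variable {G : Type*} [NormedAddCommGroup G] [NormedSpace ℝ G] {F : E d → G} (hF : IsZeroHom F)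
include hF

theorem continuousOn : ContinuousOn F {0}ᶜ := fun z hz =>
  (hF.contDiffAt z hz).continuousAt.continuousWithinAt

theorem differentiableAt {z : E d} (hz : z ≠ 0) : DifferentiableAt ℝ F z :=
  (hF.contDiffAt z hz).differentiableAt one_ne_zero

theorem contDiffOn : ContDiffOn ℝ 1 F {0}ᶜ := fun z hz => (hF.contDiffAt z hz).contDiffWithinAt

theorem continuousOn_fderiv : ContinuousOn (fderiv ℝ F) {0}ᶜ :=
  hF.contDiffOn.continuousOn_fderiv_of_isOpen isOpen_compl_singleton le_rfl

theorem fderiv_smul {r : ℝ} (hr : 0 < r) (z : E d) : fderiv ℝ F (r • z) = r⁻¹ • fderiv ℝ F z := by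
  have h := fderiv_comp_smul (𝕜 := ℝ) (f := F) (x := z) r
  have h2 : (fun x => F (r • x)) = F := funext fun x => hF.smul r hr x
  rw [h2] at h
  rw [h, smul_smul, inv_mul_cancel₀ hr.ne', one_smul]

theorem apply_normalize {z : E d} (hz : z ≠ 0) : F (‖z‖⁻¹ • z) = F z :=
  hF.smul _ (inv_pos.2 (norm_pos_iff.2 hz)) z

theorem measurable [MeasurableSpace G] [BorelSpace G] : Measurable F :=
  measurable_of_continuousOn_compl_singleton 0 hF.continuousOn

theorem exists_bound : ∃ L : ℝ, 0 ≤ L ∧ (∀ z, z ≠ 0 → ‖F z‖ ≤ L) ∧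
    ∀ z, z ≠ 0 → ‖fderiv ℝ F z‖ ≤ L / ‖z‖ := by
  have hs : sphere (0 : E d) 1 ⊆ {0}ᶜ := fun x hx h => by
    rw [Set.mem_singleton_iff] at h
    simp [h] at hx
  obtain ⟨L1, h1⟩ := (isCompact_sphere (0 : E d) 1).exists_bound_of_continuousOn
    (hF.continuousOn.mono hs)
  obtain ⟨L2, h2⟩ := (isCompact_sphere (0 : E d) 1).exists_bound_of_continuousOn
    (hF.continuousOn_fderiv.mono hs)
  refine ⟨max 0 (max L1 L2), le_max_left _ _, fun z hz => ?_, fun z hz => ?_⟩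
  · rw [← hF.apply_normalize hz]
    exact (h1 _ (by simp [norm_smul, hz])).trans ((le_max_left _ _).trans (le_max_right _ _))
  · have hz0 := norm_pos_iff.2 hz
    have h3 := hF.fderiv_smul hz0 (‖z‖⁻¹ • z)
    rw [smul_smul, mul_inv_cancel₀ hz0.ne', one_smul] at h3
    rw [h3, norm_smul, norm_inv, norm_norm, div_eq_inv_mul]
    gcongr
    exact (h2 _ (by simp [norm_smul, hz])).trans ((le_max_right _ _).trans (le_max_right _ _))

theorem exists_lipschitz : ∃ L : ℝ, 0 ≤ L ∧ (∀ z, z ≠ 0 → ‖F z‖ ≤ L) ∧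
    (∀ z, z ≠ 0 → ‖fderiv ℝ F z‖ ≤ L / ‖z‖) ∧
    ∀ x y, ‖x‖ = ‖y‖ → 1 ≤ ‖x‖ → ‖F x - F y‖ ≤ L * ‖x - y‖ := by
  obtain ⟨L, hL0, hL1, hL2⟩ := hF.exists_bound
  have h0 : ∀ z : E d, 1 ≤ ‖z‖ → z ≠ 0 := fun z h => norm_pos_iff.1 (one_pos.trans_le h)
  refine ⟨2 * L, by linarith, fun z hz => (hL1 z hz).trans (by linarith),
    fun z hz => (hL2 z hz).trans (by gcongr; linarith), fun x y hxy hx => ?_⟩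
  rcases le_or_gt 1 ‖x - y‖ with h | h
  · calc ‖F x - F y‖ ≤ ‖F x‖ + ‖F y‖ := norm_sub_le _ _
      _ ≤ L + L := add_le_add (hL1 _ (h0 x hx)) (hL1 _ (h0 y (hxy ▸ hx)))
      _ = 2 * L * 1 := by ring
      _ ≤ _ := by gcongr
  · have hseg : ∀ z ∈ segment ℝ x y, 1 / 2 ≤ ‖z‖ := by
      rintro z ⟨a, b, ha, hb, hab, rfl⟩
      have e1 : x = (a • x + b • y) + b • (x - y) := by
        rw [show a = 1 - b by linarith]; module
      have e2 : y = (a • x + b • y) - a • (x - y) := by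
        rw [show b = 1 - a by linarith]; module
      have h1 : ‖x‖ ≤ ‖a • x + b • y‖ + b * ‖x - y‖ := by
        conv_lhs => rw [e1]
        refine (norm_add_le _ _).trans (by rw [norm_smul, Real.norm_of_nonneg hb])
      have h2 : ‖y‖ ≤ ‖a • x + b • y‖ + a * ‖x - y‖ := by
        conv_lhs => rw [e2]
        refine (norm_sub_le _ _).trans (by rw [norm_smul, Real.norm_of_nonneg ha])
      nlinarith
    have hne : ∀ z ∈ segment ℝ x y, z ≠ 0 := fun z hz =>
      norm_pos_iff.1 (lt_of_lt_of_le (by norm_num) (hseg z hz))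
    have := (convex_segment (𝕜 := ℝ) x y).norm_image_sub_le_of_norm_fderiv_le (f := F) (C := 2 * L)
      (fun z hz => hF.differentiableAt (hne z hz)) (fun z hz => (hL2 z (hne z hz)).trans ?_)
      (right_mem_segment ℝ x y) (left_mem_segment ℝ x y)
    · exact this
    · rw [div_le_iff₀ (norm_pos_iff.2 (hne z hz))]
      nlinarith [hseg z hz]

end IsZeroHom

end DunklSphere
namespace DunklSphere

variable {d : ℕ}

theorem integral_refl (v : E d) (g : E d → ℝ) : ∫ x, g (refl v x) = ∫ x, g x :=
  (refl v).measurePreserving.integral_comp (refl v).toHomeomorph.measurableEmbedding g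

theorem integral_lineDeriv_eq_zero {Ψ Ψ' : E d → ℝ} {v : E d} (h : Integrable Ψ)
    (h' : Integrable Ψ') (hd : ∀ x, HasLineDerivAt ℝ Ψ (Ψ' x) x v) : ∫ x, Ψ' x = 0 := by
  have := integral_bilinear_hasLineDerivAt_right_eq_neg_left_of_integrable
    (μ := (volume : Measure (E d))) (f := Ψ) (f' := Ψ') (g := fun _ => (1 : ℝ))
    (g' := fun _ => (0 : ℝ)) (v := v) (B := ContinuousLinearMap.mul ℝ ℝ)
    (by simpa using h') (by simp) (by simpa using h) (fun x _ => hd x)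
    (fun x _ => by simpa [HasLineDerivAt] using hasDerivAt_const (0 : ℝ) (1 : ℝ))
  simpa using this

/-- The difference quotients of a function along reflections. -/
noncomputable def quot (F : E d → ℝ) (v x : E d) : ℝ := (F x - F (refl v x)) / ⟪x, v⟫

theorem quot_refl (F : E d → ℝ) (v x : E d) : quot F v (refl v x) = quot F v x := by
  rw [quot, quot, refl_refl, inner_refl_self, ← neg_sub, neg_div_neg_eq]

/-- The points off the root hyperplanes and off the origin. -/
def regular₀ (R : Finset (E d)) : Set (E d) := regular R ∩ {0}ᶜ

/-- Invariant test weights supported off the root hyperplanes. -/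
structure IsTest (R : Finset (E d)) (ρ : E d → ℝ) : Prop where
  contDiff : ContDiff ℝ 1 ρ
  compact : HasCompactSupport ρ
  supp : tsupport ρ ⊆ regular₀ R
  inv : ∀ v ∈ R, ∀ x, ρ (refl v x) = ρ x

theorem isOpen_regular (R : Finset (E d)) : IsOpen (regular R) := by
  have : regular R = ⋂ v ∈ R, {x : E d | ⟪x, v⟫ ≠ 0} := by
    ext x
    simp [regular]
  rw [this]
  exact isOpen_biInter_finset fun v _ => isOpen_ne_fun (by fun_prop) (by fun_prop)

theorem isOpen_regular₀ (R : Finset (E d)) : IsOpen (regular₀ R) :=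
  (isOpen_regular R).inter isOpen_compl_singleton

theorem integrable_mul_of_tsupport {ρ h : E d → ℝ} {V : Set (E d)} (hV : IsOpen V)
    (hρ : Continuous ρ) (hc : HasCompactSupport ρ) (hs : tsupport ρ ⊆ V) (hh : ContinuousOn h V) :
    Integrable fun x => ρ x * h x := by
  have : Continuous fun x => ρ x * h x :=
    (hρ.continuousOn.mul hh).continuous_of_tsupport_subset hV
      ((closure_mono (Function.support_mul_subset_left ρ h)).trans hs)
  exact this.integrable_of_hasCompactSupport (hc.mul_right)

namespace IsZeroHom

variable {F : E d → ℝ} (hF : IsZeroHom F)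
include hF

theorem continuousOn_refl (v : E d) : ContinuousOn (fun x => F (refl v x)) {0}ᶜ :=
  hF.continuousOn.comp (refl v).continuous.continuousOn fun x hx => by simpa using hx

theorem continuousOn_quot {R : Finset (E d)} {v : E d} (hv : v ∈ R) :
    ContinuousOn (quot F v) (regular₀ R) :=
  ((hF.continuousOn.sub (hF.continuousOn_refl v)).mono Set.inter_subset_right).div
    (by fun_prop) fun _ hx => hx.1 v hv

theorem continuousOn_fderiv_apply (R : Finset (E d)) (v : E d) :
    ContinuousOn (fun x => fderiv ℝ F x v) (regular₀ R) :=
  (hF.continuousOn_fderiv.clm_apply continuousOn_const).mono Set.inter_subset_right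

end IsZeroHom

namespace IsWeighted

variable {R : Finset (E d)} {k : E d → ℝ} (hR : IsWeighted R k) {F ρ : E d → ℝ}
include hR

theorem integral_cross (hF : IsZeroHom F) (hρ : IsTest R ρ) {v : E d} (hv : v ∈ R) :
    ∫ x, ρ x * (2 * (fderiv ℝ F x v * quot F v x)) =
      (∫ x, ρ x * quot F v x ^ 2)
        - 1 / 2 * ∫ x, fderiv ℝ ρ x v * (quot F v x ^ 2 * ⟪x, v⟫) := by
  have hV := isOpen_regular₀ R
  have hq := hF.continuousOn_quot hv
  have hI : ∀ h : E d → ℝ, ContinuousOn h (regular₀ R) → Integrable fun x => ρ x * h x :=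
    fun h => integrable_mul_of_tsupport hV hρ.contDiff.continuous hρ.compact hρ.supp
  have hℓ : ContinuousOn (fun x : E d => ⟪x, v⟫) (regular₀ R) := by fun_prop
  have hd := hF.continuousOn_fderiv_apply R v
  have hd' : ContinuousOn (fun x => fderiv ℝ F (refl v x) v) (regular₀ R) := by
    refine (hF.continuousOn_fderiv.clm_apply continuousOn_const).comp
      (refl v).continuous.continuousOn fun x hx => ?_
    simpa using hx.2
  have hρd : Continuous fun x => fderiv ℝ ρ x v :=
    (hρ.contDiff.continuous_fderiv one_ne_zero).clm_apply continuous_const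
  have hρs : tsupport (fun x => fderiv ℝ ρ x v) ⊆ tsupport ρ := tsupport_fderiv_apply_subset ℝ v
  have hρc : HasCompactSupport fun x => fderiv ℝ ρ x v := hρ.compact.of_isClosed_subset
    (isClosed_tsupport _) hρs
  have hI' : ∀ h : E d → ℝ, ContinuousOn h (regular₀ R) →
      Integrable fun x => fderiv ℝ ρ x v * h x :=
    fun h => integrable_mul_of_tsupport hV hρd hρc (hρs.trans hρ.supp)
  have i1 : Integrable fun x => 2 * (ρ x * (fderiv ℝ F x v * quot F v x)) :=
    (hI _ (hd.mul hq)).const_mul 2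
  have i2 : Integrable fun x => 2 * (ρ x * (fderiv ℝ F (refl v x) v * quot F v x)) :=
    (hI _ (hd'.mul hq)).const_mul 2
  have i3 : Integrable fun x => 2 * (ρ x * quot F v x ^ 2) := (hI _ (hq.pow 2)).const_mul 2
  have i4 : Integrable fun x => fderiv ℝ ρ x v * (quot F v x ^ 2 * ⟪x, v⟫) :=
    hI' _ ((hq.pow 2).mul hℓ)
  have i5 : Integrable fun x => 2 * (ρ x * (fderiv ℝ F x v * quot F v x))
      + 2 * (ρ x * (fderiv ℝ F (refl v x) v * quot F v x)) := i1.add i2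
  have i6 : Integrable fun x => 2 * (ρ x * (fderiv ℝ F x v * quot F v x))
      + 2 * (ρ x * (fderiv ℝ F (refl v x) v * quot F v x)) - 2 * (ρ x * quot F v x ^ 2) :=
    i5.sub i3
  have e1 : ∫ x, ρ x * (fderiv ℝ F (refl v x) v * quot F v x)
      = ∫ x, ρ x * (fderiv ℝ F x v * quot F v x) := by
    rw [← integral_refl v fun x => ρ x * (fderiv ℝ F x v * quot F v x)]
    simp_rw [hρ.inv v hv, quot_refl]
  have e2 : ∫ x, (fderiv ℝ ρ x v * (quot F v x ^ 2 * ⟪x, v⟫)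
      + (2 * (ρ x * (fderiv ℝ F x v * quot F v x))
        + 2 * (ρ x * (fderiv ℝ F (refl v x) v * quot F v x))
        - 2 * (ρ x * quot F v x ^ 2))) = 0 := by
    refine integral_lineDeriv_eq_zero (v := v)
      (Ψ := fun x => ρ x * (quot F v x ^ 2 * ⟪x, v⟫)) (hI _ ((hq.pow 2).mul hℓ))
      (i4.add i6) fun x => ?_
    by_cases hx : x ∈ tsupport ρ
    · have hxV := hρ.supp hx
      have hx0 : x ≠ 0 := hxV.2
      have hxv := hxV.1 v hv
      have hσ0 : refl v x ≠ 0 := by simpa using hx0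
      have a1 : HasDerivAt (fun t : ℝ => ρ (x + t • v)) (fderiv ℝ ρ x v) 0 :=
        (hρ.contDiff.differentiable one_ne_zero x).hasFDerivAt.hasLineDerivAt v
      have a2 : HasDerivAt (fun t : ℝ => F (x + t • v)) (fderiv ℝ F x v) 0 :=
        (hF.differentiableAt hx0).hasFDerivAt.hasLineDerivAt v
      have a3 : HasDerivAt (fun t : ℝ => F (refl v (x + t • v))) (-fderiv ℝ F (refl v x) v) 0 := by
        have := (hF.differentiableAt hσ0).hasFDerivAt.hasLineDerivAt (-v)
        rw [HasLineDerivAt, map_neg] at this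
        simpa [refl_self] using this
      have a4 : HasDerivAt (fun t : ℝ => ⟪x + t • v, v⟫) 2 0 := by
        have : (fun t : ℝ => ⟪x + t • v, v⟫) = fun t => ⟪x, v⟫ + t * 2 := by
          funext t
          rw [inner_add_left, inner_smul_left, hR.inner_self v hv]
          rfl
        rw [this]
        simpa using ((hasDerivAt_id (0 : ℝ)).mul_const (2 : ℝ)).const_add ⟪x, v⟫
      have hne : ⟪x + (0 : ℝ) • v, v⟫ ≠ 0 := by simpa using hxv
      have a5 := a1.mul ((((a2.sub a3).div a4 hne).pow 2).mul a4)
      have a6 : HasDerivAt (fun t : ℝ => ρ (x + t • v) *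
        (quot F v (x + t • v) ^ 2 * ⟪x + t • v, v⟫)) _ 0 := a5
      refine a6.congr_deriv ?_
      simp only [zero_smul, add_zero, quot, Pi.div_apply, Pi.sub_apply, Pi.pow_apply, Pi.mul_apply,
        Nat.cast_ofNat, Nat.add_one_sub_one, pow_one]
      generalize ⟪x, v⟫ = l at hxv ⊢
      field_simp
      ring
    · have h0 : ρ =ᶠ[nhds x] 0 := notMem_tsupport_iff_eventuallyEq.1 hx
      have h1 : fderiv ℝ ρ x = 0 := by
        rw [h0.fderiv_eq]
        simp
      have h2 : ρ x = 0 := h0.eq_of_nhds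
      rw [h1, h2]
      have h3 : (fun x => ρ x * (quot F v x ^ 2 * ⟪x, v⟫)) =ᶠ[nhds x] 0 := by
        filter_upwards [h0] with y hy
        simp [hy]
      have : HasFDerivAt (fun x => ρ x * (quot F v x ^ 2 * ⟪x, v⟫)) (0 : E d →L[ℝ] ℝ) x :=
        (hasFDerivAt_const (0 : ℝ) x).congr_of_eventuallyEq h3
      simpa using this.hasLineDerivAt v
  rw [integral_add i4 i6, integral_sub i5 i3, integral_add i1 i2, integral_const_mul, integral_const_mul,
    integral_const_mul, e1] at e2
  have e3 : ∫ x, ρ x * (2 * (fderiv ℝ F x v * quot F v x))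
      = 2 * ∫ x, ρ x * (fderiv ℝ F x v * quot F v x) := by
    rw [← integral_const_mul]
    congr 1
    funext x
    ring
  rw [e3]
  linarith

theorem integral_double (hF : IsZeroHom F) (hρ : IsTest R ρ) :
    ∫ x, ρ x * ∑ u ∈ R, ∑ v ∈ R, k u * k v * ⟪u, v⟫ * (quot F u x * quot F v x)
      = ∫ x, ρ x * ∑ u ∈ R, ∑ v ∈ R, k u * k v * ⟪u, v⟫ / (⟪x, u⟫ * ⟪x, v⟫)
          * (F x - F (refl v x)) ^ 2 := by
  have hV := isOpen_regular₀ R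
  have hI : ∀ h : E d → ℝ, ContinuousOn h (regular₀ R) → Integrable fun x => ρ x * h x :=
    fun h => integrable_mul_of_tsupport hV hρ.contDiff.continuous hρ.compact hρ.supp
  have hc := hF.continuousOn.mono (Set.inter_subset_right : regular₀ R ⊆ _)
  have hcr : ∀ v, ContinuousOn (fun x => F (refl v x)) (regular₀ R) := fun v =>
    (hF.continuousOn_refl v).mono Set.inter_subset_right
  have ht : ∀ u ∈ R, ∀ v ∈ R,
      ContinuousOn (fun x => k u * k v * ⟪u, v⟫ / (⟪x, u⟫ * ⟪x, v⟫)) (regular₀ R) :=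
    fun u hu v hv => continuousOn_const.div (by fun_prop)
      fun x hx => mul_ne_zero (hx.1 u hu) (hx.1 v hv)
  have i1 := hI (fun x => ∑ u ∈ R, ∑ v ∈ R, k u * k v * ⟪u, v⟫ * (quot F u x * quot F v x))
    (continuousOn_finsetSum _ fun u hu => continuousOn_finsetSum _ fun v hv =>
      continuousOn_const.mul ((hF.continuousOn_quot hu).mul (hF.continuousOn_quot hv)))
  have i2 := hI (fun x => ∑ u ∈ R, ∑ v ∈ R, k u * k v * ⟪u, v⟫ / (⟪x, u⟫ * ⟪x, v⟫)
          * (F x - F (refl v x)) ^ 2)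
    (continuousOn_finsetSum _ fun u hu => continuousOn_finsetSum _ fun v hv =>
      (ht u hu v hv).mul ((hc.sub (hcr v)).pow 2))
  rw [← sub_eq_zero, ← integral_sub i1 i2]
  have i3 : ∀ u ∈ R, ∀ v ∈ R, Integrable fun x => ρ x * (k u * k v * ⟪u, v⟫ / (⟪x, u⟫ * ⟪x, v⟫)
      * (F (refl u x) * F (refl v x) - F (refl v x) ^ 2)) := fun u hu v hv =>
    hI _ ((ht u hu v hv).mul (((hcr u).mul (hcr v)).sub ((hcr v).pow 2)))
  have e1 : ∀ x, ρ x * ∑ u ∈ R, ∑ v ∈ R, k u * k v * ⟪u, v⟫ * (quot F u x * quot F v x)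
      - ρ x * ∑ u ∈ R, ∑ v ∈ R, k u * k v * ⟪u, v⟫ / (⟪x, u⟫ * ⟪x, v⟫) * (F x - F (refl v x)) ^ 2
      = ∑ u ∈ R, ∑ v ∈ R, ρ x * (k u * k v * ⟪u, v⟫ / (⟪x, u⟫ * ⟪x, v⟫)
      * (F (refl u x) * F (refl v x) - F (refl v x) ^ 2)) := by
    intro x
    have s1 : ∑ u ∈ R, ∑ v ∈ R, k u * k v * ⟪u, v⟫ / (⟪x, u⟫ * ⟪x, v⟫) * F (refl u x)
        = ∑ u ∈ R, ∑ v ∈ R, k u * k v * ⟪u, v⟫ / (⟪x, u⟫ * ⟪x, v⟫) * F (refl v x) := by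
      rw [Finset.sum_comm]
      refine Finset.sum_congr rfl fun u _ => Finset.sum_congr rfl fun v _ => ?_
      rw [real_inner_comm, mul_comm (k v), mul_comm ⟪x, v⟫]
    simp_rw [← Finset.mul_sum]
    rw [← mul_sub, ← Finset.sum_sub_distrib]
    simp_rw [← Finset.sum_sub_distrib]
    congr 1
    rw [← sub_eq_zero, ← Finset.sum_sub_distrib]
    simp_rw [← Finset.sum_sub_distrib]
    rw [← sub_eq_zero, ← Finset.sum_sub_distrib] at s1
    simp_rw [← Finset.sum_sub_distrib] at s1
    rw [← mul_zero (-F x), ← s1, Finset.mul_sum]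
    refine Finset.sum_congr rfl fun u _ => ?_
    rw [Finset.mul_sum]
    refine Finset.sum_congr rfl fun v _ => ?_
    simp only [quot, div_eq_mul_inv, mul_inv]
    ring
  simp_rw [e1]
  rw [integral_finsetSum _ fun u hu => integrable_finsetSum _ fun v hv => i3 u hu v hv]
  have e2 : ∀ u ∈ R, ∫ x, ∑ v ∈ R, ρ x * (k u * k v * ⟪u, v⟫ / (⟪x, u⟫ * ⟪x, v⟫)
      * (F (refl u x) * F (refl v x) - F (refl v x) ^ 2)) =
      ∑ v ∈ R, ∫ x, ρ x * (k u * k v * ⟪u, v⟫ / (⟪x, refl v u⟫ * -⟪x, v⟫)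
      * (F (refl u (refl v x)) * F x - F x ^ 2)) := by
    intro u hu
    rw [integral_finsetSum _ fun v hv => i3 u hu v hv]
    refine Finset.sum_congr rfl fun v hv => ?_
    rw [← integral_refl v]
    simp_rw [hρ.inv v hv, refl_refl, inner_refl_self, inner_refl_left]
  have i4 : ∀ u ∈ R, ∀ v ∈ R, Integrable fun x => ρ x * (k u * k v * ⟪u, v⟫ /
      (⟪x, refl v u⟫ * -⟪x, v⟫) * (F (refl u (refl v x)) * F x - F x ^ 2)) := by
    intro u hu v hv
    refine hI _ (ContinuousOn.mul (continuousOn_const.div (by fun_prop)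
      fun x hx => mul_ne_zero (hx.1 _ (hR.refl_mem v hv u hu)) (neg_ne_zero.2 (hx.1 v hv))) ?_)
    refine ContinuousOn.sub (ContinuousOn.mul ?_ hc) (hc.pow 2)
    exact (hF.continuousOn_refl u).comp (refl v).continuous.continuousOn
      fun x hx => by simpa using hx.2
  rw [Finset.sum_congr rfl e2]
  rw [Finset.sum_congr rfl fun u hu => (integral_finsetSum R fun v hv => i4 u hu v hv).symm,
    ← integral_finsetSum _ fun u hu => integrable_finsetSum _ fun v hv => i4 u hu v hv]
  rw [← integral_zero (E d) ℝ]
  congr 1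
  funext x
  by_cases hx : x ∈ tsupport ρ
  swap
  · simp [image_eq_zero_of_notMem_tsupport hx]
  have hxr := (hρ.supp hx).1
  have key := hR.sum_sum_rotation hxr (fun g => F (g x) * F x - F x ^ 2) (by simp [sq])
  simp_rw [← Finset.mul_sum]
  rw [Finset.sum_comm]
  rw [← mul_zero (ρ x), ← key]
  congr 1
  refine Finset.sum_congr rfl fun v hv => ?_
  rw [← hR.sum_refl hv]
  refine Finset.sum_congr rfl fun u hu => ?_
  rw [hR.invariant v hv u hu, refl_refl, refl_refl_apply, refl_refl, inner_refl_left, refl_self,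
    inner_neg_right, real_inner_comm u v, mul_comm (k v)]
  simp only [Function.comp]
  rw [mul_neg, mul_neg, neg_div_neg_eq, mul_comm ⟪x, u⟫]

theorem energy_identity (hF : IsZeroHom F) (hρ : IsTest R ρ) :
    ∫ x, ρ x * ‖gradient F x + ∑ v ∈ R, (k v * quot F v x) • v‖ ^ 2 =
      (∫ x, ρ x * (‖gradient F x‖ ^ 2 + ∑ v ∈ R, k v * quot F v x ^ 2))
      - 1 / 2 * ∑ v ∈ R, k v * ∫ x, (fderiv ℝ ρ x v - ρ x * ∑ u ∈ R, 2 * k u * ⟪u, v⟫ / ⟪x, u⟫)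
          * (quot F v x ^ 2 * ⟪x, v⟫) := by
  have hV := isOpen_regular₀ R
  have hI : ∀ h : E d → ℝ, ContinuousOn h (regular₀ R) → Integrable fun x => ρ x * h x :=
    fun h => integrable_mul_of_tsupport hV hρ.contDiff.continuous hρ.compact hρ.supp
  have hq : ∀ v ∈ R, ContinuousOn (quot F v) (regular₀ R) := fun v hv => hF.continuousOn_quot hv
  have hgrad : ContinuousOn (fun x => gradient F x) (regular₀ R) :=
    (((InnerProductSpace.toDual ℝ (E d)).symm.continuous).comp_continuousOn
      hF.continuousOn_fderiv).mono Set.inter_subset_right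
  have hinner : ∀ x v : E d, ⟪gradient F x, v⟫ = fderiv ℝ F x v := fun x v => by
    rw [gradient, InnerProductSpace.toDual_symm_apply]
  have hρd : ∀ v, Continuous fun x => fderiv ℝ ρ x v := fun v =>
    (hρ.contDiff.continuous_fderiv one_ne_zero).clm_apply continuous_const
  have hρs : ∀ v, tsupport (fun x => fderiv ℝ ρ x v) ⊆ tsupport ρ := fun v =>
    tsupport_fderiv_apply_subset ℝ v
  have hρc : ∀ v, HasCompactSupport fun x => fderiv ℝ ρ x v := fun v =>
    hρ.compact.of_isClosed_subset (isClosed_tsupport _) (hρs v)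
  have j1 : Integrable fun x => ρ x * ‖gradient F x‖ ^ 2 := hI _ (hgrad.norm.pow 2)
  have j2 : ∀ v ∈ R, Integrable fun x => k v * (ρ x * (2 * (fderiv ℝ F x v * quot F v x))) :=
    fun v hv => (hI _ (continuousOn_const.mul
      ((hF.continuousOn_fderiv_apply R v).mul (hq v hv)))).const_mul _
  have j2' : Integrable fun x => ∑ v ∈ R, k v * (ρ x * (2 * (fderiv ℝ F x v * quot F v x))) :=
    integrable_finsetSum _ j2
  have j3 : Integrable fun x => ρ x *
      ∑ u ∈ R, ∑ v ∈ R, k u * k v * ⟪u, v⟫ * (quot F u x * quot F v x) :=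
    hI _ (continuousOn_finsetSum _ fun u hu => continuousOn_finsetSum _ fun v hv =>
      continuousOn_const.mul ((hq u hu).mul (hq v hv)))
  have j4 : ∀ v ∈ R, Integrable fun x => k v * (ρ x * quot F v x ^ 2) :=
    fun v hv => (hI _ ((hq v hv).pow 2)).const_mul _
  have j4' : Integrable fun x => ∑ v ∈ R, k v * (ρ x * quot F v x ^ 2) :=
    integrable_finsetSum _ j4
  have j5 : ∀ v ∈ R, Integrable fun x => fderiv ℝ ρ x v * (quot F v x ^ 2 * ⟪x, v⟫) :=
    fun v hv => integrable_mul_of_tsupport hV (hρd v) (hρc v) ((hρs v).trans hρ.supp)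
      (((hq v hv).pow 2).mul (by fun_prop))
  have j6 : ∀ v ∈ R, Integrable fun x => ρ x * ((∑ u ∈ R, 2 * k u * ⟪u, v⟫ / ⟪x, u⟫)
      * (quot F v x ^ 2 * ⟪x, v⟫)) := fun v hv => hI _ ((continuousOn_finsetSum _ fun u hu =>
        continuousOn_const.div (by fun_prop) fun x hx => hx.1 u hu).mul
          (((hq v hv).pow 2).mul (by fun_prop)))
  have j7 : Integrable fun x => ρ x * ‖gradient F x‖ ^ 2
      + ∑ v ∈ R, k v * (ρ x * (2 * (fderiv ℝ F x v * quot F v x))) := j1.add j2'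
  have e1 : ∀ x, ρ x * ‖gradient F x + ∑ v ∈ R, (k v * quot F v x) • v‖ ^ 2
      = ρ x * ‖gradient F x‖ ^ 2
        + ∑ v ∈ R, k v * (ρ x * (2 * (fderiv ℝ F x v * quot F v x)))
        + ρ x * ∑ u ∈ R, ∑ v ∈ R, k u * k v * ⟪u, v⟫ * (quot F u x * quot F v x) := by
    intro x
    rw [norm_add_sq_real, ← real_inner_self_eq_norm_sq (∑ v ∈ R, _), sum_inner, inner_sum]
    simp_rw [inner_sum, inner_smul_left, inner_smul_right, hinner]
    rw [mul_add, mul_add, Finset.mul_sum, Finset.mul_sum]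
    congr 2
    · refine Finset.sum_congr rfl fun v _ => ?_
      ring
    · refine Finset.sum_congr rfl fun u _ => Finset.sum_congr rfl fun v _ => ?_
      simp only [conj_trivial]
      ring
  have e2 : ∀ x, ρ x * (‖gradient F x‖ ^ 2 + ∑ v ∈ R, k v * quot F v x ^ 2)
      = ρ x * ‖gradient F x‖ ^ 2 + ∑ v ∈ R, k v * (ρ x * quot F v x ^ 2) := by
    intro x
    rw [mul_add, Finset.mul_sum]
    congr 1
    exact Finset.sum_congr rfl fun v _ => by ring
  have e3 : ∀ v ∈ R, ∫ x, (fderiv ℝ ρ x v - ρ x * ∑ u ∈ R, 2 * k u * ⟪u, v⟫ / ⟪x, u⟫)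
          * (quot F v x ^ 2 * ⟪x, v⟫) = (∫ x, fderiv ℝ ρ x v * (quot F v x ^ 2 * ⟪x, v⟫))
          - ∫ x, ρ x * ((∑ u ∈ R, 2 * k u * ⟪u, v⟫ / ⟪x, u⟫) * (quot F v x ^ 2 * ⟪x, v⟫)) := by
    intro v hv
    rw [← integral_sub (j5 v hv) (j6 v hv)]
    congr 1
    funext x
    ring
  have e4 : ∫ x, ρ x * ∑ u ∈ R, ∑ v ∈ R, k u * k v * ⟪u, v⟫ * (quot F u x * quot F v x)
      = 1 / 2 * ∑ v ∈ R, k v *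
        ∫ x, ρ x * ((∑ u ∈ R, 2 * k u * ⟪u, v⟫ / ⟪x, u⟫) * (quot F v x ^ 2 * ⟪x, v⟫)) := by
    rw [hR.integral_double hF hρ, Finset.mul_sum]
    simp_rw [← integral_const_mul]
    rw [← integral_finsetSum _ fun v hv => ((j6 v hv).const_mul _).const_mul _]
    congr 1
    funext x
    by_cases hx : x ∈ tsupport ρ
    swap
    · simp [image_eq_zero_of_notMem_tsupport hx]
    have hxr := (hρ.supp hx).1
    rw [Finset.sum_comm, Finset.mul_sum]
    refine Finset.sum_congr rfl fun v hv => ?_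
    rw [Finset.sum_mul, Finset.mul_sum, Finset.mul_sum, Finset.mul_sum, Finset.mul_sum]
    refine Finset.sum_congr rfl fun u hu => ?_
    have h1 := hxr u hu
    have h2 := hxr v hv
    simp only [quot]
    generalize ⟪x, v⟫ = l at h2 ⊢
    generalize ⟪x, u⟫ = m at h1 ⊢
    field_simp
  simp_rw [e1, e2]
  rw [integral_add j7 j3, integral_add j1 j2', integral_add j1 j4', e4,
    integral_finsetSum _ j2, integral_finsetSum _ j4]
  simp_rw [integral_const_mul]
  have s1 := Finset.sum_congr rfl fun v hv => congrArg (k v * ·) (hR.integral_cross hF hρ hv)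
  have s2 := Finset.sum_congr rfl fun v hv => congrArg (k v * ·) (e3 v hv)
  rw [s1, s2]
  simp only [mul_sub, Finset.sum_sub_distrib]
  have (g : E d → ℝ) : ∑ v ∈ R, k v * (1 / 2 * g v) = 1 / 2 * ∑ v ∈ R, k v * g v := by
    rw [Finset.mul_sum]
    exact Finset.sum_congr rfl fun v _ => by ring
  rw [this]
  ring

end IsWeighted

end DunklSphere
namespace DunklSphere

variable {d : ℕ}

theorem hasDerivAt_abs_affine_rpow {l b a : ℝ} (hl : l ≠ 0) :
    HasDerivAt (fun t : ℝ => |l + t * b| ^ a) (|l| ^ a * (a * b / l)) 0 := by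
  have h1 : HasDerivAt (fun t : ℝ => l + t * b) b 0 := by
    simpa using ((hasDerivAt_id (0 : ℝ)).mul_const b).const_add l
  have h0 : l + 0 * b ≠ 0 := by simpa using hl
  have h2' : HasDerivAt (fun t : ℝ => |l + t * b|) (SignType.sign (l + 0 * b) * b) 0 :=
    HasDerivAt.comp (h₂ := fun x : ℝ => |x|) (0 : ℝ) (hasDerivAt_abs h0) h1
  have h2 := h2'.rpow_const (p := a) (Or.inl (abs_ne_zero.2 h0))
  refine h2.congr_deriv ?_
  rw [zero_mul, add_zero, Real.rpow_sub_one (abs_ne_zero.2 hl)]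
  rcases lt_or_gt_of_ne hl with h | h
  · simp only [h, sign_neg, abs_of_neg, SignType.coe_neg_one]
    have : -l ≠ 0 := neg_ne_zero.2 hl
    field_simp
  · simp only [h, sign_pos, abs_of_pos, SignType.coe_one]
    field_simp

section Weight

variable {R : Finset (E d)} {k : E d → ℝ}

theorem wt_nonneg (R : Finset (E d)) (k : E d → ℝ) (x : E d) : 0 ≤ wt R k x :=
  Finset.prod_nonneg fun _ _ => Real.rpow_nonneg (abs_nonneg _) _

theorem wt_pos {x : E d} (hx : x ∈ regular R) : 0 < wt R k x :=
  Finset.prod_pos fun v hv => Real.rpow_pos_of_pos (abs_pos.2 (hx v hv)) _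

theorem continuous_wt (hk : ∀ v ∈ R, 0 < k v) : Continuous (wt R k) := by
  refine continuous_finsetProd _ fun v hv => ?_
  exact (by fun_prop : Continuous fun x : E d => |⟪x, v⟫|).rpow_const
    fun x => Or.inr (by linarith [hk v hv])

theorem wt_smul {r : ℝ} (hr : 0 < r) (x : E d) :
    wt R k (r • x) = r ^ (2 * ∑ v ∈ R, k v) * wt R k x := by
  unfold wt
  rw [Finset.mul_sum, Real.rpow_sum_of_pos hr, ← Finset.prod_mul_distrib]
  refine Finset.prod_congr rfl fun v _ => ?_
  rw [inner_smul_left, abs_mul, Real.mul_rpow (abs_nonneg _) (abs_nonneg _)]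
  simp [abs_of_pos hr]

theorem contDiffAt_wt {x : E d} (hx : x ∈ regular R) : ContDiffAt ℝ 1 (wt R k) x := by
  refine contDiffAt_prod fun v hv => ?_
  have h1 : ContDiffAt ℝ 1 (fun x : E d => ⟪x, v⟫) x := contDiffAt_id.inner ℝ contDiffAt_const
  exact (h1.abs (hx v hv)).rpow_const_of_ne (abs_ne_zero.2 (hx v hv))

theorem fderiv_wt {x : E d} (hx : x ∈ regular R) (w : E d) :
    fderiv ℝ (wt R k) x w = wt R k x * ∑ u ∈ R, 2 * k u * ⟪u, w⟫ / ⟪x, u⟫ := by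
  classical
  have h1 := ((contDiffAt_wt (k := k) hx).differentiableAt one_ne_zero).hasFDerivAt.hasLineDerivAt w
  have h2 : HasDerivAt (fun t : ℝ => wt R k (x + t • w))
      (wt R k x * ∑ u ∈ R, 2 * k u * ⟪u, w⟫ / ⟪x, u⟫) 0 := by
    have h3 : ∀ u ∈ R, HasDerivAt (fun t : ℝ => |⟪x + t • w, u⟫| ^ (2 * k u))
        (|⟪x, u⟫| ^ (2 * k u) * (2 * k u * ⟪u, w⟫ / ⟪x, u⟫)) 0 := by
      intro u hu
      have := hasDerivAt_abs_affine_rpow (b := ⟪u, w⟫) (a := 2 * k u) (hx u hu)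
      simpa [inner_add_left, inner_smul_left, real_inner_comm] using this
    have h4 := HasDerivAt.fun_finsetProd h3
    refine h4.congr_deriv ?_
    rw [Finset.mul_sum]
    refine Finset.sum_congr rfl fun u hu => ?_
    rw [smul_eq_mul, ← mul_assoc]
    congr 1
    simp only [zero_smul, add_zero]
    exact Finset.prod_erase_mul R (fun v => |⟪x, v⟫| ^ (2 * k v)) hu
  exact h1.unique h2

end Weight

section Cutoff

/-- A smooth cutoff that vanishes on `(-∞, 1]` and equals one on `[2, ∞)`. -/
noncomputable def cutoff (t : ℝ) : ℝ := Real.smoothTransition (t - 1)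

theorem contDiff_cutoff : ContDiff ℝ 1 cutoff :=
  Real.smoothTransition.contDiff.comp (contDiff_id.sub contDiff_const)

theorem cutoff_nonneg (t : ℝ) : 0 ≤ cutoff t := Real.smoothTransition.nonneg _

theorem cutoff_le_one (t : ℝ) : cutoff t ≤ 1 := Real.smoothTransition.le_one _

theorem cutoff_of_le {t : ℝ} (ht : t ≤ 1) : cutoff t = 0 :=
  Real.smoothTransition.zero_of_nonpos (by linarith)

theorem cutoff_of_ge {t : ℝ} (ht : 2 ≤ t) : cutoff t = 1 :=
  Real.smoothTransition.one_of_one_le (by linarith)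

theorem deriv_cutoff_of_lt {t : ℝ} (ht : t < 1) : deriv cutoff t = 0 := by
  have : cutoff =ᶠ[nhds t] fun _ => 0 := by
    filter_upwards [Iio_mem_nhds ht] with s hs using cutoff_of_le (le_of_lt hs)
  rw [this.deriv_eq, deriv_const]

theorem deriv_cutoff_of_gt {t : ℝ} (ht : 2 < t) : deriv cutoff t = 0 := by
  have : cutoff =ᶠ[nhds t] fun _ => 1 := by
    filter_upwards [Ioi_mem_nhds ht] with s hs using cutoff_of_ge (le_of_lt hs)
  rw [this.deriv_eq, deriv_const]

theorem exists_bound_deriv_cutoff : ∃ B : ℝ, 0 ≤ B ∧ ∀ t, |deriv cutoff t * t| ≤ B := by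
  have hc : Continuous fun t => deriv cutoff t * t :=
    (contDiff_cutoff.continuous_deriv_one).mul continuous_id
  obtain ⟨B, hB⟩ := (isCompact_Icc (a := (1 : ℝ)) (b := 2)).exists_bound_of_continuousOn
    hc.continuousOn
  refine ⟨max 0 B, le_max_left _ _, fun t => ?_⟩
  rcases lt_or_ge t 1 with h | h
  · simp [deriv_cutoff_of_lt h]
  rcases lt_or_ge 2 t with h2 | h2
  · simp [deriv_cutoff_of_gt h2]
  · exact (hB t ⟨h, h2⟩).trans (le_max_right _ _)

end Cutoff

section Test

variable {R : Finset (E d)} {k : E d → ℝ} (hR : IsWeighted R k)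

/-- The localized weight: radial profile `β(‖x‖²)` and cutoff near the root hyperplanes. -/
noncomputable def testWt (R : Finset (E d)) (k : E d → ℝ) (β : ℝ → ℝ) (n : ℕ) (x : E d) : ℝ :=
  β (‖x‖ ^ 2) * cutoff (n * wt R (fun _ => 1) x) * wt R k x

/-- Radial profiles: `C¹`, nonnegative, supported in `[1, 3]`. -/
structure IsProfile (β : ℝ → ℝ) : Prop where
  contDiff : ContDiff ℝ 1 β
  nonneg : ∀ t, 0 ≤ β t
  eq_zero : ∀ t, t ∉ Set.Icc (1 : ℝ) 3 → β t = 0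

theorem IsProfile.deriv_eq_zero {β : ℝ → ℝ} (hβ : IsProfile β) {t : ℝ}
    (ht : t ∉ Set.Icc (1 : ℝ) 3) : deriv β t = 0 := by
  have : β =ᶠ[nhds t] fun _ => 0 := by
    filter_upwards [isClosed_Icc.isOpen_compl.mem_nhds ht] with s hs using hβ.eq_zero s hs
  rw [this.deriv_eq, deriv_const]

include hR

theorem tsupport_testWt {β : ℝ → ℝ} (hβ : IsProfile β) (n : ℕ) :
    tsupport (testWt R k β n) ⊆ {x | ‖x‖ ^ 2 ∈ Set.Icc (1 : ℝ) 3 ∧ 1 ≤ n * wt R (fun _ => 1) x} := by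
  have hc := continuous_wt hR.one.pos
  refine closure_minimal (fun x hx => ?_) ?_
  · rw [Function.mem_support, testWt] at hx
    constructor
    · by_contra h
      exact hx (by rw [hβ.eq_zero _ h]; ring)
    · by_contra h
      exact hx (by rw [cutoff_of_le (le_of_not_ge h)]; ring)
  · exact (isClosed_Icc.preimage (continuous_norm.pow 2)).inter
      (isClosed_le continuous_const (continuous_const.mul hc))

omit hR in
theorem mem_regular_of_le {n : ℕ} {x : E d} (h : 1 ≤ n * wt R (fun _ => 1) x) :
    x ∈ regular R := by
  intro v hv h0
  have : wt R (fun _ => 1) x = 0 := by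
    refine Finset.prod_eq_zero hv ?_
    simp [h0]
  rw [this, mul_zero] at h
  linarith

omit hR in
theorem contDiffAt_testWt {β : ℝ → ℝ} (hβ : IsProfile β) (n : ℕ) {x : E d} (hx : x ∈ regular R) :
    ContDiffAt ℝ 1 (testWt R k β n) x :=
  (((hβ.contDiff.contDiffAt.comp x (contDiff_norm_sq ℝ).contDiffAt).mul
    (contDiff_cutoff.contDiffAt.comp x (contDiffAt_const.mul (contDiffAt_wt hx)))).mul
      (contDiffAt_wt hx))

theorem isTest_testWt {β : ℝ → ℝ} (hβ : IsProfile β) (n : ℕ) : IsTest R (testWt R k β n) where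
  contDiff := contDiff_iff_contDiffAt.2 fun x => by
    by_cases hx : x ∈ tsupport (testWt R k β n)
    · exact contDiffAt_testWt hβ n (mem_regular_of_le (tsupport_testWt hR hβ n hx).2)
    · exact contDiffAt_const.congr_of_eventuallyEq (notMem_tsupport_iff_eventuallyEq.1 hx)
  compact := by
    refine (isCompact_closedBall (0 : E d) 2).of_isClosed_subset (isClosed_tsupport _)
      fun x hx => ?_
    have := (tsupport_testWt hR hβ n hx).1.2
    rw [mem_closedBall_zero_iff]
    nlinarith [norm_nonneg x]
  supp := fun x hx => by
    have h := tsupport_testWt hR hβ n hx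
    refine ⟨mem_regular_of_le h.2, fun h0 => ?_⟩
    rw [Set.mem_singleton_iff] at h0
    have h1 := h.1.1
    rw [h0] at h1
    norm_num at h1
  inv := fun v hv x => by
    simp only [testWt]
    rw [hR.wt_refl hv, hR.one.wt_refl hv, LinearIsometryEquiv.norm_map]

omit hR in
theorem fderiv_testWt {β : ℝ → ℝ} (hβ : IsProfile β) (n : ℕ) {x : E d} (hx : x ∈ regular R)
    (w : E d) : fderiv ℝ (testWt R k β n) x w
      - testWt R k β n x * ∑ u ∈ R, 2 * k u * ⟪u, w⟫ / ⟪x, u⟫ =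
      wt R k x * (deriv β (‖x‖ ^ 2) * (2 * ⟪x, w⟫) * cutoff (n * wt R (fun _ => 1) x)
        + β (‖x‖ ^ 2) * (deriv cutoff (n * wt R (fun _ => 1) x) * (n * wt R (fun _ => 1) x))
          * ∑ u ∈ R, 2 * ⟪u, w⟫ / ⟪x, u⟫) := by
  have h1 : HasDerivAt (fun t : ℝ => wt R k (x + t • w)) _ 0 :=
    ((contDiffAt_wt (k := k) hx).differentiableAt one_ne_zero).hasFDerivAt.hasLineDerivAt w
  have h2 : HasDerivAt (fun t : ℝ => wt R (fun _ => 1) (x + t • w)) _ 0 :=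
    ((contDiffAt_wt (k := fun _ => 1) hx).differentiableAt one_ne_zero).hasFDerivAt.hasLineDerivAt w
  have h3 : HasDerivAt (fun t : ℝ => ‖x + t • w‖ ^ 2) (2 * ⟪x, w⟫) 0 := by
    have h := ((hasStrictFDerivAt_norm_sq x).hasFDerivAt).hasLineDerivAt w
    simpa using (show HasDerivAt _ _ _ from h)
  have h3' : HasDerivAt β (deriv β (‖x‖ ^ 2)) (‖x + (0 : ℝ) • w‖ ^ 2) := by
    rw [zero_smul, add_zero]
    exact (hβ.contDiff.differentiable one_ne_zero _).hasDerivAt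
  have h4 := h3'.comp (0 : ℝ) h3
  have h5' : HasDerivAt cutoff (deriv cutoff (n * wt R (fun _ => 1) x))
      (n * wt R (fun _ => 1) (x + (0 : ℝ) • w)) := by
    rw [zero_smul, add_zero]
    exact (contDiff_cutoff.differentiable one_ne_zero _).hasDerivAt
  have h5 := h5'.comp (0 : ℝ) (h2.const_mul (n : ℝ))
  have h6 := (h4.mul h5).mul h1
  have h7 : HasDerivAt (fun t : ℝ => testWt R k β n (x + t • w)) _ 0 :=
    ((contDiffAt_testWt (k := k) hβ n hx).differentiableAt one_ne_zero).hasFDerivAt.hasLineDerivAt w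
  rw [h7.unique h6]
  simp only [Function.comp, Pi.mul_apply, zero_smul, add_zero, fderiv_wt hx, testWt, mul_one]
  ring

end Test

end DunklSphere
namespace DunklSphere

variable {d : ℕ}

section Integrability

theorem integrableOn_abs_rpow {r : ℝ} (hr : -1 < r) :
    IntegrableOn (fun t : ℝ => |t| ^ r) (Set.Icc (-2) 2) := by
  have h1 : IntervalIntegrable (fun t : ℝ => |t| ^ r) volume 0 2 := by
    refine (intervalIntegral.intervalIntegrable_rpow' hr).congr fun t ht => ?_
    rw [Set.uIoc_of_le (by norm_num)] at ht
    simp only [abs_of_pos ht.1]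
  have h2 : IntervalIntegrable (fun t : ℝ => |t| ^ r) volume (-2) 0 := by
    have := h1.comp_sub_left 0
    simpa using this.symm
  have := h2.trans h1
  rwa [intervalIntegrable_iff_integrableOn_Icc_of_le (by norm_num)] at this

theorem integrableOn_abs_coord_rpow {r : ℝ} (hr : -1 < r) (i : Fin d) :
    IntegrableOn (fun x : E d => |x i| ^ r) (ball 0 2) := by
  classical
  let h : Fin d → ℝ → ℝ := fun j =>
    Set.indicator (Set.Icc (-2) 2) (fun t => if j = i then |t| ^ r else 1)
  have hint : ∀ j, Integrable (h j) := by
    intro j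
    rw [integrable_indicator_iff measurableSet_Icc]
    by_cases hj : j = i
    · simp only [hj, if_true]
      exact integrableOn_abs_rpow hr
    · simp only [hj, if_false]
      exact integrableOn_const (by simp)
  have h1 : Integrable (fun x : Fin d → ℝ => ∏ j, h j (x j)) := Integrable.fintype_prod hint
  have h2 : Integrable (fun x : E d => ∏ j, h j (x j)) :=
    (((PiLp.volume_preserving_ofLp (Fin d)).integrable_comp_emb
      (MeasurableEquiv.toLp 2 (Fin d → ℝ)).symm.measurableEmbedding).2 h1)
  refine (h2.integrableOn (s := ball 0 2)).mono' ?_ ?_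
  · refine (Measurable.aestronglyMeasurable ?_)
    have : Continuous fun x : E d => |x i| := by fun_prop
    exact this.measurable.pow_const r
  · refine (ae_restrict_iff' measurableSet_ball).2 (Filter.Eventually.of_forall fun x hx => ?_)
    have hx2 : ∀ j, x j ∈ Set.Icc (-2 : ℝ) 2 := fun j => by
      rw [mem_ball_zero_iff] at hx
      have := (PiLp.norm_apply_le x j).trans hx.le
      rwa [Real.norm_eq_abs, abs_le] at this
    have h3 : ∏ j, h j (x j) = |x i| ^ r := by
      rw [Finset.prod_eq_single i]
      · simp [h, hx2]
      · intro j _ hj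
        simp [h, hx2, hj]
      · simp
    rw [h3, Real.norm_of_nonneg (Real.rpow_nonneg (abs_nonneg _) _)]

theorem integrableOn_abs_inner_rpow {r : ℝ} (hr : -1 < r) {u : E d} (hu : u ≠ 0) :
    IntegrableOn (fun x : E d => |⟪x, u⟫| ^ r) (ball 0 2) := by
  obtain ⟨i⟩ : Nonempty (Fin d) := by
    by_contra h
    rw [not_nonempty_iff] at h
    exact hu (Subsingleton.elim _ _)
  let e : E d := EuclideanSpace.single i ‖u‖
  have hT : refl (u - e) u = e := Submodule.reflection_sub (by simp [e])
  have h1 : ∀ x : E d, |⟪x, u⟫| ^ r = ‖u‖ ^ r * |(refl (u - e) x) i| ^ r := by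
    intro x
    rw [← (refl (u - e)).inner_map_map x u, hT, EuclideanSpace.inner_single_right, abs_mul,
      abs_norm, Real.mul_rpow (norm_nonneg _) (abs_nonneg _)]
    simp
  simp_rw [h1]
  refine Integrable.const_mul ?_ _
  have := ((refl (u - e)).measurePreserving.integrableOn_comp_preimage
    (refl (u - e)).toHomeomorph.measurableEmbedding).2 (integrableOn_abs_coord_rpow hr i)
  have hb : (refl (u - e)) ⁻¹' (ball 0 2) = ball 0 2 := by
    ext x
    simp
  rw [hb] at this
  exact this

variable {R : Finset (E d)} {k : E d → ℝ} (hR : IsWeighted R k)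
include hR

theorem IsWeighted.integrableOn_wt_div {u : E d} (hu : u ∈ R) :
    IntegrableOn (fun x : E d => wt R k x / |⟪x, u⟫|) (ball 0 2) := by
  classical
  have hk := hR.pos u hu
  have hc : Continuous fun x : E d => ∏ v ∈ R.erase u, |⟪x, v⟫| ^ (2 * k v) := by
    refine continuous_finsetProd _ fun v hv => ?_
    exact (by fun_prop : Continuous fun x : E d => |⟪x, v⟫|).rpow_const
      fun x => Or.inr (by linarith [hR.pos v (Finset.mem_of_mem_erase hv)])
  obtain ⟨C, hC⟩ := (isCompact_closedBall (0 : E d) 2).exists_bound_of_continuousOn hc.continuousOn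
  refine ((integrableOn_abs_inner_rpow (r := 2 * k u - 1) (by linarith)
    (hR.ne_zero hu)).const_mul C).mono' ?_ ?_
  · exact ((continuous_wt hR.pos).measurable.div
      (by fun_prop : Continuous fun x : E d => |⟪x, u⟫|).measurable).aestronglyMeasurable
  · refine (ae_restrict_iff' measurableSet_ball).2 (Filter.Eventually.of_forall fun x hx => ?_)
    have hb := hC x (ball_subset_closedBall hx)
    rw [Real.norm_of_nonneg (div_nonneg (wt_nonneg R k x) (abs_nonneg _)), wt,
      ← Finset.mul_prod_erase R _ hu]
    rcases eq_or_ne ⟪x, u⟫ 0 with h0 | h0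
    · rw [h0, abs_zero, div_zero]
      exact mul_nonneg ((norm_nonneg _).trans hb) (Real.rpow_nonneg le_rfl _)
    · rw [Real.rpow_sub_one (abs_ne_zero.2 h0), mul_comm (|⟪x, u⟫| ^ _), mul_div_assoc]
      gcongr
      exact (le_abs_self _).trans hb

end Integrability

section Limit

variable {R : Finset (E d)} {k : E d → ℝ} (hR : IsWeighted R k) {F : E d → ℝ} {β : ℝ → ℝ}

omit hR in
theorem measurable_quot (hF : IsZeroHom F) (v : E d) : Measurable (quot F v) :=
  (hF.measurable.sub (hF.measurable.comp (refl v).continuous.measurable)).div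
    (by fun_prop : Continuous fun x : E d => ⟪x, v⟫).measurable

theorem measurable_gradient (F : E d → ℝ) : Measurable (gradient F) :=
  (InnerProductSpace.toDual ℝ (E d)).symm.continuous.measurable.comp (measurable_fderiv ℝ F)

include hR

theorem IsWeighted.exists_bound_quot (hF : IsZeroHom F) : ∃ L : ℝ, 0 ≤ L ∧
    (∀ x, 1 ≤ ‖x‖ → ‖gradient F x‖ ≤ L) ∧ ∀ v ∈ R, ∀ x, 1 ≤ ‖x‖ → |quot F v x| ≤ L := by
  obtain ⟨L, hL0, hL1, hL2, hL3⟩ := hF.exists_lipschitz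
  refine ⟨2 * L, by linarith, fun x hx => ?_, fun v hv x hx => ?_⟩
  · rw [gradient, LinearIsometryEquiv.norm_map]
    refine (hL2 x (norm_pos_iff.1 (by linarith))).trans ?_
    rw [div_le_iff₀ (by linarith)]
    nlinarith
  · rcases eq_or_ne ⟪x, v⟫ 0 with h0 | h0
    · simpa [quot, h0] using hL0
    rw [quot, abs_div, div_le_iff₀ (abs_pos.2 h0)]
    have h1 := hL3 x (refl v x) (by simp) hx
    rw [hR.refl_eq hv, sub_sub_cancel, norm_smul, ← hR.refl_eq hv, Real.norm_eq_abs,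
      Real.norm_eq_abs] at h1
    have h2 : ‖v‖ ≤ 2 := by nlinarith [hR.norm_sq hv, norm_nonneg v]
    calc _ ≤ _ := h1
      _ ≤ L * (|⟪x, v⟫| * 2) := by gcongr
      _ = _ := by ring

omit hR in
theorem measurable_dunkl (R : Finset (E d)) (k : E d → ℝ) (hF : IsZeroHom F) :
    Measurable fun x => ‖gradient F x + ∑ v ∈ R, (k v * quot F v x) • v‖ ^ 2 :=
  (((measurable_gradient F).add (Finset.measurable_fun_sum _ fun v _ =>
    ((measurable_quot hF v).const_mul _).smul_const _)).norm).pow_const 2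

omit hR in
theorem measurable_dirichlet (R : Finset (E d)) (k : E d → ℝ) (hF : IsZeroHom F) :
    Measurable fun x => ‖gradient F x‖ ^ 2 + ∑ v ∈ R, k v * quot F v x ^ 2 :=
  ((measurable_gradient F).norm.pow_const 2).add (Finset.measurable_fun_sum _ fun v _ =>
    ((measurable_quot hF v).pow_const 2).const_mul _)

theorem IsWeighted.exists_bound_energy (hF : IsZeroHom F) : ∃ C : ℝ, 0 ≤ C ∧
    (∀ x, 1 ≤ ‖x‖ → |‖gradient F x + ∑ v ∈ R, (k v * quot F v x) • v‖ ^ 2| ≤ C) ∧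
    ∀ x, 1 ≤ ‖x‖ → |‖gradient F x‖ ^ 2 + ∑ v ∈ R, k v * quot F v x ^ 2| ≤ C := by
  obtain ⟨L, hL0, hg, hq⟩ := hR.exists_bound_quot hF
  refine ⟨max ((L + ∑ v ∈ R, k v * L * ‖v‖) ^ 2) (L ^ 2 + ∑ v ∈ R, k v * L ^ 2),
    le_max_of_le_left (sq_nonneg _), fun x hx => le_max_of_le_left ?_,
    fun x hx => le_max_of_le_right ?_⟩
  · rw [abs_pow, abs_norm]
    gcongr
    refine (norm_add_le _ _).trans (add_le_add (hg x hx) ((norm_sum_le _ _).trans ?_))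
    refine Finset.sum_le_sum fun v hv => ?_
    have hk := (hR.pos v hv).le
    rw [norm_smul, norm_mul, Real.norm_of_nonneg hk, Real.norm_eq_abs]
    gcongr
    exact hq v hv x hx
  · rw [abs_of_nonneg (add_nonneg (sq_nonneg _) (Finset.sum_nonneg fun v hv =>
      mul_nonneg (hR.pos v hv).le (sq_nonneg _)))]
    exact add_le_add (pow_le_pow_left₀ (norm_nonneg _) (hg x hx) 2)
      (Finset.sum_le_sum fun v hv => mul_le_mul_of_nonneg_left
        (sq_le_sq' (abs_le.1 (hq v hv x hx)).1 (abs_le.1 (hq v hv x hx)).2) (hR.pos v hv).le)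

theorem IsWeighted.integrable_profile {γ : ℝ → ℝ} (hγ : Continuous γ)
    (hγ0 : ∀ t, t ∉ Set.Icc (1 : ℝ) 3 → γ t = 0) {h : E d → ℝ} (hm : Measurable h) {C : ℝ} (hC0 : 0 ≤ C)
    (hC : ∀ x, 1 ≤ ‖x‖ → |h x| ≤ C) : Integrable fun x => γ (‖x‖ ^ 2) * wt R k x * h x := by
  have hc : Continuous fun x : E d => γ (‖x‖ ^ 2) * wt R k x :=
    (hγ.comp (continuous_norm.pow 2)).mul (continuous_wt hR.pos)
  obtain ⟨B, hB⟩ := (isCompact_closedBall (0 : E d) 2).exists_bound_of_continuousOn hc.continuousOn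
  have h0 : ∀ x : E d, x ∉ closedBall (0 : E d) 2 → γ (‖x‖ ^ 2) * wt R k x * h x = 0 := by
    intro x hx
    rw [mem_closedBall_zero_iff, not_le] at hx
    rw [hγ0 _ fun hh => by nlinarith [hh.2]]
    ring
  have hi : IntegrableOn (fun x => γ (‖x‖ ^ 2) * wt R k x * h x) (closedBall (0 : E d) 2) := by
    refine IntegrableOn.of_bound measure_closedBall_lt_top
      (hc.measurable.mul hm).aestronglyMeasurable (B * C) ?_
    refine (ae_restrict_iff' measurableSet_closedBall).2 (Filter.Eventually.of_forall fun x hx => ?_)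
    have hBx := hB x hx
    have hB0 := (norm_nonneg _).trans hBx
    by_cases h1 : 1 ≤ ‖x‖
    · rw [norm_mul]
      exact mul_le_mul hBx (hC x h1) (norm_nonneg _) hB0
    · rw [hγ0 _ fun hh => by nlinarith [hh.1, norm_nonneg x], zero_mul, zero_mul, norm_zero]
      exact mul_nonneg hB0 hC0
  exact (integrableOn_iff_integrable_of_support_subset fun x hx => by
    by_contra h; exact hx (h0 x h)).1 hi

omit hR in
theorem tendsto_cutoff {x : E d} (hx : x ∈ regular R) :
    ∀ᶠ n : ℕ in Filter.atTop, 2 < n * wt R (fun _ => 1) x := by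
  have h0 : 0 < wt R (fun _ => 1) x := wt_pos hx
  have := (tendsto_natCast_atTop_atTop (R := ℝ)).atTop_mul_const h0
  exact this.eventually_gt_atTop 2

theorem IsWeighted.tendsto_integral_cutoff {g : E d → ℝ} (hg : Integrable g) :
    Filter.Tendsto (fun n : ℕ => ∫ x, cutoff (n * wt R (fun _ => 1) x) * g x) Filter.atTop
      (nhds (∫ x, g x)) := by
  refine tendsto_integral_of_dominated_convergence (fun x => ‖g x‖) (fun n => ?_) hg.norm
    (fun n => Filter.Eventually.of_forall fun x => ?_) ?_
  · exact ((contDiff_cutoff.continuous.comp (continuous_const.mul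
      (continuous_wt hR.one.pos))).aestronglyMeasurable).mul hg.1
  · rw [norm_mul, Real.norm_of_nonneg (cutoff_nonneg _)]
    exact mul_le_of_le_one_left (norm_nonneg _) (cutoff_le_one _)
  · filter_upwards [ae_mem_regular fun v hv => hR.ne_zero hv] with x hx
    refine tendsto_const_nhds.congr' ?_
    filter_upwards [tendsto_cutoff hx] with n hn
    rw [cutoff_of_ge hn.le, one_mul]

theorem IsWeighted.tendsto_integral_remainder (hF : IsZeroHom F) (hβ : IsProfile β) {v : E d}
    (hv : v ∈ R) :
    (∀ n : ℕ, Integrable fun x => wt R k x * (β (‖x‖ ^ 2) *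
      (deriv cutoff (n * wt R (fun _ => 1) x) * (n * wt R (fun _ => 1) x))
          * ∑ u ∈ R, 2 * ⟪u, v⟫ / ⟪x, u⟫) * (quot F v x ^ 2 * ⟪x, v⟫)) ∧
    Filter.Tendsto (fun n : ℕ => ∫ x, wt R k x * (β (‖x‖ ^ 2) *
      (deriv cutoff (n * wt R (fun _ => 1) x) * (n * wt R (fun _ => 1) x))
          * ∑ u ∈ R, 2 * ⟪u, v⟫ / ⟪x, u⟫) * (quot F v x ^ 2 * ⟪x, v⟫)) Filter.atTop
      (nhds 0) := by
  obtain ⟨L, hL0, -, hL⟩ := hR.exists_bound_quot hF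
  obtain ⟨B, hB0, hB⟩ := exists_bound_deriv_cutoff
  obtain ⟨D, hD⟩ := (isCompact_Icc (a := (1 : ℝ)) (b := 3)).exists_bound_of_continuousOn
    hβ.contDiff.continuous.continuousOn
  have hD0 : 0 ≤ D := (norm_nonneg _).trans (hD 1 (by norm_num))
  have hmeas : ∀ n : ℕ, AEStronglyMeasurable (fun x : E d => wt R k x * (β (‖x‖ ^ 2) *
      (deriv cutoff (n * wt R (fun _ => 1) x) * (n * wt R (fun _ => 1) x))
          * ∑ u ∈ R, 2 * ⟪u, v⟫ / ⟪x, u⟫) * (quot F v x ^ 2 * ⟪x, v⟫)) := by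
    intro n
    refine Measurable.aestronglyMeasurable ?_
    have m1 := (continuous_wt hR.pos).measurable
    have m2 : Continuous fun x : E d => (n : ℝ) * wt R (fun _ => 1) x :=
      continuous_const.mul (continuous_wt hR.one.pos)
    have m3 : Continuous fun x : E d => β (‖x‖ ^ 2) *
      (deriv cutoff (n * wt R (fun _ => 1) x) * (n * wt R (fun _ => 1) x)) :=
      (hβ.contDiff.continuous.comp (continuous_norm.pow 2)).mul
        (((contDiff_cutoff.continuous_deriv_one).comp m2).mul m2)
    have m4 : Measurable fun x : E d => ∑ u ∈ R, 2 * ⟪u, v⟫ / ⟪x, u⟫ :=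
      Finset.measurable_fun_sum _ fun u _ => measurable_const.div
        (by fun_prop : Continuous fun x : E d => ⟪x, u⟫).measurable
    exact (m1.mul (m3.measurable.mul m4)).mul (((measurable_quot hF v).pow_const 2).mul
      (by fun_prop : Continuous fun x : E d => ⟪x, v⟫).measurable)
  have hint : Integrable (Set.indicator (ball 0 2) (fun x => ∑ u ∈ R, D * B * (2 * |⟪u, v⟫|) * (L ^ 2 * 4) *
      (wt R k x / |⟪x, u⟫|))) := by
    rw [integrable_indicator_iff measurableSet_ball]
    exact integrable_finsetSum _ fun u hu => (hR.integrableOn_wt_div hu).const_mul _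
  have hbd : ∀ (n : ℕ) (x : E d), ‖wt R k x * (β (‖x‖ ^ 2) *
      (deriv cutoff (n * wt R (fun _ => 1) x) * (n * wt R (fun _ => 1) x))
          * ∑ u ∈ R, 2 * ⟪u, v⟫ / ⟪x, u⟫) * (quot F v x ^ 2 * ⟪x, v⟫)‖ ≤ Set.indicator (ball 0 2) (fun x => ∑ u ∈ R, D * B * (2 * |⟪u, v⟫|) * (L ^ 2 * 4) *
      (wt R k x / |⟪x, u⟫|)) x := by
    intro n x
    by_cases hx : ‖x‖ ^ 2 ∈ Set.Icc (1 : ℝ) 3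
    · have hx1 : 1 ≤ ‖x‖ := by nlinarith [hx.1, norm_nonneg x]
      have hx2 : ‖x‖ < 2 := by nlinarith [hx.2, norm_nonneg x]
      rw [Set.indicator_of_mem (by simpa using hx2)]
      have hv2 : ‖v‖ ≤ 2 := by nlinarith [hR.norm_sq hv, norm_nonneg v]
      have b1 : |quot F v x ^ 2 * ⟪x, v⟫| ≤ L ^ 2 * 4 := by
        rw [abs_mul, abs_pow]
        gcongr
        · exact hL v hv x hx1
        · calc |⟪x, v⟫| ≤ ‖x‖ * ‖v‖ := abs_real_inner_le_norm _ _
            _ ≤ 2 * 2 := by gcongr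
            _ = 4 := by norm_num
      have b2 : |∑ u ∈ R, 2 * ⟪u, v⟫ / ⟪x, u⟫| ≤ ∑ u ∈ R, 2 * |⟪u, v⟫| / |⟪x, u⟫| := by
        refine (Finset.abs_sum_le_sum_abs _ _).trans (le_of_eq ?_)
        refine Finset.sum_congr rfl fun u _ => ?_
        rw [abs_div, abs_mul, abs_two]
      have b3 := hB (n * wt R (fun _ => 1) x)
      have b4 : |β (‖x‖ ^ 2)| ≤ D := hD _ hx
      rw [Real.norm_eq_abs, abs_mul, abs_mul, abs_mul, abs_mul (β _),
        abs_of_nonneg (wt_nonneg R k x)]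
      calc _ ≤ wt R k x * (D * B * ∑ u ∈ R, 2 * |⟪u, v⟫| / |⟪x, u⟫|) * (L ^ 2 * 4) := by
            have := wt_nonneg R k x
            gcongr
        _ = _ := by
            rw [Finset.mul_sum, Finset.mul_sum, Finset.sum_mul]
            refine Finset.sum_congr rfl fun u _ => ?_
            ring
    · rw [hβ.eq_zero _ hx]
      simp only [zero_mul, mul_zero, norm_zero]
      refine Set.indicator_nonneg (fun x _ => Finset.sum_nonneg fun u _ => ?_) _
      have := wt_nonneg R k x
      positivity
  refine ⟨fun n => hint.mono' (hmeas n) (Filter.Eventually.of_forall (hbd n)), ?_⟩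
  rw [← integral_zero (E d) ℝ]
  refine tendsto_integral_of_dominated_convergence _ hmeas hint
    (fun n => Filter.Eventually.of_forall (hbd n)) ?_
  · filter_upwards [ae_mem_regular fun v hv => hR.ne_zero hv] with x hx
    refine tendsto_const_nhds.congr' ?_
    filter_upwards [tendsto_cutoff hx] with n hn
    rw [deriv_cutoff_of_gt hn]
    ring

/-- The energy identity with a radial weight. -/
theorem IsWeighted.energy_radial (hF : IsZeroHom F) (hβ : IsProfile β) :
    ∫ x, β (‖x‖ ^ 2) * wt R k x * ‖gradient F x + ∑ v ∈ R, (k v * quot F v x) • v‖ ^ 2 =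
      (∫ x, β (‖x‖ ^ 2) * wt R k x * (‖gradient F x‖ ^ 2 + ∑ v ∈ R, k v * quot F v x ^ 2))
      - ∑ v ∈ R, k v * ∫ x, deriv β (‖x‖ ^ 2) * wt R k x * (F x - F (refl v x)) ^ 2 := by
  obtain ⟨C, hC0, hC1, hC2⟩ := hR.exists_bound_energy hF
  have i1 : Integrable fun x => β (‖x‖ ^ 2) * wt R k x *
      ‖gradient F x + ∑ v ∈ R, (k v * quot F v x) • v‖ ^ 2 :=
    hR.integrable_profile hβ.contDiff.continuous hβ.eq_zero (measurable_dunkl R k hF) hC0 hC1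
  have i2 : Integrable fun x => β (‖x‖ ^ 2) * wt R k x *
      (‖gradient F x‖ ^ 2 + ∑ v ∈ R, k v * quot F v x ^ 2) :=
    hR.integrable_profile hβ.contDiff.continuous hβ.eq_zero (measurable_dirichlet R k hF) hC0 hC2
  have i3 : ∀ v ∈ R, Integrable fun x => deriv β (‖x‖ ^ 2) * wt R k x *
      (F x - F (refl v x)) ^ 2 := by
    intro v hv
    obtain ⟨L', hL0', hL', -⟩ := hF.exists_bound
    refine hR.integrable_profile (C := (L' + L') ^ 2)
      hβ.contDiff.continuous_deriv_one (fun t ht => hβ.deriv_eq_zero ht) ?_ (sq_nonneg _)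
      fun x hx => ?_
    · exact (hF.measurable.sub (hF.measurable.comp (refl v).continuous.measurable)).pow_const 2
    · rw [abs_pow, ← Real.norm_eq_abs]
      have hx0 : x ≠ 0 := norm_pos_iff.1 (by linarith)
      gcongr
      exact (norm_sub_le _ _).trans (add_le_add (hL' x hx0) (hL' _ (by simpa using hx0)))
  have e1 : ∀ v ∈ R, ∀ n : ℕ,
      ∫ x, (fderiv ℝ (testWt R k β n) x v - testWt R k β n x * ∑ u ∈ R, 2 * k u * ⟪u, v⟫ / ⟪x, u⟫)
          * (quot F v x ^ 2 * ⟪x, v⟫) =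
        (∫ x, cutoff (n * wt R (fun _ => 1) x) *
          (2 * (deriv β (‖x‖ ^ 2) * wt R k x * (F x - F (refl v x)) ^ 2))) +
        ∫ x, wt R k x * (β (‖x‖ ^ 2) *
          (deriv cutoff (n * wt R (fun _ => 1) x) * (n * wt R (fun _ => 1) x))
          * ∑ u ∈ R, 2 * ⟪u, v⟫ / ⟪x, u⟫) * (quot F v x ^ 2 * ⟪x, v⟫) := by
    intro v hv n
    have hI : Integrable fun x => cutoff (n * wt R (fun _ => 1) x) *
          (2 * (deriv β (‖x‖ ^ 2) * wt R k x * (F x - F (refl v x)) ^ 2)) := by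
      refine ((i3 v hv).const_mul 2).norm.mono' ?_ (Filter.Eventually.of_forall fun x => ?_)
      · exact ((contDiff_cutoff.continuous.comp (continuous_const.mul
          (continuous_wt hR.one.pos))).aestronglyMeasurable).mul ((i3 v hv).const_mul 2).1
      · rw [norm_mul, Real.norm_of_nonneg (cutoff_nonneg _)]
        exact mul_le_of_le_one_left (norm_nonneg _) (cutoff_le_one _)
    rw [← integral_add hI ((hR.tendsto_integral_remainder hF hβ hv).1 n)]
    refine integral_congr_ae ?_
    filter_upwards [ae_mem_regular fun v hv => hR.ne_zero hv] with x hx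
    rw [fderiv_testWt hβ n hx]
    have : F x - F (refl v x) = quot F v x * ⟪x, v⟫ := by
      rw [quot, div_mul_cancel₀ _ (hx v hv)]
    rw [this]
    ring
  have t1 : ∀ v ∈ R, Filter.Tendsto (fun n : ℕ => ∫ x, (fderiv ℝ (testWt R k β n) x v
      - testWt R k β n x * ∑ u ∈ R, 2 * k u * ⟪u, v⟫ / ⟪x, u⟫) * (quot F v x ^ 2 * ⟪x, v⟫))
      Filter.atTop (nhds (2 * ∫ x, deriv β (‖x‖ ^ 2) * wt R k x * (F x - F (refl v x)) ^ 2)) := by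
    intro v hv
    simp_rw [e1 v hv]
    rw [← integral_const_mul, ← add_zero (∫ x, 2 * _)]
    exact (hR.tendsto_integral_cutoff ((i3 v hv).const_mul 2)).add
      (hR.tendsto_integral_remainder hF hβ hv).2
  have t2 := (hR.tendsto_integral_cutoff i2).sub
    ((tendsto_finsetSum R fun v hv => (t1 v hv).const_mul (k v)).const_mul (1 / 2))
  have t3 := hR.tendsto_integral_cutoff i1
  have e2 : ∀ n : ℕ, ∫ x, cutoff (n * wt R (fun _ => 1) x) * (β (‖x‖ ^ 2) * wt R k x *
      ‖gradient F x + ∑ v ∈ R, (k v * quot F v x) • v‖ ^ 2) =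
      ∫ x, testWt R k β n x * ‖gradient F x + ∑ v ∈ R, (k v * quot F v x) • v‖ ^ 2 := fun n => by
    congr 1
    funext x
    rw [testWt]
    ring
  have e3 : ∀ n : ℕ, ∫ x, cutoff (n * wt R (fun _ => 1) x) * (β (‖x‖ ^ 2) * wt R k x *
      (‖gradient F x‖ ^ 2 + ∑ v ∈ R, k v * quot F v x ^ 2)) =
      ∫ x, testWt R k β n x * (‖gradient F x‖ ^ 2 + ∑ v ∈ R, k v * quot F v x ^ 2) := fun n => by
    congr 1
    funext x
    rw [testWt]
    ring
  simp_rw [e2, hR.energy_identity hF (isTest_testWt hR hβ _)] at t3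
  simp_rw [e3] at t2
  rw [tendsto_nhds_unique t3 t2, Finset.mul_sum]
  congr 1
  refine Finset.sum_congr rfl fun v _ => ?_
  ring

end Limit

end DunklSphere
namespace DunklSphere

variable {d : ℕ}

theorem exists_profile : ∃ β : ℝ → ℝ, IsProfile β ∧ ∀ t ∈ Set.Icc (3 / 2 : ℝ) (5 / 2), β t = 1 := by
  let β : ContDiffBump (2 : ℝ) := ⟨1 / 2, 1, by norm_num, by norm_num⟩
  refine ⟨β, ⟨β.contDiff, fun t => β.nonneg, fun t ht => ?_⟩, fun t ht => ?_⟩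
  · refine β.zero_of_le_dist ?_
    change 1 ≤ dist t 2
    rw [Real.dist_eq]
    by_contra h
    rw [not_le, abs_lt] at h
    exact ht ⟨by linarith, by linarith⟩
  · refine β.one_of_mem_closedBall ?_
    change t ∈ closedBall 2 (1 / 2)
    rw [Real.closedBall_eq_Icc]
    exact ⟨by linarith [ht.1], by linarith [ht.2]⟩

theorem integrableOn_Ioi_of_support {g : ℝ → ℝ} (hg : ContinuousOn g (Set.Ioi 0))
    (h0 : ∀ r, 0 < r → r ^ 2 ∉ Set.Icc (1 : ℝ) 3 → g r = 0) : IntegrableOn g (Set.Ioi 0) := by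
  have h1 : IntegrableOn g (Set.Icc 1 2) :=
    (hg.mono fun r hr => lt_of_lt_of_le one_pos hr.1).integrableOn_Icc
  refine h1.of_forall_sdiff_eq_zero measurableSet_Ioi fun r hr => h0 r hr.1 fun h => hr.2 ?_
  have hr0 : 0 < r := hr.1
  exact ⟨by nlinarith [h.1], by nlinarith [h.2]⟩

theorem IsProfile.integral_radial {β : ℝ → ℝ} (hβ : IsProfile β) (a : ℝ) :
    2 * ∫ r in Set.Ioi (0 : ℝ), r * deriv β (r ^ 2) * r ^ a =
      -(a * ∫ r in Set.Ioi (0 : ℝ), β (r ^ 2) * r ^ (a - 1)) := by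
  have hr : ∀ b : ℝ, ContinuousOn (fun r : ℝ => r ^ b) (Set.Ioi 0) := fun b r hr =>
    (Real.continuousAt_rpow_const r b (Or.inl (ne_of_gt hr))).continuousWithinAt
  have hb : Continuous fun r : ℝ => β (r ^ 2) := hβ.contDiff.continuous.comp (continuous_pow 2)
  have hb' : Continuous fun r : ℝ => deriv β (r ^ 2) :=
    hβ.contDiff.continuous_deriv_one.comp (continuous_pow 2)
  have i1 : IntegrableOn (fun r : ℝ => 2 * (r * deriv β (r ^ 2) * r ^ a)) (Set.Ioi 0) :=
    integrableOn_Ioi_of_support (continuousOn_const.mul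
      ((continuous_id.mul hb').continuousOn.mul (hr a)))
      fun r _ h => by rw [hβ.deriv_eq_zero h]; ring
  have i2 : IntegrableOn (fun r : ℝ => a * (β (r ^ 2) * r ^ (a - 1))) (Set.Ioi 0) :=
    integrableOn_Ioi_of_support (continuousOn_const.mul (hb.continuousOn.mul (hr _)))
      fun r _ h => by rw [hβ.eq_zero _ h]; ring
  have h0 : (fun r : ℝ => β (r ^ 2) * r ^ a) =ᶠ[nhds 0] fun _ => 0 := by
    filter_upwards [Ioo_mem_nhds (show (-1 : ℝ) < 0 by norm_num) one_pos] with r hr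
    rw [hβ.eq_zero _ fun h => by nlinarith [h.1, hr.1, hr.2], zero_mul]
  have h1 : (fun r : ℝ => β (r ^ 2) * r ^ a) =ᶠ[Filter.atTop] fun _ => 0 := by
    filter_upwards [Filter.eventually_gt_atTop 2] with r hr
    rw [hβ.eq_zero _ fun h => by nlinarith [h.2], zero_mul]
  have key := integral_Ioi_of_hasDerivAt_of_tendsto (a := (0 : ℝ)) (m := (0 : ℝ))
    (f := fun r : ℝ => β (r ^ 2) * r ^ a)
    (f' := fun r => 2 * (r * deriv β (r ^ 2) * r ^ a) + a * (β (r ^ 2) * r ^ (a - 1)))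
    (continuousAt_const.congr h0.symm).continuousWithinAt (fun r hr => ?_) (i1.add i2)
    (tendsto_const_nhds.congr' h1.symm)
  · rw [integral_add i1 i2, h0.eq_of_nhds, integral_const_mul, integral_const_mul] at key
    linarith
  · have d1 : HasDerivAt (fun r : ℝ => β (r ^ 2)) (deriv β (r ^ 2) * (2 * r)) r := by
      refine (HasDerivAt.comp (h₂ := β) r
        (hβ.contDiff.differentiable one_ne_zero (r ^ 2)).hasDerivAt (hasDerivAt_pow 2 r)).congr_deriv ?_
      simp
    have d2 := Real.hasDerivAt_rpow_const (x := r) (p := a) (Or.inl (ne_of_gt hr))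
    refine (d1.mul d2).congr_deriv ?_
    ring

theorem IsProfile.integral_pos {β : ℝ → ℝ} (hβ : IsProfile β)
    (h1 : ∀ t ∈ Set.Icc (3 / 2 : ℝ) (5 / 2), β t = 1) (a : ℝ) :
    0 < ∫ r in Set.Ioi (0 : ℝ), β (r ^ 2) * r ^ a := by
  have hr : ContinuousOn (fun r : ℝ => r ^ a) (Set.Ioi 0) := fun r hr =>
    (Real.continuousAt_rpow_const r a (Or.inl (ne_of_gt hr))).continuousWithinAt
  have hb : Continuous fun r : ℝ => β (r ^ 2) := hβ.contDiff.continuous.comp (continuous_pow 2)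
  have i2 : IntegrableOn (fun r : ℝ => β (r ^ 2) * r ^ a) (Set.Ioi 0) :=
    integrableOn_Ioi_of_support (hb.continuousOn.mul hr)
      fun r _ h => by rw [hβ.eq_zero _ h]; ring
  rw [setIntegral_pos_iff_support_of_nonneg_ae ?_ i2]
  · refine lt_of_lt_of_le ?_ (measure_mono (s := Set.Ioo (1.3 : ℝ) 1.5) fun r hr => ?_)
    · simp; norm_num
    · have hr0 : (0 : ℝ) < r := by linarith [hr.1]
      refine ⟨?_, hr0⟩
      rw [Function.mem_support, h1 _ ⟨by nlinarith [hr.1], by nlinarith [hr.1, hr.2]⟩, one_mul]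
      exact (Real.rpow_pos_of_pos hr0 a).ne'
  · refine (ae_restrict_iff' measurableSet_Ioi).2 (Filter.Eventually.of_forall fun r hr => ?_)
    exact mul_nonneg (hβ.nonneg _) (Real.rpow_nonneg (le_of_lt hr) _)

variable {R : Finset (E d)} {k : E d → ℝ} (hR : IsWeighted R k) {F : E d → ℝ}

theorem IsZeroHom.quot_smul (hF : IsZeroHom F) {r : ℝ} (hr : 0 < r) (v x : E d) :
    quot F v (r • x) = r⁻¹ * quot F v x := by
  rw [quot, map_smul, hF.smul r hr, hF.smul r hr, inner_smul_left, quot]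
  simp only [conj_trivial]
  rw [div_mul_eq_div_div_swap, inv_mul_eq_div]

theorem IsZeroHom.gradient_smul (hF : IsZeroHom F) {r : ℝ} (hr : 0 < r) (x : E d) :
    gradient F (r • x) = r⁻¹ • gradient F x := by
  rw [gradient, hF.fderiv_smul hr, gradient, map_smulₛₗ]
  simp

include hR

/-- The Dunkl energy on the sphere dominates the Dirichlet energy with its jump part. -/
theorem IsWeighted.energy_sphere_le (hd : 2 ≤ d) (hF : IsZeroHom F) :
    ∫ x : S d, wt R k x * (‖gradient F (x : E d)‖ ^ 2 + ∑ v ∈ R, k v * quot F v x ^ 2)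
        ∂surfaceMeasure d ≤
      ∫ x : S d, wt R k x * ‖gradient F (x : E d) + ∑ v ∈ R, (k v * quot F v x) • v‖ ^ 2
        ∂surfaceMeasure d := by
  obtain ⟨β, hβ, hβ1⟩ := exists_profile
  have key := hR.energy_radial hF hβ
  set Γ := ∑ v ∈ R, k v with hΓ
  have hΓ0 : 0 ≤ Γ := Finset.sum_nonneg fun v hv => (hR.pos v hv).le
  have hn : ∀ r : ℝ, 0 < r → ∀ x : S d, ‖r • (x : E d)‖ ^ 2 = r ^ 2 := fun r hr x => by
    rw [norm_smul, Real.norm_of_nonneg hr.le]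
    simp
  rw [integral_polar (by omega) (φ := fun r => β (r ^ 2) * r ^ (2 * Γ) * (r⁻¹) ^ 2)
      (g := fun x => wt R k x * ‖gradient F (x : E d) + ∑ v ∈ R, (k v * quot F v x) • v‖ ^ 2),
    integral_polar (by omega) (φ := fun r => β (r ^ 2) * r ^ (2 * Γ) * (r⁻¹) ^ 2)
      (g := fun x => wt R k x * (‖gradient F (x : E d)‖ ^ 2 + ∑ v ∈ R, k v * quot F v x ^ 2))]
    at key
  rotate_left
  · intro r hr x
    rw [hn r hr, wt_smul hr, hF.gradient_smul hr]
    simp_rw [hF.quot_smul hr]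
    rw [norm_smul, norm_inv, Real.norm_of_nonneg hr.le]
    have : ∑ v ∈ R, k v * (r⁻¹ * quot F v x) ^ 2 = r⁻¹ ^ 2 * ∑ v ∈ R, k v * quot F v x ^ 2 := by
      rw [Finset.mul_sum]
      exact Finset.sum_congr rfl fun v _ => by ring
    rw [this]
    ring
  · intro r hr x
    rw [hn r hr, wt_smul hr, hF.gradient_smul hr]
    simp_rw [hF.quot_smul hr]
    have : ∑ v ∈ R, (k v * (r⁻¹ * quot F v x)) • v = r⁻¹ • ∑ v ∈ R, (k v * quot F v x) • v := by
      rw [Finset.smul_sum]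
      refine Finset.sum_congr rfl fun v _ => ?_
      rw [smul_smul]
      congr 1
      ring
    rw [this, ← smul_add, norm_smul, norm_inv, Real.norm_of_nonneg hr.le]
    ring
  have e2 : ∀ v ∈ R, ∫ x : E d, deriv β (‖x‖ ^ 2) * wt R k x * (F x - F (refl v x)) ^ 2
      = (∫ r in Set.Ioi (0 : ℝ), r ^ (d - 1) * (deriv β (r ^ 2) * r ^ (2 * Γ))) *
        ∫ x : S d, wt R k x * (F x - F (refl v x)) ^ 2 ∂surfaceMeasure d := by
    intro v hv
    refine integral_polar (by omega) fun r hr x => ?_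
    rw [hn r hr, wt_smul hr, map_smul, hF.smul r hr, hF.smul r hr]
    ring
  rw [Finset.sum_congr rfl fun v hv => by rw [e2 v hv]] at key
  set a : ℝ := (d : ℝ) - 2 + 2 * Γ with ha
  have hd' : (2 : ℝ) ≤ d := by exact_mod_cast hd
  have hp : ∀ r : ℝ, 0 < r → r ^ (d - 1) = r ^ ((d : ℝ) - 1) := fun r hr => by
    rw [← Real.rpow_natCast, Nat.cast_sub (by omega), Nat.cast_one]
  have j1 : ∫ r in Set.Ioi (0 : ℝ), r ^ (d - 1) * (β (r ^ 2) * r ^ (2 * Γ) * (r⁻¹) ^ 2)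
      = ∫ r in Set.Ioi (0 : ℝ), β (r ^ 2) * r ^ (a - 1) := by
    refine setIntegral_congr_fun measurableSet_Ioi fun r hr => ?_
    have hr : (0 : ℝ) < r := hr
    have : r ^ (a - 1) = r ^ ((d : ℝ) - 1) * r ^ (2 * Γ) * r ^ (-2 : ℝ) := by
      rw [← Real.rpow_add hr, ← Real.rpow_add hr, ha]
      congr 1
      ring
    rw [this, hp r hr, Real.rpow_neg hr.le, Real.rpow_two, inv_pow]
    ring
  have j2 : ∫ r in Set.Ioi (0 : ℝ), r ^ (d - 1) * (deriv β (r ^ 2) * r ^ (2 * Γ))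
      = ∫ r in Set.Ioi (0 : ℝ), r * deriv β (r ^ 2) * r ^ a := by
    refine setIntegral_congr_fun measurableSet_Ioi fun r hr => ?_
    have hr : (0 : ℝ) < r := hr
    have : r ^ ((d : ℝ) - 1) * r ^ (2 * Γ) = r * r ^ a := by
      rw [← Real.rpow_add hr, ← Real.rpow_one_add' hr.le (by rw [ha]; linarith), ha]
      congr 1
      ring
    rw [hp r hr]
    linear_combination (deriv β (r ^ 2)) * this
  rw [j1, j2] at key
  have hI1 := hβ.integral_pos hβ1 (a - 1)
  have hI2 := hβ.integral_radial a
  set I1 := ∫ r in Set.Ioi (0 : ℝ), β (r ^ 2) * r ^ (a - 1)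
  set I2 := ∫ r in Set.Ioi (0 : ℝ), r * deriv β (r ^ 2) * r ^ a
  have hI2' : I2 ≤ 0 := by
    have : 0 ≤ a * I1 := mul_nonneg (by rw [ha]; linarith) hI1.le
    linarith
  have hJ : ∑ v ∈ R, k v * (I2 * ∫ x : S d, wt R k x * (F x - F (refl v x)) ^ 2 ∂surfaceMeasure d)
      ≤ 0 := by
    refine Finset.sum_nonpos fun v hv => ?_
    have : 0 ≤ ∫ x : S d, wt R k x * (F x - F (refl v x)) ^ 2 ∂surfaceMeasure d :=
      integral_nonneg fun x => mul_nonneg (wt_nonneg R k x) (sq_nonneg _)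
    exact mul_nonpos_of_nonneg_of_nonpos (hR.pos v hv).le
      (mul_nonpos_of_nonpos_of_nonneg hI2' this)
  refine le_of_mul_le_mul_left ?_ hI1
  linarith

end DunklSphere
namespace DunklSphere

variable {d : ℕ}

/-- The roots of nonzero multiplicity. -/
noncomputable def activeRoots (R : Finset (E d)) (κ : E d → ℝ) : Finset (E d) :=
  open Classical in R.filter fun v => κ v ≠ 0

section Active

variable {R P : Finset (E d)} {κ : E d → ℝ} (hR : IsRootSystem R) (hκ : IsMultiplicity R κ)

include hκ in
theorem multiplicity_refl {u v : E d} (hu : u ∈ R) (hv : v ∈ R) : κ (refl u v) = κ v :=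
  hκ.invariant _ (Subgroup.subset_closure ⟨u, hu, rfl⟩) v hv

include hR hκ in
theorem isWeighted_activeRoots : IsWeighted (activeRoots R κ) (fun v => κ v / 2) where
  inner_self v hv := hR.inner_self_eq_two v (Finset.mem_filter.1 hv).1
  refl_mem u hu v hv := by
    have hu := Finset.mem_filter.1 hu
    have hv := Finset.mem_filter.1 hv
    refine Finset.mem_filter.2 ⟨hR.refl_mem u hu.1 v hv.1, ?_⟩
    rw [multiplicity_refl hκ hu.1 hv.1]
    exact hv.2
  pos v hv := by
    have hv := Finset.mem_filter.1 hv
    have := lt_of_le_of_ne (hκ.nonneg v hv.1) (Ne.symm hv.2)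
    linarith
  invariant u hu v hv := by
    rw [multiplicity_refl hκ (Finset.mem_filter.1 hu).1 (Finset.mem_filter.1 hv).1]

include hR in
@[to_additive]
theorem prod_positive_sq {M : Type*} [CommMonoid M] (hP : IsPositiveSubsystem R P) (g : E d → M)
    (hg : ∀ v ∈ R, g (-v) = g v) : (∏ v ∈ P, g v) ^ 2 = ∏ v ∈ R, g v := by
  classical
  obtain ⟨β, hβ, hP⟩ := hP
  have hneg : ∀ v ∈ R, -v ∈ R := fun v hv => by
    rw [← refl_self]
    exact hR.refl_mem v hv v hv
  rw [← Finset.prod_filter_mul_prod_filter_not R (fun v => 0 < ⟪v, β⟫) g, sq]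
  congr 1
  · refine Finset.prod_congr ?_ fun _ _ => rfl
    ext v
    rw [hP, Finset.mem_filter]
  · refine Finset.prod_nbij' (fun v => -v) (fun v => -v) ?_ ?_ (fun v _ => neg_neg v)
      (fun v _ => neg_neg v) ?_
    · intro v hv
      have hv := (hP v).1 hv
      refine Finset.mem_filter.2 ⟨hneg v hv.1, ?_⟩
      rw [inner_neg_left]
      linarith
    · intro v hv
      have hv := Finset.mem_filter.1 hv
      refine (hP _).2 ⟨hneg v hv.1, ?_⟩
      rw [inner_neg_left]
      have := lt_of_le_of_ne (not_lt.1 hv.2) (hβ v hv.1)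
      linarith
    · intro v hv
      exact (hg v ((hP v).1 hv).1).symm

include hκ in
theorem multiplicity_neg {v : E d} (hv : v ∈ R) : κ (-v) = κ v := by
  rw [← refl_self]
  exact multiplicity_refl hκ hv hv

include hR hκ

theorem weight_sq (hP : IsPositiveSubsystem R P) (x : E d) :
    weight P κ x ^ 2 = wt (activeRoots R κ) (fun v => κ v / 2) x := by
  rw [weight, prod_positive_sq hR hP, wt, activeRoots, Finset.prod_filter]
  · refine Finset.prod_congr rfl fun v _ => ?_
    split_ifs with h
    · congr 1
      ring
    · rw [not_not.1 h, Real.rpow_zero]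
  · intro v hv
    rw [inner_neg_right, abs_neg, multiplicity_neg hκ hv]

theorem dunklOp_eq {𝕜 : Type*} [RCLike 𝕜] (hP : IsPositiveSubsystem R P) (F : E d → 𝕜) {x : E d}
    (hx : x ∈ regular (activeRoots R κ)) (i : Fin d) :
    dunklOp P κ i F x = fderiv ℝ F x (EuclideanSpace.single i 1) +
      ∑ v ∈ activeRoots R κ, (κ v / 2 * v i) • ((⟪x, v⟫)⁻¹ • (F x - F (refl v x))) := by
  rw [dunklOp]
  congr 1
  have e1 : ∑ v ∈ P, (κ v * v i) • reflQuotient v F x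
      = ∑ v ∈ P, (κ v * v i) • ((⟪x, v⟫)⁻¹ • (F x - F (refl v x))) := by
    refine Finset.sum_congr rfl fun v hv => ?_
    by_cases h : κ v = 0
    · simp [h]
    · have hv' : v ∈ R := by
        obtain ⟨β, _, h2⟩ := hP
        exact ((h2 v).1 hv).1
      rw [reflQuotient, if_neg (hx v (Finset.mem_filter.2 ⟨hv', h⟩))]
  have e2 := sum_positive_sq hR hP
    (fun v => (κ v * v i) • ((⟪x, v⟫)⁻¹ • (F x - F (refl v x)))) fun v hv => by
      simp only [multiplicity_neg hκ hv, inner_neg_right, refl_neg, PiLp.neg_apply, mul_neg,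
        inv_neg, neg_smul, smul_neg, neg_neg]
  have e3 : ∑ v ∈ R, (κ v * v i) • ((⟪x, v⟫)⁻¹ • (F x - F (refl v x)))
      = (2 : ℝ) • ∑ v ∈ activeRoots R κ,
        (κ v / 2 * v i) • ((⟪x, v⟫)⁻¹ • (F x - F (refl v x))) := by
    rw [activeRoots, Finset.smul_sum, Finset.sum_filter]
    refine Finset.sum_congr rfl fun v _ => ?_
    split_ifs with h
    · rw [smul_smul (2 : ℝ)]
      congr 1
      ring
    · simp [not_not.1 h]
  rw [e1]
  rw [e3, ← Nat.cast_smul_eq_nsmul ℝ] at e2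
  exact smul_right_injective 𝕜 (two_ne_zero (α := ℝ)) (by simpa using e2)

end Active

section Complex

variable {𝕜 : Type*} [RCLike 𝕜] {F : E d → 𝕜}

theorem IsZeroHom.re (hF : IsZeroHom F) : IsZeroHom fun x => RCLike.re (F x) where
  contDiffAt z hz := (RCLike.reCLM (K := 𝕜)).contDiff.contDiffAt.comp z (hF.contDiffAt z hz)
  smul r hr z := by rw [hF.smul r hr]

theorem IsZeroHom.im (hF : IsZeroHom F) : IsZeroHom fun x => RCLike.im (F x) where
  contDiffAt z hz := (RCLike.imCLM (K := 𝕜)).contDiff.contDiffAt.comp z (hF.contDiffAt z hz)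
  smul r hr z := by rw [hF.smul r hr]

theorem fderiv_re {x : E d} (hF : DifferentiableAt ℝ F x) (w : E d) :
    fderiv ℝ (fun x => RCLike.re (F x)) x w = RCLike.re (fderiv ℝ F x w) := by
  have := ((RCLike.reCLM (K := 𝕜)).hasFDerivAt.comp x hF.hasFDerivAt).fderiv
  exact congrArg (fun T => T w) this

theorem fderiv_im {x : E d} (hF : DifferentiableAt ℝ F x) (w : E d) :
    fderiv ℝ (fun x => RCLike.im (F x)) x w = RCLike.im (fderiv ℝ F x w) := by
  have := ((RCLike.imCLM (K := 𝕜)).hasFDerivAt.comp x hF.hasFDerivAt).fderiv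
  exact congrArg (fun T => T w) this

theorem gradient_apply (h : E d → ℝ) (x : E d) (i : Fin d) :
    gradient h x i = fderiv ℝ h x (EuclideanSpace.single i 1) := by
  rw [← InnerProductSpace.toDual_symm_apply (x := EuclideanSpace.single i (1 : ℝ))
    (y := fderiv ℝ h x), EuclideanSpace.inner_single_right]
  simp [gradient]

theorem norm_fderiv_sq_le {x : E d} (hF : DifferentiableAt ℝ F x) :
    ‖fderiv ℝ F x‖ ^ 2 ≤ ‖gradient (fun x => RCLike.re (F x)) x‖ ^ 2
      + ‖gradient (fun x => RCLike.im (F x)) x‖ ^ 2 := by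
  set A := ‖gradient (fun x => RCLike.re (F x)) x‖ ^ 2
    + ‖gradient (fun x => RCLike.im (F x)) x‖ ^ 2 with hA
  have hA0 : 0 ≤ A := by positivity
  refine (Real.le_sqrt (norm_nonneg _) hA0).1 (ContinuousLinearMap.opNorm_le_bound _ (Real.sqrt_nonneg _) ?_)
  intro w
  refine (abs_le_of_sq_le_sq' ?_ (mul_nonneg (Real.sqrt_nonneg _) (norm_nonneg _))).2
  rw [mul_pow, Real.sq_sqrt hA0, hA, RCLike.norm_sq_eq_def, ← fderiv_re hF, ← fderiv_im hF]
  have h (g : E d → ℝ) : (fderiv ℝ g x w) ^ 2 ≤ ‖gradient g x‖ ^ 2 * ‖w‖ ^ 2 := by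
    rw [← InnerProductSpace.toDual_symm_apply, ← mul_pow, ← sq_abs]
    gcongr
    exact abs_real_inner_le_norm _ _
  nlinarith [h fun x => RCLike.re (F x), h fun x => RCLike.im (F x)]

theorem norm_sub_refl_sq {v x : E d} (hx : ⟪x, v⟫ ≠ 0) : ‖F x - F (refl v x)‖ ^ 2 =
    ⟪x, v⟫ ^ 2 * (quot (fun x => RCLike.re (F x)) v x ^ 2
      + quot (fun x => RCLike.im (F x)) v x ^ 2) := by
  rw [RCLike.norm_sq_eq_def, quot, quot, map_sub, map_sub]
  field_simp

variable {R P : Finset (E d)} {κ : E d → ℝ} (hR : IsRootSystem R) (hκ : IsMultiplicity R κ)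
include hR hκ

theorem norm_dunklGrad_sq (hP : IsPositiveSubsystem R P) {x : E d} (hF : DifferentiableAt ℝ F x)
    (hx : x ∈ regular (activeRoots R κ)) : ‖dunklGrad P κ F x‖ ^ 2 =
      ‖gradient (fun x => RCLike.re (F x)) x
        + ∑ v ∈ activeRoots R κ, (κ v / 2 * quot (fun x => RCLike.re (F x)) v x) • v‖ ^ 2 +
      ‖gradient (fun x => RCLike.im (F x)) x
        + ∑ v ∈ activeRoots R κ, (κ v / 2 * quot (fun x => RCLike.im (F x)) v x) • v‖ ^ 2 := by
  rw [EuclideanSpace.norm_sq_eq, EuclideanSpace.norm_sq_eq, EuclideanSpace.norm_sq_eq,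
    ← Finset.sum_add_distrib]
  refine Finset.sum_congr rfl fun i _ => ?_
  simp only [dunklGrad, dunklOp_eq hR hκ hP F hx]
  rw [RCLike.norm_sq_eq_def, Real.norm_eq_abs, Real.norm_eq_abs, sq_abs, sq_abs]
  simp only [PiLp.add_apply, gradient_apply, fderiv_re hF, fderiv_im hF, map_add, map_sum,
    RCLike.smul_re, RCLike.smul_im, map_sub, WithLp.ofLp_sum, Finset.sum_apply, PiLp.smul_apply,
    smul_eq_mul]
  have h (φ : E d → ℝ) : ∑ v ∈ activeRoots R κ, κ v / 2 * v i * ((⟪x, v⟫)⁻¹ * (φ x - φ (refl v x)))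
      = ∑ v ∈ activeRoots R κ, κ v / 2 * quot φ v x * v i := by
    refine Finset.sum_congr rfl fun v _ => ?_
    rw [quot]
    ring
  rw [h fun x => RCLike.re (F x), h fun x => RCLike.im (F x)]
  ring

end Complex

end DunklSphere
namespace DunklSphere

variable {d : ℕ}

theorem one_le_norm_sphere (x : S d) : 1 ≤ ‖(x : E d)‖ := by simp

theorem coe_sphere_ne_zero (x : S d) : (x : E d) ≠ 0 := norm_pos_iff.1 (by simp)

theorem IsWeighted.integrable_sphere {R : Finset (E d)} {k : E d → ℝ} (hR : IsWeighted R k)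
    {h : E d → ℝ} (hm : Measurable h) {C : ℝ} (hC : ∀ x, 1 ≤ ‖x‖ → |h x| ≤ C) :
    Integrable (fun x : S d => wt R k x * h x) (surfaceMeasure d) := by
  have hc := continuous_wt hR.pos
  obtain ⟨B, hB⟩ := (isCompact_sphere (0 : E d) 1).exists_bound_of_continuousOn hc.continuousOn
  refine Integrable.of_bound (C := B * C)
    ((hc.measurable.mul hm).comp measurable_subtype_coe).aestronglyMeasurable
    (Filter.Eventually.of_forall fun x => ?_)
  rw [norm_mul]
  exact mul_le_mul (hB x x.2) (hC x (one_le_norm_sphere x)) (norm_nonneg _)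
    ((norm_nonneg _).trans (hB x x.2))

variable {𝕜 : Type*} [RCLike 𝕜] {R P : Finset (E d)} {κ : E d → ℝ}

/-- The energy of the tangential Dunkl gradient controls the tangential gradient and the jumps. -/
theorem sphereGrad_energy (hR : IsRootSystem R) (hκ : IsMultiplicity R κ)
    (hP : IsPositiveSubsystem R P) (hd : 2 ≤ d) {f : S d → 𝕜} (hF : IsZeroHom (radialExt f)) :
    ∫⁻ x : S d, ENNReal.ofReal (wt (activeRoots R κ) (fun v => κ v / 2) x) *
      (‖fderiv ℝ (radialExt f) x‖ₑ ^ 2 + ∑ v ∈ activeRoots R κ,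
        ENNReal.ofReal (κ v / 4) * ‖radialExt f x - radialExt f (refl v x)‖ₑ ^ 2)
          ∂surfaceMeasure d ≤
      ENNReal.ofReal (∫ x, ‖sphereGrad P κ f x‖ ^ 2 * weight P κ x ^ 2 ∂surfaceMeasure d) := by
  set F := radialExt f with hFdef
  have hW := isWeighted_activeRoots hR hκ
  set A := activeRoots R κ with hA
  set φ : E d → ℝ := fun x => RCLike.re (F x)
  set ψ : E d → ℝ := fun x => RCLike.im (F x)
  obtain ⟨C, -, hC1, hC2⟩ := hW.exists_bound_energy hF.re
  obtain ⟨C', -, hC1', hC2'⟩ := hW.exists_bound_energy hF.im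
  have i1 := hW.integrable_sphere (measurable_dunkl A _ hF.re) hC1
  have i2 := hW.integrable_sphere (measurable_dirichlet A _ hF.re) hC2
  have i1' := hW.integrable_sphere (measurable_dunkl A _ hF.im) hC1'
  have i2' := hW.integrable_sphere (measurable_dirichlet A _ hF.im) hC2'
  have i3 : Integrable (fun x : S d => wt A (fun v => κ v / 2) x *
      (‖gradient φ (x : E d)‖ ^ 2 + ∑ v ∈ A, κ v / 2 * quot φ v x ^ 2)
      + wt A (fun v => κ v / 2) x *
      (‖gradient ψ (x : E d)‖ ^ 2 + ∑ v ∈ A, κ v / 2 * quot ψ v x ^ 2)) (surfaceMeasure d) :=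
    i2.add i2'
  have hae := ae_sphere_mem_regular (R := A) fun v hv => hW.ne_zero hv
  have e1 : ∫ x, ‖sphereGrad P κ f x‖ ^ 2 * weight P κ x ^ 2 ∂surfaceMeasure d =
      ∫ x : S d, (wt A (fun v => κ v / 2) x *
        ‖gradient φ (x : E d) + ∑ v ∈ A, (κ v / 2 * quot φ v x) • v‖ ^ 2
      + wt A (fun v => κ v / 2) x *
        ‖gradient ψ (x : E d) + ∑ v ∈ A, (κ v / 2 * quot ψ v x) • v‖ ^ 2) ∂surfaceMeasure d := by
    refine integral_congr_ae ?_
    filter_upwards [hae] with x hx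
    rw [weight_sq hR hκ hP, sphereGrad,
      norm_dunklGrad_sq hR hκ hP (hF.differentiableAt (coe_sphere_ne_zero x)) hx]
    ring
  rw [e1, integral_add i1 i1']
  refine le_trans ?_ (ENNReal.ofReal_le_ofReal
    (add_le_add (hW.energy_sphere_le hd hF.re) (hW.energy_sphere_le hd hF.im)))
  rw [← integral_add i2 i2', ofReal_integral_eq_lintegral_ofReal i3]
  · refine lintegral_mono_ae ?_
    filter_upwards [hae] with x hx
    have hx0 := coe_sphere_ne_zero x
    have hk : ∀ v ∈ A, 0 ≤ κ v := fun v hv => by linarith [hW.pos v hv]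
    have hconv : ENNReal.ofReal (wt A (fun v => κ v / 2) x) * (‖fderiv ℝ F x‖ₑ ^ 2 + ∑ v ∈ A,
        ENNReal.ofReal (κ v / 4) * ‖F x - F (refl v x)‖ₑ ^ 2) =
        ENNReal.ofReal (wt A (fun v => κ v / 2) x * (‖fderiv ℝ F x‖ ^ 2 + ∑ v ∈ A,
          (κ v / 4) * ‖F x - F (refl v x)‖ ^ 2)) := by
      rw [ENNReal.ofReal_mul (wt_nonneg _ _ _), ENNReal.ofReal_add (sq_nonneg _)
        (Finset.sum_nonneg fun v hv => mul_nonneg (by linarith [hk v hv]) (sq_nonneg _)),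
        ENNReal.ofReal_sum_of_nonneg
          fun v hv => mul_nonneg (by linarith [hk v hv]) (sq_nonneg _),
        ENNReal.ofReal_pow (norm_nonneg _), ofReal_norm]
      congr 2
      refine Finset.sum_congr rfl fun v hv => ?_
      rw [ENNReal.ofReal_mul (by linarith [hk v hv]), ENNReal.ofReal_pow (norm_nonneg _),
        ofReal_norm]
    rw [hconv, ← mul_add]
    refine ENNReal.ofReal_le_ofReal (mul_le_mul_of_nonneg_left ?_ (wt_nonneg _ _ _))
    have h1 := norm_fderiv_sq_le (hF.differentiableAt hx0)
    have h2 : ∑ v ∈ A, κ v / 4 * ‖F x - F (refl v x)‖ ^ 2 ≤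
        ∑ v ∈ A, κ v / 2 * quot φ v x ^ 2 + ∑ v ∈ A, κ v / 2 * quot ψ v x ^ 2 := by
      rw [← Finset.sum_add_distrib]
      refine Finset.sum_le_sum fun v hv => ?_
      rw [norm_sub_refl_sq (hx v hv), ← mul_add]
      have h3 : ⟪(x : E d), v⟫ ^ 2 ≤ 2 := by
        have := abs_real_inner_le_norm (x : E d) v
        rw [norm_eq_of_mem_sphere, one_mul] at this
        rw [← hW.norm_sq hv, ← sq_abs]
        gcongr
      have h4 : 0 ≤ quot φ v x ^ 2 + quot ψ v x ^ 2 := by positivity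
      calc κ v / 4 * (⟪(x : E d), v⟫ ^ 2 * (quot φ v x ^ 2 + quot ψ v x ^ 2))
          ≤ κ v / 4 * (2 * (quot φ v x ^ 2 + quot ψ v x ^ 2)) := by
            have := hk v hv
            gcongr
        _ = _ := by ring
    linarith
  · refine Filter.Eventually.of_forall fun x => ?_
    have hk : ∀ v ∈ A, 0 ≤ κ v / 2 := fun v hv => (hW.pos v hv).le
    exact add_nonneg (mul_nonneg (wt_nonneg _ _ _) (add_nonneg (sq_nonneg _)
      (Finset.sum_nonneg fun v hv => mul_nonneg (hk v hv) (sq_nonneg _))))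
      (mul_nonneg (wt_nonneg _ _ _) (add_nonneg (sq_nonneg _)
      (Finset.sum_nonneg fun v hv => mul_nonneg (hk v hv) (sq_nonneg _))))

end DunklSphere
namespace DunklSphere

variable {d : ℕ}

section Segments

theorem sq_lintegral_Icc_le {g : ℝ → ENNReal} (hg : AEMeasurable g (volume.restrict (Set.Icc 0 1))) :
    (∫⁻ t in Set.Icc (0 : ℝ) 1, g t) ^ 2 ≤ ∫⁻ t in Set.Icc (0 : ℝ) 1, g t ^ 2 := by
  have h := ENNReal.lintegral_mul_le_Lp_mul_Lq (volume.restrict (Set.Icc (0 : ℝ) 1))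
    Real.HolderConjugate.two_two hg (g := fun _ => 1) aemeasurable_const
  simp only [Pi.mul_apply, mul_one, lintegral_const, Measure.restrict_apply MeasurableSet.univ, Set.univ_inter, Real.volume_Icc, sub_zero,
    ENNReal.ofReal_one, ENNReal.rpow_two, one_pow, ENNReal.one_rpow] at h
  calc _ ≤ ((∫⁻ t in Set.Icc (0 : ℝ) 1, g t ^ 2) ^ (1 / 2 : ℝ)) ^ 2 := by gcongr
    _ = _ := by
      rw [← ENNReal.rpow_two, ← ENNReal.rpow_mul]
      norm_num

variable {G : Type*} [NormedAddCommGroup G] [NormedSpace ℝ G] [CompleteSpace G] {F : E d → G}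

theorem IsZeroHom.enorm_sub_sq_le (hF : IsZeroHom F) {x h : E d}
    (hx : ∀ t ∈ Set.Icc (0 : ℝ) 1, x + t • h ≠ 0) :
    ‖F (x + h) - F x‖ₑ ^ 2 ≤
      ‖h‖ₑ ^ 2 * ∫⁻ t in Set.Icc (0 : ℝ) 1, ‖fderiv ℝ F (x + t • h)‖ₑ ^ 2 := by
  have hl : Continuous fun t : ℝ => x + t • h := by fun_prop
  have hc : ContinuousOn (fun t : ℝ => fderiv ℝ F (x + t • h)) (Set.Icc 0 1) :=
    hF.continuousOn_fderiv.comp hl.continuousOn fun t ht => hx t ht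
  have hd : ∀ t ∈ Set.uIcc (0 : ℝ) 1,
      HasDerivAt (fun t : ℝ => F (x + t • h)) (fderiv ℝ F (x + t • h) h) t := by
    intro t ht
    rw [Set.uIcc_of_le zero_le_one] at ht
    have h1 : HasDerivAt (fun t : ℝ => x + t • h) h t := by
      simpa using ((hasDerivAt_id t).smul_const h).const_add x
    exact (hF.differentiableAt (hx t ht)).hasFDerivAt.comp_hasDerivAt t h1
  have hi : IntervalIntegrable (fun t : ℝ => fderiv ℝ F (x + t • h) h) volume 0 1 := by
    refine ContinuousOn.intervalIntegrable ?_
    rw [Set.uIcc_of_le zero_le_one]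
    exact hc.clm_apply continuousOn_const
  have key := intervalIntegral.integral_eq_sub_of_hasDerivAt hd hi
  rw [one_smul, zero_smul, add_zero, intervalIntegral.integral_of_le zero_le_one,
    ← integral_Icc_eq_integral_Ioc] at key
  have hm : AEMeasurable (fun t : ℝ => ‖fderiv ℝ F (x + t • h)‖ₑ)
      (volume.restrict (Set.Icc 0 1)) :=
    (hc.aestronglyMeasurable measurableSet_Icc).enorm
  rw [← key]
  calc _ ≤ (∫⁻ t in Set.Icc (0 : ℝ) 1, ‖fderiv ℝ F (x + t • h) h‖ₑ) ^ 2 := by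
        gcongr
        exact enorm_integral_le_lintegral_enorm _
    _ ≤ (∫⁻ t in Set.Icc (0 : ℝ) 1, ‖h‖ₑ * ‖fderiv ℝ F (x + t • h)‖ₑ) ^ 2 := by
        gcongr with t
        rw [mul_comm]
        exact ContinuousLinearMap.le_opENorm _ _
    _ = ‖h‖ₑ ^ 2 * (∫⁻ t in Set.Icc (0 : ℝ) 1, ‖fderiv ℝ F (x + t • h)‖ₑ) ^ 2 := by
        rw [lintegral_const_mul'' _ hm, mul_pow]
    _ ≤ _ := by
        gcongr
        exact sq_lintegral_Icc_le hm

omit [NormedSpace ℝ G] [CompleteSpace G] in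
theorem enorm_add_sq_le (a b : G) : ‖a + b‖ₑ ^ 2 ≤ 2 * ‖a‖ₑ ^ 2 + 2 * ‖b‖ₑ ^ 2 := by
  have h : ‖a + b‖ ^ 2 ≤ 2 * ‖a‖ ^ 2 + 2 * ‖b‖ ^ 2 := by
    nlinarith [norm_add_le a b, norm_nonneg (a + b), norm_nonneg a, norm_nonneg b,
      sq_nonneg (‖a‖ - ‖b‖)]
  have h2 := ENNReal.ofReal_le_ofReal h
  rw [ENNReal.ofReal_add (by positivity) (by positivity), ENNReal.ofReal_mul (by norm_num),
    ENNReal.ofReal_mul (by norm_num), ENNReal.ofReal_pow (norm_nonneg _),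
    ENNReal.ofReal_pow (norm_nonneg _), ENNReal.ofReal_pow (norm_nonneg _), ofReal_norm,
    ofReal_norm, ofReal_norm] at h2
  simpa using h2

end Segments

section Chambers

/-- The open chamber of the root hyperplanes that contains the regular point `a`. -/
def chamber (R : Finset (E d)) (a : E d) : Set (E d) := {x | ∀ v ∈ R, 0 < ⟪x, v⟫ * ⟪a, v⟫}

variable {R : Finset (E d)} {a : E d}

theorem isOpen_chamber (R : Finset (E d)) (a : E d) : IsOpen (chamber R a) := by
  have : chamber R a = ⋂ v ∈ R, {x : E d | 0 < ⟪x, v⟫ * ⟪a, v⟫} := by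
    ext x
    simp [chamber]
  rw [this]
  exact isOpen_biInter_finset fun v _ => isOpen_lt continuous_const (by fun_prop)

theorem mem_chamber_self (ha : a ∈ regular R) : a ∈ chamber R a := fun v hv =>
  mul_self_pos.2 (ha v hv)

theorem convex_chamber (R : Finset (E d)) (a : E d) : Convex ℝ (chamber R a) := by
  intro x hx y hy s t hs ht hst v hv
  have h1 := hx v hv
  have h2 := hy v hv
  rw [inner_add_left, inner_smul_left, inner_smul_left]
  simp only [conj_trivial]
  rcases hs.eq_or_lt with h | h
  · have : t = 1 := by linarith
    simp [← h, this, h2]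
  · nlinarith [mul_pos h h1, mul_nonneg ht h2.le]

theorem smul_mem_chamber {x : E d} {r : ℝ} (hr : 0 < r) (hx : x ∈ chamber R a) :
    r • x ∈ chamber R a := fun v hv => by
  rw [inner_smul_left]
  simp only [conj_trivial]
  rw [mul_assoc]
  exact mul_pos hr (hx v hv)

theorem smul_mem_chamber_iff {x : E d} {r : ℝ} (hr : 0 < r) :
    r • x ∈ chamber R a ↔ x ∈ chamber R a := by
  refine ⟨fun h => ?_, smul_mem_chamber hr⟩
  have := smul_mem_chamber (inv_pos.2 hr) h
  rwa [smul_smul, inv_mul_cancel₀ hr.ne', one_smul] at this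

theorem chamber_subset_regular : chamber R a ⊆ regular R := fun x hx v hv h => by
  have := hx v hv
  rw [h, zero_mul] at this
  exact lt_irrefl _ this

theorem abs_inner_le_of_chamber {x u : E d} {s : ℝ} (hs : 0 ≤ s) (hx : x ∈ chamber R a)
    (hu : u ∈ chamber R a) {v : E d} (hv : v ∈ R) : |⟪x, v⟫| ≤ |⟪x + s • u, v⟫| := by
  have h1 := hx v hv
  have h2 := hu v hv
  have h3 : 0 ≤ ⟪x, v⟫ * (s * ⟪u, v⟫) := by
    have : 0 < (⟪x, v⟫ * ⟪u, v⟫) * ⟪a, v⟫ ^ 2 := by nlinarith [mul_pos h1 h2]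
    have h5 : 0 < ⟪x, v⟫ * ⟪u, v⟫ :=
      lt_of_mul_lt_mul_right (by rwa [zero_mul]) (sq_nonneg ⟪a, v⟫)
    nlinarith [mul_nonneg hs h5.le]
  rw [inner_add_left, inner_smul_left]
  simp only [conj_trivial]
  refine sq_le_sq.1 ?_
  nlinarith [sq_nonneg (s * ⟪u, v⟫)]

theorem wt_le_of_chamber {k : E d → ℝ} (hk : ∀ v ∈ R, 0 < k v) {x u : E d} {s : ℝ} (hs : 0 ≤ s)
    (hx : x ∈ chamber R a) (hu : u ∈ chamber R a) : wt R k x ≤ wt R k (x + s • u) :=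
  Finset.prod_le_prod (fun _ _ => Real.rpow_nonneg (abs_nonneg _) _) fun v hv =>
    Real.rpow_le_rpow (abs_nonneg _) (abs_inner_le_of_chamber hs hx hu hv)
      (by linarith [hk v hv])

theorem exists_finset_chamber (R : Finset (E d)) : ∃ B : Finset (E d), (∀ a ∈ B, a ∈ regular R) ∧
    ∀ x ∈ regular R, ∃ a ∈ B, x ∈ chamber R a := by
  classical
  let pat : E d → Finset (E d) := fun x => R.filter fun v => 0 < ⟪x, v⟫
  have hfin : (pat '' regular R).Finite := R.powerset.finite_toSet.subset fun s hs => by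
    obtain ⟨x, _, rfl⟩ := hs
    exact Finset.mem_coe.2 (Finset.mem_powerset.2 (Finset.filter_subset _ _))
  obtain ⟨B, hB, hbij⟩ := Set.exists_subset_bijOn (regular R) pat
  have hBf : B.Finite := Set.Finite.of_finite_image (by rw [hbij.image_eq]; exact hfin) hbij.injOn
  refine ⟨hBf.toFinset, fun a ha => hB (hBf.mem_toFinset.1 ha), fun x hx => ?_⟩
  obtain ⟨a, ha, hax⟩ := hbij.surjOn (Set.mem_image_of_mem pat hx)
  refine ⟨a, hBf.mem_toFinset.2 ha, fun v hv => ?_⟩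
  have h : 0 < ⟪a, v⟫ ↔ 0 < ⟪x, v⟫ := by
    have := congrArg (v ∈ ·) hax
    simpa [pat, hv] using this
  rcases lt_or_gt_of_ne (hx v hv) with h1 | h1
  · have h2 : ⟪a, v⟫ < 0 :=
      lt_of_le_of_ne (not_lt.1 fun h3 => absurd (h.1 h3) (not_lt.2 h1.le)) (hB ha v hv)
    exact mul_pos_of_neg_of_neg h1 h2
  · exact mul_pos h1 (h.2 h1)

end Chambers

end DunklSphere
namespace DunklSphere

variable {d : ℕ}

section Shell

/-- The radial factor of a conical integral with homogeneity degree `p`. -/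
noncomputable def radialFactor (d : ℕ) (I : Set ℝ) (p : ℝ) : ENNReal :=
  ∫⁻ r in Set.Ioi (0 : ℝ), ENNReal.ofReal (r ^ (d - 1)) * I.indicator (fun r => ENNReal.ofReal (r ^ p)) r

theorem setLIntegral_cone (hd : 0 < d) {G : E d → ENNReal} (hG : Measurable G) {p : ℝ}
    (hom : ∀ r : ℝ, 0 < r → ∀ x : S d, G (r • (x : E d)) = ENNReal.ofReal (r ^ p) * G x)
    {Q : Set (E d)} (hQ : MeasurableSet Q)
    (hQc : ∀ r : ℝ, 0 < r → ∀ x : S d, r • (x : E d) ∈ Q ↔ (x : E d) ∈ Q)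
    {I : Set ℝ} (hI : MeasurableSet I) :
    ∫⁻ z in {z | ‖z‖ ∈ I} ∩ Q, G z =
      radialFactor d I p * ∫⁻ x in {x : S d | (x : E d) ∈ Q}, G x ∂surfaceMeasure d := by
  classical
  have hQ' : MeasurableSet {x : S d | (x : E d) ∈ Q} := hQ.preimage measurable_subtype_coe
  have hI' : MeasurableSet {z : E d | ‖z‖ ∈ I} := hI.preimage measurable_norm
  rw [← lintegral_indicator (hI'.inter hQ), ← lintegral_indicator hQ', radialFactor]
  refine lintegral_polar hd ?_ ?_ ?_
  · exact (ENNReal.measurable_ofReal.comp (by fun_prop)).indicator hI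
  · exact ((hG.comp measurable_subtype_coe).indicator hQ').aemeasurable
  · intro r hr x
    have hn : ‖r • (x : E d)‖ = r := by
      rw [norm_smul, Real.norm_of_nonneg hr.le]
      simp
    by_cases h1 : r ∈ I
    · by_cases h2 : (x : E d) ∈ Q
      · rw [Set.indicator_of_mem (show r • (x : E d) ∈ {z | ‖z‖ ∈ I} ∩ Q from
            ⟨by simpa [hn] using h1, (hQc r hr x).2 h2⟩),
          Set.indicator_of_mem h1, Set.indicator_of_mem (show x ∈ {x : S d | (x : E d) ∈ Q} from h2),
          hom r hr]
      · rw [Set.indicator_of_notMem fun h => h2 ((hQc r hr x).1 h.2),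
          Set.indicator_of_notMem (show x ∉ {x : S d | (x : E d) ∈ Q} from h2), mul_zero]
    · rw [Set.indicator_of_notMem fun h => h1 (by simpa [hn] using h.1),
        Set.indicator_of_notMem h1, zero_mul]

theorem radialFactor_ne_zero {I : Set ℝ} (hI : MeasurableSet I) {α β : ℝ} (hα : 0 ≤ α)
    (hαβ : α < β) (hs : Set.Ioo α β ⊆ I) (p : ℝ) : radialFactor d I p ≠ 0 := by
  have hm : Measurable fun r : ℝ => ENNReal.ofReal (r ^ (d - 1)) *
      I.indicator (fun r => ENNReal.ofReal (r ^ p)) r :=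
    (by fun_prop : Measurable fun r : ℝ => ENNReal.ofReal (r ^ (d - 1))).mul
      ((ENNReal.measurable_ofReal.comp (by fun_prop)).indicator hI)
  rw [radialFactor, ne_eq, setLIntegral_eq_zero_iff measurableSet_Ioi hm, ae_iff]
  refine fun h => absurd (measure_mono_null (s := Set.Ioo α β) (fun r hr => ?_) h) ?_
  · have hr0 : 0 < r := hα.trans_lt hr.1
    simp only [Set.mem_ofPred_eq, Classical.not_imp]
    refine ⟨hr0, ?_⟩
    rw [Set.indicator_of_mem (hs hr)]
    have h1 : 0 < r ^ (d - 1) := by positivity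
    have h2 : 0 < r ^ p := by positivity
    simp [h1, h2]
  · simpa using hαβ

theorem radialFactor_ne_top (hd : 0 < d) {I : Set ℝ} {β : ℝ}
    (hs : I ⊆ Set.Iic β) {p : ℝ} (hp : 0 < d + p) : radialFactor d I p ≠ ⊤ := by
  have h0 : radialFactor d I p ≤ ∫⁻ r in Set.Ioc 0 β, ENNReal.ofReal (r ^ ((d : ℝ) - 1 + p)) := by
    rw [radialFactor, ← lintegral_indicator measurableSet_Ioi,
      ← lintegral_indicator measurableSet_Ioc]
    refine lintegral_mono fun r => ?_
    by_cases hr : r ∈ Set.Ioi (0 : ℝ)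
    · rw [Set.indicator_of_mem hr]
      have hr0 : 0 < r := hr
      by_cases hrI : r ∈ I
      · rw [Set.indicator_of_mem hrI, Set.indicator_of_mem (show r ∈ Set.Ioc 0 β from ⟨hr0, hs hrI⟩),
          ← ENNReal.ofReal_mul (by positivity), Real.rpow_add hr0, ← Real.rpow_natCast,
          Nat.cast_sub (by omega), Nat.cast_one]
      · rw [Set.indicator_of_notMem hrI, mul_zero]
        exact zero_le
    · rw [Set.indicator_of_notMem hr]
      exact zero_le
  refine ne_top_of_le_ne_top ?_ h0
  rcases le_or_gt β 0 with hβ | hβ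
  · rw [Set.Ioc_eq_empty (not_lt.2 hβ)]
    simp
  have h1 := intervalIntegral.intervalIntegrable_rpow' (a := 0) (b := β) (r := (d : ℝ) - 1 + p)
    (by linarith)
  rw [intervalIntegrable_iff_integrableOn_Ioc_of_le hβ.le] at h1
  have h2 := h1.2
  rw [hasFiniteIntegral_iff_ofReal] at h2
  · exact h2.ne
  · refine (ae_restrict_iff' measurableSet_Ioc).2 (Filter.Eventually.of_forall fun r hr => ?_)
    exact Real.rpow_nonneg hr.1.le _

theorem setLIntegral_translate_le {T V : Set (E d)} (hT : MeasurableSet T) (hV : MeasurableSet V)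
    (h : E d) (hTV : ∀ x ∈ T, x + h ∈ V) (g : E d → ENNReal) :
    ∫⁻ x in T, g (x + h) ≤ ∫⁻ x in V, g x := by
  classical
  rw [← lintegral_indicator hT, ← lintegral_indicator hV,
    ← lintegral_add_right_eq_self (V.indicator g) h]
  refine lintegral_mono fun x => ?_
  by_cases hx : x ∈ T
  · rw [Set.indicator_of_mem hx, Set.indicator_of_mem (hTV x hx)]
  · rw [Set.indicator_of_notMem hx]
    exact zero_le

end Shell

section Weights

variable {R : Finset (E d)} {k : E d → ℝ} {G : Type*} [NormedAddCommGroup G] [NormedSpace ℝ G]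
  {F : E d → G}

/-- The weight as an extended nonnegative function. -/
noncomputable def ewt (R : Finset (E d)) (k : E d → ℝ) (x : E d) : ENNReal :=
  ENNReal.ofReal (wt R k x)

theorem measurable_ewt (hk : ∀ v ∈ R, 0 < k v) : Measurable (ewt R k) :=
  (continuous_wt hk).measurable.ennreal_ofReal

theorem measurable_energy (F : E d → G) (hk : ∀ v ∈ R, 0 < k v) [CompleteSpace G] :
    Measurable fun x => ewt R k x * ‖fderiv ℝ F x‖ₑ ^ 2 := by
  borelize G
  exact (measurable_ewt hk).mul ((measurable_fderiv ℝ F).enorm.pow_const 2)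

theorem IsZeroHom.measurable_enorm (hF : IsZeroHom F) : Measurable fun x => ‖F x‖ₑ ^ 2 := by
  borelize G
  exact hF.measurable.enorm.pow_const 2

theorem IsZeroHom.ewt_mul_fderiv_smul (hF : IsZeroHom F) {r : ℝ} (hr : 0 < r) (x : E d) :
    ewt R k (r • x) * ‖fderiv ℝ F (r • x)‖ₑ ^ 2 =
      ENNReal.ofReal (r ^ (2 * ∑ v ∈ R, k v - 2)) * (ewt R k x * ‖fderiv ℝ F x‖ₑ ^ 2) := by
  rw [ewt, wt_smul hr, hF.fderiv_smul hr, enorm_smul, mul_pow,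
    ENNReal.ofReal_mul (by positivity), ewt]
  have : ‖r⁻¹‖ₑ ^ 2 = ENNReal.ofReal (r ^ (-2 : ℝ)) := by
    rw [Real.enorm_of_nonneg (by positivity), ← ENNReal.ofReal_pow (by positivity),
      Real.rpow_neg hr.le, Real.rpow_two, inv_pow]
  rw [this, sub_eq_add_neg, Real.rpow_add hr, ENNReal.ofReal_mul (by positivity)]
  ring

theorem ewt_mul_smul {r : ℝ} (hr : 0 < r) (x : E d) {g : E d → ENNReal}
    (hg : g (r • x) = g x) : ewt R k (r • x) * g (r • x) =
      ENNReal.ofReal (r ^ (2 * ∑ v ∈ R, k v)) * (ewt R k x * g x) := by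
  rw [hg, ewt, wt_smul hr, ENNReal.ofReal_mul (by positivity), ewt, mul_assoc]

end Weights

section Concentration

variable {R : Finset (E d)} {k : E d → ℝ} {𝕜 : Type*} [RCLike 𝕜]

theorem exists_orthogonal_unit (hd : 2 ≤ d) (y : E d) : ∃ e : E d, ‖e‖ = 1 ∧ ⟪y, e⟫ = 0 := by
  have h : (ℝ ∙ y)ᗮ ≠ ⊥ := by
    intro h
    have h1 := Submodule.finrank_add_finrank_orthogonal (ℝ ∙ y)
    rw [h, finrank_bot, finrank_euclideanSpace_fin] at h1
    have h2 := finrank_span_le_card (R := ℝ) ({y} : Set (E d))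
    simp at h2
    omega
  obtain ⟨w, hw, hw0⟩ := Submodule.exists_mem_ne_zero_of_ne_bot h
  refine ⟨‖w‖⁻¹ • w, by simp [norm_smul, hw0], ?_⟩
  rw [inner_smul_right, Submodule.mem_orthogonal_singleton_iff_inner_right.1 hw, mul_zero]

theorem IsZeroHom.lintegral_translate_le {F : E d → 𝕜} (hF : IsZeroHom F)
    (hk : ∀ v ∈ R, 0 < k v) {a u : E d} (hu : u ∈ chamber R a) {s : ℝ} (hs : 0 ≤ s)
    {T V V' : Set (E d)} (hT : MeasurableSet T) (hV : MeasurableSet V) (hV' : MeasurableSet V')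
    (hTa : T ⊆ chamber R a) (hV0 : (0 : E d) ∉ V)
    (hTV : ∀ x ∈ T, ∀ t ∈ Set.Icc (0 : ℝ) 1, x + t • s • u ∈ V)
    (hTV' : ∀ x ∈ T, x + s • u ∈ V') :
    ∫⁻ x in T, ewt R k x * ‖F x‖ₑ ^ 2 ≤
      2 * ‖s • u‖ₑ ^ 2 * (∫⁻ x in V, ewt R k x * ‖fderiv ℝ F x‖ₑ ^ 2) +
        2 * ∫⁻ x in V', ewt R k x * ‖F x‖ₑ ^ 2 := by
  have hmE : Measurable fun x => ewt R k x * ‖fderiv ℝ F x‖ₑ ^ 2 := measurable_energy F hk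
  have hmF : Measurable fun x => ewt R k x * ‖F x‖ₑ ^ 2 := (measurable_ewt hk).mul hF.measurable_enorm
  have hmU : Measurable fun p : E d × ℝ =>
      ewt R k (p.1 + p.2 • s • u) * ‖fderiv ℝ F (p.1 + p.2 • s • u)‖ₑ ^ 2 :=
    hmE.comp (by fun_prop : Measurable fun p : E d × ℝ => p.1 + p.2 • s • u)
  have hpt : ∀ x ∈ T, ewt R k x * ‖F x‖ₑ ^ 2 ≤
      2 * ‖s • u‖ₑ ^ 2 * (∫⁻ t in Set.Icc (0 : ℝ) 1,
        ewt R k (x + t • s • u) * ‖fderiv ℝ F (x + t • s • u)‖ₑ ^ 2) +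
      2 * (ewt R k (x + s • u) * ‖F (x + s • u)‖ₑ ^ 2) := by
    intro x hx
    have h1 := enorm_add_sq_le (F (x + s • u)) (-(F (x + s • u) - F x))
    rw [neg_sub, add_sub_cancel, ← neg_sub, enorm_neg] at h1
    have h2 := hF.enorm_sub_sq_le (x := x) (h := s • u) fun t ht h0 =>
      hV0 (h0 ▸ hTV x hx t ht)
    have h3 : ewt R k x ≤ ewt R k (x + s • u) :=
      ENNReal.ofReal_le_ofReal (wt_le_of_chamber hk hs (hTa hx) hu)
    have h4 : ewt R k x * (∫⁻ t in Set.Icc (0 : ℝ) 1, ‖fderiv ℝ F (x + t • s • u)‖ₑ ^ 2) ≤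
        ∫⁻ t in Set.Icc (0 : ℝ) 1,
          ewt R k (x + t • s • u) * ‖fderiv ℝ F (x + t • s • u)‖ₑ ^ 2 := by
      rw [← lintegral_const_mul' _ _ (show ewt R k x ≠ ⊤ from ENNReal.ofReal_ne_top)]
      refine setLIntegral_mono' measurableSet_Icc fun t ht => ?_
      gcongr
      refine ENNReal.ofReal_le_ofReal ?_
      rw [smul_smul]
      exact wt_le_of_chamber hk (mul_nonneg ht.1 hs) (hTa hx) hu
    calc ewt R k x * ‖F x‖ₑ ^ 2
        ≤ ewt R k x * (2 * ‖F (x + s • u)‖ₑ ^ 2 + 2 * (‖s • u‖ₑ ^ 2 *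
          ∫⁻ t in Set.Icc (0 : ℝ) 1, ‖fderiv ℝ F (x + t • s • u)‖ₑ ^ 2)) := by
          gcongr
          exact h1.trans (by gcongr)
      _ = 2 * ‖s • u‖ₑ ^ 2 * (ewt R k x *
            ∫⁻ t in Set.Icc (0 : ℝ) 1, ‖fderiv ℝ F (x + t • s • u)‖ₑ ^ 2) +
          2 * (ewt R k x * ‖F (x + s • u)‖ₑ ^ 2) := by ring
      _ ≤ _ := by gcongr
  have hmF' : Measurable fun x => ewt R k (x + s • u) * ‖F (x + s • u)‖ₑ ^ 2 :=
    hmF.comp (by fun_prop : Measurable fun x : E d => x + s • u)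
  refine (setLIntegral_mono' hT hpt).trans ?_
  rw [lintegral_add_left (Measurable.const_mul hmU.lintegral_prod_right' _),
    lintegral_const_mul _ hmU.lintegral_prod_right',
    lintegral_const_mul _ hmF']
  refine add_le_add (mul_le_mul' le_rfl ?_) (mul_le_mul' le_rfl ?_)
  · rw [lintegral_lintegral_swap (f := fun x t =>
      ewt R k (x + t • s • u) * ‖fderiv ℝ F (x + t • s • u)‖ₑ ^ 2) hmU.aemeasurable]
    calc _ ≤ ∫⁻ t in Set.Icc (0 : ℝ) 1, ∫⁻ x in V, ewt R k x * ‖fderiv ℝ F x‖ₑ ^ 2 :=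
          setLIntegral_mono' measurableSet_Icc fun t ht =>
            setLIntegral_translate_le hT hV (t • s • u) (fun x hx => hTV x hx t ht)
              fun x => ewt R k x * ‖fderiv ℝ F x‖ₑ ^ 2
      _ = _ := by simp
  · exact setLIntegral_translate_le hT hV' (s • u) hTV' fun x => ewt R k x * ‖F x‖ₑ ^ 2

theorem exists_transversal (hd : 2 ≤ d) {a : E d} (ha : a ∈ regular R) :
    ∃ ε L : ℝ, 0 < ε ∧ 0 < L ∧ ∀ y : E d, ∃ e u : E d, ‖e‖ = 1 ∧ ⟪y, e⟫ = 0 ∧ u ∈ chamber R a ∧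
      ‖u‖ ≤ L ∧ ε ≤ |⟪u, e⟫| := by
  obtain ⟨ε, hε, hb⟩ := Metric.isOpen_iff.1 (isOpen_chamber R a) a (mem_chamber_self ha)
  refine ⟨ε / 2, ‖a‖ + ε, by positivity, by positivity, fun y => ?_⟩
  obtain ⟨e, he, hye⟩ := exists_orthogonal_unit hd y
  have key : ∀ c : ℝ, |c| = ε / 2 → a + c • e ∈ chamber R a ∧ ‖a + c • e‖ ≤ ‖a‖ + ε := by
    intro c hc
    have hn : ‖c • e‖ = ε / 2 := by rw [norm_smul, he, mul_one, Real.norm_eq_abs, hc]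
    refine ⟨hb ?_, (norm_add_le _ _).trans (by rw [hn]; linarith)⟩
    rw [mem_ball, dist_eq_norm, add_sub_cancel_left, hn]
    linarith
  have hin : ∀ c : ℝ, ⟪a + c • e, e⟫ = ⟪a, e⟫ + c := by
    intro c
    rw [inner_add_left, inner_smul_left, real_inner_self_eq_norm_sq, he]
    simp
  rcases le_total 0 ⟪a, e⟫ with h | h
  · have h1 := key (ε / 2) (abs_of_pos (by positivity))
    refine ⟨e, _, he, hye, h1.1, h1.2, ?_⟩
    rw [hin, abs_of_nonneg (by positivity)]
    linarith
  · have h1 := key (-(ε / 2)) (by rw [abs_neg, abs_of_pos (by positivity)])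
    refine ⟨e, _, he, hye, h1.1, h1.2, ?_⟩
    rw [hin, abs_of_nonpos (by linarith)]
    linarith

/-- A function concentrated near one point of the sphere has a large Dirichlet energy. -/
theorem concentration_chamber (hk : ∀ v ∈ R, 0 < k v) (hd : 2 ≤ d) {a : E d}
    (ha : a ∈ regular R) : ∃ C : ENNReal, C ≠ ⊤ ∧ ∃ r₀ : ℝ, 0 < r₀ ∧ ∀ (y : S d) (r : ℝ), 0 < r →
      r ≤ r₀ → ∀ F : E d → 𝕜, IsZeroHom F →
      ∫⁻ x in {x : S d | (x : E d) ∈ chamber R a ∧ ‖(x : E d) - y‖ < r}, ewt R k x * ‖F x‖ₑ ^ 2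
        ∂surfaceMeasure d ≤
      C * (ENNReal.ofReal (r ^ 2) * (∫⁻ x : S d, ewt R k x * ‖fderiv ℝ F x‖ₑ ^ 2 ∂surfaceMeasure d)
        + ∫⁻ x in {x : S d | r ≤ ‖(x : E d) - y‖}, ewt R k x * ‖F x‖ₑ ^ 2 ∂surfaceMeasure d) := by
  obtain ⟨ε, L, hε, hL, hu⟩ := exists_transversal hd ha
  have hd0 : 0 < d := by omega
  set Γ : ℝ := 2 * ∑ v ∈ R, k v with hΓ
  have hΓ0 : 0 ≤ Γ := mul_nonneg (by norm_num) (Finset.sum_nonneg fun v hv => (hk v hv).le)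
  have hdR : (2 : ℝ) ≤ d := by exact_mod_cast hd
  set JT := radialFactor d (Set.Icc (3 / 4) (5 / 4)) Γ with hJT
  set JE := radialFactor d (Set.Icc (1 / 2) (3 / 2)) (Γ - 2) with hJE
  set JV := radialFactor d (Set.Icc (1 / 2) (3 / 2)) Γ with hJV
  have hJT0 : JT ≠ 0 := radialFactor_ne_zero measurableSet_Icc (by norm_num) (by norm_num)
    (Set.Ioo_subset_Icc_self) _
  have hJTt : JT ≠ ⊤ := radialFactor_ne_top hd0 Set.Icc_subset_Iic_self
    (by positivity)
  have hJVt : JV ≠ ⊤ := radialFactor_ne_top hd0 Set.Icc_subset_Iic_self (by positivity)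
  have hJEt : JE ≠ ⊤ := by
    refine ne_top_of_le_ne_top (ENNReal.mul_ne_top (by norm_num : (4 : ENNReal) ≠ ⊤) hJVt) ?_
    rw [hJE, hJV, radialFactor, radialFactor, ← lintegral_const_mul' _ _ (by norm_num)]
    refine lintegral_mono fun t => ?_
    by_cases ht : t ∈ Set.Icc (1 / 2 : ℝ) (3 / 2)
    · have ht0 : 0 < t := by linarith [ht.1]
      rw [Set.indicator_of_mem ht, Set.indicator_of_mem ht, mul_left_comm]
      gcongr
      have h4 : (4 : ENNReal) = ENNReal.ofReal 4 := by norm_num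
      rw [h4, ← ENNReal.ofReal_mul (by norm_num)]
      refine ENNReal.ofReal_le_ofReal ?_
      rw [Real.rpow_sub ht0, Real.rpow_two, div_le_iff₀ (by positivity)]
      have h5 : 1 ≤ 4 * t ^ 2 := by nlinarith [ht.1]
      nlinarith [Real.rpow_nonneg ht0.le Γ]
    · rw [Set.indicator_of_notMem ht, mul_zero]
      exact zero_le
  set c : ENNReal := 2 * ENNReal.ofReal ((3 * L / ε) ^ 2) * JE + 2 * JV with hc
  have hct : c ≠ ⊤ := by
    rw [hc]
    finiteness
  refine ⟨JT⁻¹ * c, ENNReal.mul_ne_top (ENNReal.inv_ne_top.2 hJT0) hct, ε / (12 * L), by positivity,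
    fun y r hr hr0 F hF => ?_⟩
  obtain ⟨e, u, he, hye, hua, huL, hue⟩ := hu y
  have hmE : Measurable fun x => ewt R k x * ‖fderiv ℝ F x‖ₑ ^ 2 := measurable_energy F hk
  have hmF : Measurable fun x => ewt R k x * ‖F x‖ₑ ^ 2 := (measurable_ewt hk).mul hF.measurable_enorm
  have hmN : Measurable fun x : E d => ‖‖x‖⁻¹ • x - y‖ := by fun_prop
  set s : ℝ := 3 * r / ε with hs
  have hs0 : 0 ≤ s := by positivity
  have hsu : ‖s • u‖ ≤ 3 * L / ε * r := by
    rw [norm_smul, Real.norm_of_nonneg hs0, hs]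
    calc 3 * r / ε * ‖u‖ ≤ 3 * r / ε * L := by gcongr
      _ = _ := by ring
  have hsu' : ‖s • u‖ ≤ 1 / 4 := by
    refine hsu.trans ?_
    calc 3 * L / ε * r ≤ 3 * L / ε * (ε / (12 * L)) := by gcongr
      _ = 1 / 4 := by field_simp; norm_num
  have hcone : ∀ (Q : Set (E d)), MeasurableSet Q →
      (∀ r : ℝ, 0 < r → ∀ x : S d, r • (x : E d) ∈ Q ↔ (x : E d) ∈ Q) →
      ∀ I : Set ℝ, MeasurableSet I →
      ∫⁻ z in {z | ‖z‖ ∈ I} ∩ Q, ewt R k z * ‖F z‖ₑ ^ 2 = radialFactor d I Γ *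
        ∫⁻ x in {x : S d | (x : E d) ∈ Q}, ewt R k x * ‖F x‖ₑ ^ 2 ∂surfaceMeasure d := by
    intro Q hQ hQc I hI
    refine setLIntegral_cone hd0 hmF (fun t ht x => ?_) hQ hQc hI
    exact ewt_mul_smul (g := fun x => ‖F x‖ₑ ^ 2) ht _ (by rw [hF.smul _ ht])
  have hnormz : ∀ t : ℝ, 0 < t → ∀ x : S d, ‖t • (x : E d)‖⁻¹ • t • (x : E d) = x := by
    intro t ht x
    rw [norm_smul, Real.norm_of_nonneg ht.le, norm_eq_of_mem_sphere, mul_one, smul_smul,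
      inv_mul_cancel₀ ht.ne', one_smul]
  have hnorm1 : ∀ x : S d, ‖(x : E d)‖⁻¹ • (x : E d) = x := by
    intro x
    simp
  set QT : Set (E d) := {x | x ∈ chamber R a ∧ ‖‖x‖⁻¹ • x - y‖ < r} with hQT
  set QV : Set (E d) := {x | r ≤ ‖‖x‖⁻¹ • x - y‖} with hQV
  have hQTm : MeasurableSet QT :=
    (isOpen_chamber R a).measurableSet.inter (measurableSet_lt hmN measurable_const)
  have hQVm : MeasurableSet QV := measurableSet_le measurable_const hmN
  have hT := hcone QT hQTm (fun t ht x => by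
    simp only [hQT, Set.mem_ofPred_eq, smul_mem_chamber_iff ht, hnormz t ht, hnorm1])
    (Set.Icc (3 / 4) (5 / 4)) measurableSet_Icc
  have hV := hcone QV hQVm (fun t ht x => by
    simp only [hQV, Set.mem_ofPred_eq, hnormz t ht, hnorm1])
    (Set.Icc (1 / 2) (3 / 2)) measurableSet_Icc
  have hVE := setLIntegral_cone hd0 hmE (fun t ht x => hF.ewt_mul_fderiv_smul (R := R) (k := k) ht x)
    MeasurableSet.univ (fun _ _ _ => by simp) (measurableSet_Icc (a := (1 / 2 : ℝ)) (b := 3 / 2))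
  simp only [hQT, hQV, Set.mem_ofPred_eq, hnorm1, Set.mem_univ, Set.ofPred_true,
    Measure.restrict_univ] at hT hV hVE
  rw [← hQT] at hT
  rw [← hQV] at hV
  have hnV : ∀ I : Set ℝ, MeasurableSet I → MeasurableSet {z : E d | ‖z‖ ∈ I} := fun I hI =>
    hI.preimage measurable_norm
  have key := hF.lintegral_translate_le hk hua hs0
    ((hnV _ (measurableSet_Icc (a := (3 / 4 : ℝ)) (b := 5 / 4))).inter hQTm)
    ((hnV _ (measurableSet_Icc (a := (1 / 2 : ℝ)) (b := 3 / 2))).inter MeasurableSet.univ)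
    ((hnV _ (measurableSet_Icc (a := (1 / 2 : ℝ)) (b := 3 / 2))).inter hQVm)
    (fun x hx => hx.2.1) (fun h => by
      have := h.1.1
      simp at this
      linarith) ?_ ?_
  · rw [hT, hV, hVE, ← hJT, ← hJE, ← hJV] at key
    rw [mul_assoc, ← ENNReal.mul_le_iff_le_inv hJT0 hJTt]
    refine key.trans ?_
    have hsq : ‖s • u‖ₑ ^ 2 ≤ ENNReal.ofReal ((3 * L / ε) ^ 2) * ENNReal.ofReal (r ^ 2) := by
      rw [← ENNReal.ofReal_mul (by positivity), ← mul_pow, ← ofReal_norm,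
        ← ENNReal.ofReal_pow (norm_nonneg _)]
      gcongr
    generalize (∫⁻ x : S d, ewt R k x * ‖fderiv ℝ F x‖ₑ ^ 2 ∂surfaceMeasure d) = A
    generalize (∫⁻ x in {x : S d | r ≤ ‖(x : E d) - y‖}, ewt R k x * ‖F x‖ₑ ^ 2
      ∂surfaceMeasure d) = B
    calc _ ≤ 2 * (ENNReal.ofReal ((3 * L / ε) ^ 2) * ENNReal.ofReal (r ^ 2)) * (JE * A) +
          2 * (JV * B) := by gcongr
      _ = 2 * ENNReal.ofReal ((3 * L / ε) ^ 2) * JE * (ENNReal.ofReal (r ^ 2) * A) +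
          2 * JV * B := by ring
      _ ≤ c * (ENNReal.ofReal (r ^ 2) * A) + c * B := by
          gcongr
          · exact le_self_add
          · exact le_add_self
      _ = _ := by ring
  · rintro x ⟨hx, -⟩ t ht
    have h1 : ‖t • s • u‖ ≤ 1 / 4 := by
      rw [norm_smul, Real.norm_of_nonneg ht.1]
      nlinarith [ht.2, ht.1, norm_nonneg (s • u)]
    have h2 := norm_add_le x (t • s • u)
    have h3 := norm_sub_le (x + t • s • u) (t • s • u)
    rw [add_sub_cancel_right] at h3
    exact ⟨⟨by linarith [hx.1], by linarith [hx.2]⟩, trivial⟩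
  · rintro x ⟨hx, hxr⟩
    have h2 := norm_add_le x (s • u)
    have h3 := norm_sub_le (x + s • u) (s • u)
    rw [add_sub_cancel_right] at h3
    have h4 : 1 / 2 ≤ ‖x + s • u‖ := by linarith [hx.1]
    have h5 : ‖x + s • u‖ ≤ 3 / 2 := by linarith [hx.2]
    refine ⟨⟨h4, h5⟩, ?_⟩
    have hproj : ∀ z : E d, z ≠ 0 → |⟪z, e⟫| ≤ ‖z‖ * ‖‖z‖⁻¹ • z - y‖ := by
      intro z hz
      have h6 : ⟪z, e⟫ = ‖z‖ * ⟪‖z‖⁻¹ • z - (y : E d), e⟫ := by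
        rw [inner_sub_left, hye, sub_zero, inner_smul_left]
        simp [hz]
      rw [h6, abs_mul, abs_norm]
      gcongr
      exact (abs_real_inner_le_norm _ _).trans (by rw [he, mul_one])
    have h7 := hproj x (norm_pos_iff.1 (by linarith [hx.1]))
    have h8 := hproj (x + s • u) (norm_pos_iff.1 (by linarith))
    have h9 : |⟪x, e⟫| ≤ 5 / 4 * r := h7.trans (by
      have := hxr.2
      gcongr
      exact hx.2)
    have h10 : 3 * r ≤ |⟪s • u, e⟫| := by
      rw [inner_smul_left, abs_mul, conj_trivial, abs_of_nonneg hs0, hs]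
      calc 3 * r = 3 * r / ε * ε := by field_simp
        _ ≤ _ := by gcongr
    have h11 : |⟪s • u, e⟫| ≤ |⟪x + s • u, e⟫| + |⟪x, e⟫| := by
      rw [inner_add_left]
      have := abs_sub (⟪x, e⟫ + ⟪s • u, e⟫) ⟪x, e⟫
      rwa [add_sub_cancel_left] at this
    have h12 : ‖x + s • u‖ * ‖‖x + s • u‖⁻¹ • (x + s • u) - y‖ ≤
        3 / 2 * ‖‖x + s • u‖⁻¹ • (x + s • u) - y‖ := by gcongr
    change r ≤ ‖‖x + s • u‖⁻¹ • (x + s • u) - y‖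
    linarith

end Concentration

end DunklSphere
namespace DunklSphere

variable {d : ℕ}

section Concentration

variable {R : Finset (E d)} {k : E d → ℝ} {𝕜 : Type*} [RCLike 𝕜]

theorem exists_pos_le_finset {ι : Type*} (B : Finset ι) (ρ : ι → ℝ) (h : ∀ i ∈ B, 0 < ρ i) :
    ∃ r : ℝ, 0 < r ∧ ∀ i ∈ B, r ≤ ρ i := by
  classical
  induction B using Finset.induction_on with
  | empty => exact ⟨1, one_pos, by simp⟩
  | insert i B _ ih =>
    obtain ⟨r, hr, h2⟩ := ih fun j hj => h j (Finset.mem_insert_of_mem hj)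
    refine ⟨min r (ρ i), lt_min hr (h i (Finset.mem_insert_self i B)), fun j hj => ?_⟩
    rcases Finset.mem_insert.1 hj with rfl | hj
    · exact min_le_right _ _
    · exact (min_le_left _ _).trans (h2 j hj)

theorem lintegral_biUnion_finset_le {α ι : Type*} [MeasurableSpace α] {μ : Measure α}
    (B : Finset ι) (s : ι → Set α) (g : α → ENNReal) :
    ∫⁻ x in ⋃ i ∈ B, s i, g x ∂μ ≤ ∑ i ∈ B, ∫⁻ x in s i, g x ∂μ := by
  classical
  induction B using Finset.induction_on with
  | empty => simp
  | insert i B hi ih =>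
    rw [Finset.set_biUnion_insert, Finset.sum_insert hi]
    exact (lintegral_union_le _ _ _).trans (by gcongr)

theorem concentration (hk : ∀ v ∈ R, 0 < k v) (hR0 : ∀ v ∈ R, v ≠ 0) (hd : 2 ≤ d) :
    ∃ C : ENNReal, C ≠ ⊤ ∧ ∃ r₀ : ℝ, 0 < r₀ ∧ ∀ (y : S d) (r : ℝ), 0 < r →
      r ≤ r₀ → ∀ F : E d → 𝕜, IsZeroHom F →
      ∫⁻ x in {x : S d | ‖(x : E d) - y‖ < r}, ewt R k x * ‖F x‖ₑ ^ 2 ∂surfaceMeasure d ≤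
      C * (ENNReal.ofReal (r ^ 2) * (∫⁻ x : S d, ewt R k x * ‖fderiv ℝ F x‖ₑ ^ 2 ∂surfaceMeasure d)
        + ∫⁻ x in {x : S d | r ≤ ‖(x : E d) - y‖}, ewt R k x * ‖F x‖ₑ ^ 2 ∂surfaceMeasure d) := by
  obtain ⟨B, hB, hBc⟩ := exists_finset_chamber R
  choose! C hC ρ hρ h using fun a (ha : a ∈ regular R) => concentration_chamber (𝕜 := 𝕜) hk hd ha
  obtain ⟨r₀, hr₀, hr₀'⟩ := exists_pos_le_finset B ρ fun a ha => hρ a (hB a ha)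
  refine ⟨∑ a ∈ B, C a, (ENNReal.sum_lt_top.2 fun a ha => (hC a (hB a ha)).lt_top).ne, r₀, hr₀,
    fun y r hr hrr F hF => ?_⟩
  have hsub : {x : S d | ‖(x : E d) - y‖ < r} ≤ᵐ[surfaceMeasure d]
      (⋃ a ∈ B, {x : S d | (x : E d) ∈ chamber R a ∧ ‖(x : E d) - y‖ < r} : Set (S d)) := by
    filter_upwards [ae_sphere_mem_regular hR0] with x hx hxr
    obtain ⟨a, ha, hxa⟩ := hBc x hx
    exact Set.mem_biUnion (Finset.mem_coe.2 ha) ⟨hxa, hxr⟩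
  refine (lintegral_mono_set' hsub).trans ((lintegral_biUnion_finset_le _ _ _).trans ?_)
  rw [Finset.sum_mul]
  refine Finset.sum_le_sum fun a ha => h a (hB a ha) y r hr (hrr.trans (hr₀' a ha)) F hF

theorem one_sub_inner_sphere (x y : S d) :
    1 - ⟪(x : E d), y⟫ = ‖(x : E d) - y‖ ^ 2 / 2 := by
  rw [norm_sub_sq_real, norm_eq_of_mem_sphere, norm_eq_of_mem_sphere]
  ring

/-- Either the variance of a normalized function about `y` is bounded below, or its product with
the Dirichlet energy is. -/
theorem variance_or_energy (hk : ∀ v ∈ R, 0 < k v) (hR0 : ∀ v ∈ R, v ≠ 0) (hd : 2 ≤ d) :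
    ∃ c : ℝ, 0 < c ∧ ∀ (y : S d) (F : E d → 𝕜), IsZeroHom F →
      ∫⁻ x : S d, ewt R k x * ‖F x‖ₑ ^ 2 ∂surfaceMeasure d = 1 →
      ∀ m e : ℝ, 0 ≤ m → 0 ≤ e →
      ∫⁻ x : S d, ENNReal.ofReal (1 - ⟪(x : E d), y⟫) * (ewt R k x * ‖F x‖ₑ ^ 2)
        ∂surfaceMeasure d ≤ ENNReal.ofReal m →
      ∫⁻ x : S d, ewt R k x * ‖fderiv ℝ F x‖ₑ ^ 2 ∂surfaceMeasure d ≤ ENNReal.ofReal e →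
      c ≤ m ∨ c ≤ m * e := by
  obtain ⟨C', hC', r₀, hr₀, h⟩ := concentration (𝕜 := 𝕜) hk hR0 hd
  obtain ⟨C, hC0, hC⟩ : ∃ C : ℝ, 0 < C ∧ C' ≤ ENNReal.ofReal C :=
    ⟨C'.toReal + 1, by positivity, by
      rw [← ENNReal.ofReal_toReal hC']
      exact ENNReal.ofReal_le_ofReal (by simp)⟩
  refine ⟨min (r₀ ^ 2 / (4 * (C + 1))) (1 / (8 * C * (C + 1))), by positivity,
    fun y F hF h1 m e hm he hvar hen => ?_⟩
  rw [min_le_iff, min_le_iff]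
  by_contra! hcon
  have hmF : Measurable fun x : S d => ewt R k x * ‖F x‖ₑ ^ 2 :=
    ((measurable_ewt hk).mul hF.measurable_enorm).comp measurable_subtype_coe
  have hmN : Measurable fun x : S d => ‖(x : E d) - y‖ := by fun_prop
  have key : ∀ r : ℝ, 0 < r → r ≤ r₀ →
      1 ≤ C * (r ^ 2 * e + 2 / r ^ 2 * m) + 2 / r ^ 2 * m := by
    intro r hr hrr
    have hfar : ∫⁻ x in {x : S d | r ≤ ‖(x : E d) - y‖}, ewt R k x * ‖F x‖ₑ ^ 2
        ∂surfaceMeasure d ≤ ENNReal.ofReal (2 / r ^ 2 * m) := by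
      rw [ENNReal.ofReal_mul (by positivity)]
      refine le_trans ?_ (mul_le_mul' le_rfl hvar)
      rw [← lintegral_const_mul' _ _ ENNReal.ofReal_ne_top]
      refine le_trans (setLIntegral_mono' (measurableSet_le measurable_const hmN) ?_)
        (setLIntegral_le_lintegral _ _)
      intro x hx
      rw [← mul_assoc, ← ENNReal.ofReal_mul (by positivity)]
      refine le_mul_of_one_le_left' ?_
      rw [← ENNReal.ofReal_one]
      refine ENNReal.ofReal_le_ofReal ?_
      rw [one_sub_inner_sphere]
      have hx' : r ≤ ‖(x : E d) - y‖ := hx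
      have : r ^ 2 ≤ ‖(x : E d) - y‖ ^ 2 := by gcongr
      rw [div_mul_div_comm, le_div_iff₀ (by positivity)]
      linarith
    have hnear := h y r hr hrr F hF
    have hsplit : ∫⁻ x : S d, ewt R k x * ‖F x‖ₑ ^ 2 ∂surfaceMeasure d ≤
        (∫⁻ x in {x : S d | ‖(x : E d) - y‖ < r}, ewt R k x * ‖F x‖ₑ ^ 2 ∂surfaceMeasure d) +
        ∫⁻ x in {x : S d | r ≤ ‖(x : E d) - y‖}, ewt R k x * ‖F x‖ₑ ^ 2 ∂surfaceMeasure d := by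
      rw [← setLIntegral_univ]
      refine (lintegral_mono_set fun x _ => ?_).trans (lintegral_union_le _ _ _)
      exact lt_or_ge ‖(x : E d) - y‖ r
    rw [h1] at hsplit
    rw [← ENNReal.ofReal_le_ofReal_iff (by positivity), ENNReal.ofReal_one]
    calc (1 : ENNReal) ≤ _ := hsplit
      _ ≤ ENNReal.ofReal C * (ENNReal.ofReal (r ^ 2) * ENNReal.ofReal e +
          ENNReal.ofReal (2 / r ^ 2 * m)) + ENNReal.ofReal (2 / r ^ 2 * m) := by
        refine add_le_add (hnear.trans ?_) hfar
        gcongr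
      _ = _ := by
        rw [ENNReal.ofReal_add (by positivity) (by positivity), ENNReal.ofReal_mul hC0.le,
          ENNReal.ofReal_add (by positivity) (by positivity),
          ENNReal.ofReal_mul (p := r ^ 2) (by positivity)]
  obtain ⟨hc1, hc2⟩ := hcon
  rcases hm.eq_or_lt with hm0 | hm0
  · subst hm0
    have hK : 0 < 2 * C * (e + 1) := by positivity
    obtain ⟨r, hr, hrr, hr2⟩ : ∃ r : ℝ, 0 < r ∧ r ≤ r₀ ∧ r ^ 2 * (2 * C * (e + 1)) ≤ 1 := by
      refine ⟨min r₀ (Real.sqrt (1 / (2 * C * (e + 1)))), by positivity, min_le_left _ _, ?_⟩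
      rw [← le_div_iff₀ hK]
      calc _ ≤ Real.sqrt (1 / (2 * C * (e + 1))) ^ 2 := by
            gcongr
            exact min_le_right _ _
        _ = _ := Real.sq_sqrt (by positivity)
    have := key r hr hrr
    have h3 : 0 ≤ r ^ 2 * C := by positivity
    nlinarith [mul_pos (mul_pos hr hr) hC0]
  · have hr2 : Real.sqrt (4 * (C + 1) * m) ^ 2 = 4 * (C + 1) * m := Real.sq_sqrt (by positivity)
    have hrr : Real.sqrt (4 * (C + 1) * m) ≤ r₀ := by
      rw [Real.sqrt_le_left hr₀.le]
      have := hc1.1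
      rw [lt_div_iff₀ (by positivity)] at this
      linarith
    have := key _ (Real.sqrt_pos.2 (by positivity)) hrr
    rw [hr2] at this
    have e1 : C * (4 * (C + 1) * m * e + 2 / (4 * (C + 1) * m) * m) + 2 / (4 * (C + 1) * m) * m =
        4 * C * (C + 1) * (m * e) + 1 / 2 := by
      field_simp
      ring
    rw [e1] at this
    have h4 := hc2.2
    rw [lt_div_iff₀ (by positivity)] at h4
    nlinarith

end Concentration

end DunklSphere
namespace DunklSphere

variable {d : ℕ}

section Poincare

theorem setLIntegral_dilation_le {K V : Set (E d)} (hK : MeasurableSet K) (hV : MeasurableSet V)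
    {c : ℝ} (hc : 1 / 2 ≤ c) (b : E d) (hKV : ∀ x ∈ K, c • x + b ∈ V) {g : E d → ENNReal}
    (hg : Measurable g) : ∫⁻ x in K, g (c • x + b) ≤ 2 ^ d * ∫⁻ x in V, g x := by
  classical
  have hc0 : 0 < c := by linarith
  have hm : Measurable fun x => V.indicator g (x + b) :=
    (hg.indicator hV).comp (measurable_add_const b)
  calc ∫⁻ x in K, g (c • x + b) ≤ ∫⁻ x, V.indicator g (c • x + b) := by
        rw [← lintegral_indicator hK]
        refine lintegral_mono fun x => ?_
        by_cases hx : x ∈ K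
        · rw [Set.indicator_of_mem hx, Set.indicator_of_mem (hKV x hx)]
        · rw [Set.indicator_of_notMem hx]
          exact zero_le
    _ = ∫⁻ x, V.indicator g (x + b) ∂(volume.map fun x : E d => c • x) :=
        (lintegral_map hm (measurable_const_smul c)).symm
    _ = ENNReal.ofReal |(c ^ d)⁻¹| * ∫⁻ x in V, g x := by
        rw [Measure.map_addHaar_smul volume hc0.ne', lintegral_smul_measure,
          lintegral_add_right_eq_self (V.indicator g) b, lintegral_indicator hV,
          finrank_euclideanSpace_fin, smul_eq_mul]
    _ ≤ _ := by
        gcongr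
        rw [abs_of_pos (by positivity), show (2 : ENNReal) = ENNReal.ofReal 2 by norm_num,
          ← ENNReal.ofReal_pow (by norm_num)]
        refine ENNReal.ofReal_le_ofReal ?_
        rw [← inv_pow]
        gcongr
        rw [inv_le_comm₀ hc0 two_pos]
        linarith

variable {𝕜 : Type*} [RCLike 𝕜] {F : E d → 𝕜}

theorem IsZeroHom.poincare_convex (hF : IsZeroHom F) {w : E d → ENNReal} (hw : Measurable w)
    (hwt : ∀ x, w x ≠ ⊤) {K : Set (E d)} (hK : MeasurableSet K) (hKc : Convex ℝ K)
    (hK1 : K ⊆ ball 0 1) (h0 : (0 : E d) ∉ K) {D : ENNReal}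
    (hD : ∀ x ∈ K, ∀ y ∈ K, ∀ s ∈ Set.Icc (0 : ℝ) (1 / 2), w x ≤ D * w (x + s • (y - x))) :
    ∫⁻ x in K, ∫⁻ y in K, w x * w y * ‖F x - F y‖ₑ ^ 2 ≤
      4 * 2 ^ d * D * (∫⁻ x in K, w x) * ∫⁻ x in K, w x * ‖fderiv ℝ F x‖ₑ ^ 2 := by
  borelize 𝕜
  have hFm := hF.measurable
  have hG : Measurable fun x => w x * ‖fderiv ℝ F x‖ₑ ^ 2 :=
    hw.mul ((measurable_fderiv ℝ F).enorm.pow_const 2)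
  set A := ∫⁻ x in K, w x * ‖fderiv ℝ F x‖ₑ ^ 2 with hA
  set p : E d → E d → E d := fun x y => x + (1 / 2 : ℝ) • (y - x) with hp
  have hps : ∀ x y, p x y = p y x := fun x y => by
    simp only [hp]
    module
  set Ψ : E d → E d → ENNReal := fun x y => w x * w y * ‖F (p x y) - F x‖ₑ ^ 2 with hΨ
  have hpm : Measurable fun z : E d × E d => p z.1 z.2 := by fun_prop
  have hΨm : Measurable (Function.uncurry Ψ) :=
    ((hw.comp measurable_fst).mul (hw.comp measurable_snd)).mul
      (((hFm.comp hpm).sub (hFm.comp measurable_fst)).enorm.pow_const 2)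
  have hΨm' : Measurable (Function.uncurry fun x y => Ψ y x) := hΨm.comp measurable_swap
  have hseg : ∀ x ∈ K, ∀ y ∈ K, ∀ s ∈ Set.Icc (0 : ℝ) 1, x + s • (y - x) ∈ K :=
    fun x hx y hy s hs => hKc.add_smul_sub_mem hx hy hs
  have hle : ∀ x y, w x * w y * ‖F x - F y‖ₑ ^ 2 ≤ 2 * Ψ x y + 2 * Ψ y x := by
    intro x y
    have h1 := enorm_add_sq_le (-(F (p x y) - F x)) (F (p x y) - F y)
    rw [enorm_neg, show -(F (p x y) - F x) + (F (p x y) - F y) = F x - F y by ring] at h1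
    calc _ ≤ w x * w y * (2 * ‖F (p x y) - F x‖ₑ ^ 2 + 2 * ‖F (p x y) - F y‖ₑ ^ 2) := by gcongr
      _ = _ := by
        simp only [hΨ]
        rw [hps y x]
        ring
  have hhalf : ∀ x ∈ K, ∀ y ∈ K, Ψ x y ≤ w y * (D * ∫⁻ t in Set.Icc (0 : ℝ) 1,
      w (x + t • (1 / 2 : ℝ) • (y - x)) * ‖fderiv ℝ F (x + t • (1 / 2 : ℝ) • (y - x))‖ₑ ^ 2) := by
    intro x hx y hy
    have h1 := hF.enorm_sub_sq_le (x := x) (h := (1 / 2 : ℝ) • (y - x)) fun t ht h => by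
      rw [smul_smul] at h
      exact h0 (h ▸ hseg x hx y hy _ ⟨by linarith [ht.1], by linarith [ht.2]⟩)
    have h2 : ‖(1 / 2 : ℝ) • (y - x)‖ₑ ^ 2 ≤ 1 := by
      rw [← ofReal_norm, ← ENNReal.ofReal_pow (norm_nonneg _), ← ENNReal.ofReal_one]
      refine ENNReal.ofReal_le_ofReal (pow_le_one₀ (norm_nonneg _) ?_)
      have h3 := norm_sub_le y x
      have h4 := hK1 hx
      have h5 := hK1 hy
      rw [mem_ball_zero_iff] at h4 h5
      rw [norm_smul]
      norm_num
      linarith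
    have h3 : ‖F (p x y) - F x‖ₑ ^ 2 ≤
        ∫⁻ t in Set.Icc (0 : ℝ) 1, ‖fderiv ℝ F (x + t • (1 / 2 : ℝ) • (y - x))‖ₑ ^ 2 :=
      h1.trans (mul_le_of_le_one_left' h2)
    simp only [hΨ]
    rw [mul_comm (w x), mul_assoc]
    refine mul_le_mul' le_rfl ?_
    calc _ ≤ w x * ∫⁻ t in Set.Icc (0 : ℝ) 1,
          ‖fderiv ℝ F (x + t • (1 / 2 : ℝ) • (y - x))‖ₑ ^ 2 := by gcongr
      _ = ∫⁻ t in Set.Icc (0 : ℝ) 1,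
          w x * ‖fderiv ℝ F (x + t • (1 / 2 : ℝ) • (y - x))‖ₑ ^ 2 :=
        (lintegral_const_mul' _ _ (hwt x)).symm
      _ ≤ ∫⁻ t in Set.Icc (0 : ℝ) 1, D * (w (x + t • (1 / 2 : ℝ) • (y - x)) *
          ‖fderiv ℝ F (x + t • (1 / 2 : ℝ) • (y - x))‖ₑ ^ 2) := by
        refine setLIntegral_mono' measurableSet_Icc fun t ht => ?_
        rw [← mul_assoc, smul_smul]
        gcongr
        exact hD x hx y hy _ ⟨by linarith [ht.1], by linarith [ht.2]⟩
      _ = _ := lintegral_const_mul _ (hG.comp (by fun_prop))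
  have hone : ∀ y ∈ K, ∫⁻ x in K, Ψ x y ≤ w y * (D * (2 ^ d * A)) := by
    intro y hy
    have hm : Measurable (Function.uncurry fun (x : E d) (t : ℝ) =>
        w (x + t • (1 / 2 : ℝ) • (y - x)) * ‖fderiv ℝ F (x + t • (1 / 2 : ℝ) • (y - x))‖ₑ ^ 2) :=
      hG.comp (by fun_prop : Measurable fun z : E d × ℝ => z.1 + z.2 • (1 / 2 : ℝ) • (y - z.1))
    have hmi : Measurable fun x => ∫⁻ t in Set.Icc (0 : ℝ) 1,
        w (x + t • (1 / 2 : ℝ) • (y - x)) * ‖fderiv ℝ F (x + t • (1 / 2 : ℝ) • (y - x))‖ₑ ^ 2 :=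
      hm.lintegral_prod_right'
    refine (setLIntegral_mono' hK fun x hx => hhalf x hx y hy).trans ?_
    rw [lintegral_const_mul _ (hmi.const_mul D), lintegral_const_mul _ hmi,
      lintegral_lintegral_swap hm.aemeasurable]
    refine mul_le_mul' le_rfl (mul_le_mul' le_rfl ?_)
    calc _ ≤ ∫⁻ t in Set.Icc (0 : ℝ) 1, 2 ^ d * A := by
          refine setLIntegral_mono' measurableSet_Icc fun t ht => ?_
          have e1 : ∀ x : E d, x + t • (1 / 2 : ℝ) • (y - x) = (1 - t / 2) • x + (t / 2) • y :=
            fun x => by module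
          simp only [e1]
          refine setLIntegral_dilation_le hK hK (by linarith [ht.2]) _ (fun x hx => ?_) hG
          rw [← e1, smul_smul]
          exact hseg x hx y hy _ ⟨by linarith [ht.1], by linarith [ht.2]⟩
      _ = _ := by simp
  have hI : Measurable fun x => ∫⁻ y in K, Ψ x y := hΨm.lintegral_prod_right'
  have hI' : Measurable fun x => ∫⁻ y in K, Ψ y x := hΨm'.lintegral_prod_right'
  have hsum : ∫⁻ y in K, ∫⁻ x in K, Ψ x y ≤ (∫⁻ y in K, w y) * (D * (2 ^ d * A)) := by
    rw [← lintegral_mul_const _ hw]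
    exact setLIntegral_mono' hK hone
  calc _ ≤ ∫⁻ x in K, ∫⁻ y in K, (2 * Ψ x y + 2 * Ψ y x) :=
        lintegral_mono fun x => lintegral_mono fun y => hle x y
    _ = 2 * (∫⁻ x in K, ∫⁻ y in K, Ψ x y) + 2 * ∫⁻ x in K, ∫⁻ y in K, Ψ y x := by
        rw [← lintegral_const_mul _ hI, ← lintegral_const_mul _ hI',
          ← lintegral_add_left (hI.const_mul 2)]
        refine lintegral_congr fun x => ?_
        have h1 : Measurable (Ψ x) := hΨm.of_uncurry_left
        have h2 : Measurable fun y => Ψ y x := hΨm.of_uncurry_right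
        rw [lintegral_add_left (h1.const_mul 2), lintegral_const_mul _ h1,
          lintegral_const_mul _ h2]
    _ = 4 * ∫⁻ y in K, ∫⁻ x in K, Ψ x y := by
        rw [lintegral_lintegral_swap hΨm.aemeasurable]
        ring
    _ ≤ 4 * ((∫⁻ y in K, w y) * (D * (2 ^ d * A))) := by gcongr
    _ = _ := by ring

end Poincare

end DunklSphere
namespace DunklSphere

variable {d : ℕ}

section ChamberPoincare

variable {R : Finset (E d)} {k : E d → ℝ} {𝕜 : Type*} [RCLike 𝕜]

theorem wt_le_of_mem_chamber (hk : ∀ v ∈ R, 0 < k v) {a x y : E d} (hx : x ∈ chamber R a)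
    (hy : y ∈ chamber R a) {s : ℝ} (hs : s ∈ Set.Icc (0 : ℝ) (1 / 2)) :
    ewt R k x ≤ ENNReal.ofReal (2 ^ (2 * ∑ v ∈ R, k v)) * ewt R k (x + s • (y - x)) := by
  have h1 : 0 < 1 - s := by linarith [hs.2]
  have hΓ : 0 ≤ 2 * ∑ v ∈ R, k v :=
    mul_nonneg (by norm_num) (Finset.sum_nonneg fun v hv => (hk v hv).le)
  rw [ewt, ewt, ← ENNReal.ofReal_mul (by positivity)]
  refine ENNReal.ofReal_le_ofReal ?_
  have h2 := wt_le_of_chamber hk hs.1 (smul_mem_chamber h1 hx) hy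
  rw [show (1 - s) • x + s • y = x + s • (y - x) by module, wt_smul h1] at h2
  calc wt R k x ≤ (2 * (1 - s)) ^ (2 * ∑ v ∈ R, k v) * wt R k x :=
        le_mul_of_one_le_left (wt_nonneg _ _ _) (Real.one_le_rpow (by linarith [hs.2]) hΓ)
    _ = 2 ^ (2 * ∑ v ∈ R, k v) * ((1 - s) ^ (2 * ∑ v ∈ R, k v) * wt R k x) := by
        rw [Real.mul_rpow two_pos.le h1.le, mul_assoc]
    _ ≤ _ := by gcongr

theorem poincare_chamber (hk : ∀ v ∈ R, 0 < k v) (hd : 2 ≤ d) (hne : R.Nonempty) {a : E d}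
    (ha : a ∈ regular R) : ∃ C : ENNReal, C ≠ ⊤ ∧ ∀ F : E d → 𝕜, IsZeroHom F → ∃ c : 𝕜,
      ∫⁻ x in {x : S d | (x : E d) ∈ chamber R a}, ewt R k x * ‖F x - c‖ₑ ^ 2 ∂surfaceMeasure d ≤
        C * ∫⁻ x : S d, ewt R k x * ‖fderiv ℝ F x‖ₑ ^ 2 ∂surfaceMeasure d := by
  have hd0 : 0 < d := by omega
  set p : ℝ := 2 * ∑ v ∈ R, k v with hp
  have hp0 : 0 < p := mul_pos two_pos (Finset.sum_pos hk hne)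
  have hdR : (2 : ℝ) ≤ d := by exact_mod_cast hd
  set J := radialFactor d (Set.Iio 1) p with hJ
  set J' := radialFactor d (Set.Iio 1) (p - 2) with hJ'
  have hJ0 : J ≠ 0 := radialFactor_ne_zero measurableSet_Iio le_rfl one_pos
    Set.Ioo_subset_Iio_self p
  have hJt : J ≠ ⊤ := radialFactor_ne_top hd0 Set.Iio_subset_Iic_self (by positivity)
  have hJt' : J' ≠ ⊤ := radialFactor_ne_top hd0 Set.Iio_subset_Iic_self (by linarith)
  set D : ENNReal := ENNReal.ofReal (2 ^ p) with hD
  refine ⟨J⁻¹ * (4 * 2 ^ d * D * J'), ?_, fun F hF => ?_⟩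
  · have := ENNReal.inv_ne_top.2 hJ0
    rw [hD]
    finiteness
  have hQm := (isOpen_chamber R a).measurableSet
  set K : Set (E d) := {z | ‖z‖ ∈ Set.Iio (1 : ℝ)} ∩ chamber R a with hKdef
  have hKo : IsOpen K := (isOpen_Iio.preimage continuous_norm).inter (isOpen_chamber R a)
  have hball : {z : E d | ‖z‖ ∈ Set.Iio (1 : ℝ)} = ball 0 1 := by
    ext z
    simp
  have hKc : Convex ℝ K := by
    rw [hKdef, hball]
    exact (convex_ball 0 1).inter (convex_chamber R a)
  have hK1 : K ⊆ ball 0 1 := hball ▸ Set.inter_subset_left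
  have h0 : (0 : E d) ∉ K := fun h => by
    obtain ⟨v, hv⟩ := hne
    have := h.2 v hv
    simp at this
  have hKne : K.Nonempty := by
    refine ⟨(2 * (‖a‖ + 1))⁻¹ • a, ?_, smul_mem_chamber (by positivity) (mem_chamber_self ha)⟩
    change ‖_‖ < 1
    rw [norm_smul, norm_inv, Real.norm_of_nonneg (by positivity), inv_mul_lt_iff₀ (by positivity)]
    linarith [norm_nonneg a]
  have hwm : Measurable (ewt R k) := measurable_ewt hk
  borelize 𝕜
  have hFm := hF.measurable
  set M := ∫⁻ x in K, ewt R k x with hM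
  have hM0 : M ≠ 0 := by
    rw [hM, ne_eq, setLIntegral_eq_zero_iff hKo.measurableSet hwm, ae_iff]
    refine fun h => hKo.measure_ne_zero volume hKne (measure_mono_null (fun x hx => ?_) h)
    simp only [Set.mem_ofPred_eq, Classical.not_imp]
    refine ⟨hx, ?_⟩
    rw [ewt, ENNReal.ofReal_eq_zero, not_le]
    exact wt_pos (chamber_subset_regular hx.2)
  have hMt : M ≠ ⊤ := by
    have h1 : IntegrableOn (wt R k) (closedBall 0 1) :=
      (continuous_wt hk).continuousOn.integrableOn_compact (isCompact_closedBall _ _)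
    exact (Integrable.lintegral_lt_top (h1.mono_set (hK1.trans ball_subset_closedBall))).ne
  set ν : Measure (E d) := (volume.restrict K).withDensity (ewt R k) with hν
  have hνu : ν Set.univ = M := by
    rw [hν, withDensity_apply _ MeasurableSet.univ, Measure.restrict_univ]
  have hνf : IsFiniteMeasure ν := ⟨by rw [hνu]; exact hMt.lt_top⟩
  have hν0 : ν ≠ 0 := fun h => hM0 (by rw [← hνu, h]; simp)
  set φ : E d → ENNReal := fun x => ∫⁻ y in K, ewt R k y * ‖F x - F y‖ₑ ^ 2 with hφ
  have hφu : Measurable fun z : E d × E d => ewt R k z.2 * ‖F z.1 - F z.2‖ₑ ^ 2 :=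
    (hwm.comp measurable_snd).mul
      (((hFm.comp measurable_fst).sub (hFm.comp measurable_snd)).enorm.pow_const 2)
  have hφm : Measurable φ := hφu.lintegral_prod_right'
  obtain ⟨x₀, hx₀⟩ := exists_le_laverage hν0 hφm.aemeasurable
  refine ⟨F x₀, ?_⟩
  have key := hF.poincare_convex hwm (fun x => ENNReal.ofReal_ne_top) hKo.measurableSet hKc hK1 h0
    (fun x hx y hy s hs => wt_le_of_mem_chamber hk hx.2 hy.2 hs)
  rw [← hp, ← hD, ← hM] at key
  have hint : ∫⁻ x, φ x ∂ν = ∫⁻ x in K, ∫⁻ y in K, ewt R k x * ewt R k y * ‖F x - F y‖ₑ ^ 2 := by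
    rw [hν, lintegral_withDensity_eq_lintegral_mul _ hwm hφm]
    refine lintegral_congr fun x => ?_
    simp only [Pi.mul_apply, hφ, mul_assoc]
    rw [lintegral_const_mul' _ _ (show ewt R k x ≠ ⊤ from ENNReal.ofReal_ne_top)]
  have hbound : φ x₀ ≤ 4 * 2 ^ d * D * ∫⁻ x in K, ewt R k x * ‖fderiv ℝ F x‖ₑ ^ 2 := by
    refine hx₀.trans ?_
    rw [laverage_eq, hνu, hint]
    refine ENNReal.div_le_of_le_mul (key.trans (le_of_eq ?_))
    ring
  have e1 : φ x₀ = J * ∫⁻ x in {x : S d | (x : E d) ∈ chamber R a},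
      ewt R k x * ‖F x - F x₀‖ₑ ^ 2 ∂surfaceMeasure d := by
    have hm : Measurable fun x => ewt R k x * ‖F x - F x₀‖ₑ ^ 2 :=
      hwm.mul ((hFm.sub_const _).enorm.pow_const 2)
    rw [hJ, ← setLIntegral_cone hd0 hm (fun r hr x => ewt_mul_smul
      (g := fun x => ‖F x - F x₀‖ₑ ^ 2) hr _ (by rw [hF.smul r hr])) hQm
      (fun r hr x => smul_mem_chamber_iff hr) measurableSet_Iio]
    refine lintegral_congr fun y => ?_
    rw [enorm_sub_rev]
  have e2 : ∫⁻ x in K, ewt R k x * ‖fderiv ℝ F x‖ₑ ^ 2 ≤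
      J' * ∫⁻ x : S d, ewt R k x * ‖fderiv ℝ F x‖ₑ ^ 2 ∂surfaceMeasure d := by
    rw [hKdef, setLIntegral_cone hd0 (measurable_energy F hk)
      (fun r hr x => hF.ewt_mul_fderiv_smul hr _) hQm
      (fun r hr x => smul_mem_chamber_iff hr) measurableSet_Iio]
    gcongr
    exact Measure.restrict_le_self
  rw [mul_assoc, ← ENNReal.mul_le_iff_le_inv hJ0 hJt, ← e1, mul_assoc]
  exact hbound.trans (by gcongr)

end ChamberPoincare

end DunklSphere
namespace DunklSphere

variable {d : ℕ}

section Reflections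

theorem lintegral_sphere_refl (hd : 0 < d) (v : E d) {G : E d → ENNReal} (hG : Measurable G) :
    ∫⁻ x : S d, G (refl v x) ∂surfaceMeasure d = ∫⁻ x : S d, G x ∂surfaceMeasure d := by
  have hcone : ∀ H : E d → ENNReal, Measurable H →
      ∫⁻ z in {z : E d | ‖z‖ ∈ Set.Iio (1 : ℝ)}, H (‖z‖⁻¹ • z) =
        radialFactor d (Set.Iio 1) 0 * ∫⁻ x : S d, H x ∂surfaceMeasure d := by
    intro H hH
    have h := setLIntegral_cone hd (G := fun z => H (‖z‖⁻¹ • z)) (p := 0) (Q := Set.univ)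
      (I := Set.Iio 1) (hH.comp (by fun_prop)) (fun r hr x => by
        rw [norm_smul, Real.norm_of_nonneg hr.le, norm_eq_of_mem_sphere, mul_one, smul_smul,
          inv_mul_cancel₀ hr.ne']
        simp) MeasurableSet.univ (fun _ _ _ => by simp) measurableSet_Iio
    simpa using h
  have hJ0 : radialFactor d (Set.Iio 1) 0 ≠ 0 := radialFactor_ne_zero measurableSet_Iio le_rfl
    one_pos Set.Ioo_subset_Iio_self 0
  have hJt : radialFactor d (Set.Iio 1) 0 ≠ ⊤ :=
    radialFactor_ne_top hd Set.Iio_subset_Iic_self (by simpa using hd)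
  rw [← ENNReal.mul_right_inj hJ0 hJt, ← hcone G hG,
    ← hcone (fun x => G (refl v x)) (hG.comp (refl v).continuous.measurable)]
  have hm : MeasurableSet {z : E d | ‖z‖ ∈ Set.Iio (1 : ℝ)} := measurableSet_Iio.preimage measurable_norm
  have hmp := (refl v).measurePreserving.setLIntegral_comp_preimage hm
    (f := fun z => G (‖z‖⁻¹ • z)) (hG.comp (by fun_prop))
  rw [← hmp]
  have hs : refl v ⁻¹' {z : E d | ‖z‖ ∈ Set.Iio (1 : ℝ)} = {z : E d | ‖z‖ ∈ Set.Iio (1 : ℝ)} := by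
    ext z
    simp
  rw [hs]
  simp

variable {R : Finset (E d)} {k : E d → ℝ} {𝕜 : Type*} [RCLike 𝕜] {F : E d → 𝕜}

theorem IsWeighted.mem_chamber_refl (hR : IsWeighted R k) {v : E d} (hv : v ∈ R) {b x : E d} :
    x ∈ chamber R (refl v b) ↔ refl v x ∈ chamber R b := by
  refine ⟨fun h u hu => ?_, fun h u hu => ?_⟩
  · have := h _ (hR.refl_mem v hv u hu)
    rwa [← inner_refl_left, inner_refl_left v b, refl_refl] at this
  · have := h _ (hR.refl_mem v hv u hu)
    rwa [inner_refl_left v x, refl_refl, ← inner_refl_left] at this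

theorem IsWeighted.lintegral_chamber_refl_le (hR : IsWeighted R k) (hd : 0 < d) {v : E d}
    (hv : v ∈ R) (b : E d) (hF : IsZeroHom F) (c : 𝕜) :
    ∫⁻ x in {x : S d | (x : E d) ∈ chamber R (refl v b)}, ewt R k x * ‖F x - c‖ₑ ^ 2
      ∂surfaceMeasure d ≤
    2 * (∫⁻ x in {x : S d | (x : E d) ∈ chamber R b}, ewt R k x * ‖F x - c‖ₑ ^ 2
      ∂surfaceMeasure d) +
    2 * ∫⁻ x : S d, ewt R k x * ∑ v ∈ R, ‖F x - F (refl v x)‖ₑ ^ 2 ∂surfaceMeasure d := by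
  classical
  borelize 𝕜
  have hFm := hF.measurable
  have hwm := measurable_ewt hR.pos
  have hm : Measurable fun x : E d => ewt R k x * ‖F x - c‖ₑ ^ 2 :=
    hwm.mul ((hFm.sub_const _).enorm.pow_const 2)
  have hch : ∀ b : E d, MeasurableSet {x : S d | (x : E d) ∈ chamber R b} := fun b =>
    (isOpen_chamber R b).measurableSet.preimage measurable_subtype_coe
  have hmi : Measurable ((chamber R b).indicator fun x : E d => ewt R k x * ‖F x - c‖ₑ ^ 2) :=
    hm.indicator (isOpen_chamber R b).measurableSet
  have hmσ : Measurable fun x : S d => (chamber R b).indicator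
      (fun x : E d => ewt R k x * ‖F x - c‖ₑ ^ 2) (refl v x) :=
    (hmi.comp (refl v).continuous.measurable).comp measurable_subtype_coe
  have e1 : ∫⁻ x in {x : S d | (x : E d) ∈ chamber R b}, ewt R k x * ‖F x - c‖ₑ ^ 2
      ∂surfaceMeasure d = ∫⁻ x : S d, (chamber R b).indicator
        (fun x : E d => ewt R k x * ‖F x - c‖ₑ ^ 2) (refl v x) ∂surfaceMeasure d := by
    rw [lintegral_sphere_refl hd v hmi, ← lintegral_indicator (hch b)]
    rfl
  rw [e1, ← lintegral_const_mul' 2 _ (by norm_num), ← lintegral_const_mul' 2 _ (by norm_num),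
    ← lintegral_indicator (hch _), ← lintegral_add_left (hmσ.const_mul 2)]
  refine lintegral_mono fun x => ?_
  by_cases hx : (x : E d) ∈ chamber R (refl v b)
  · rw [Set.indicator_of_mem (show x ∈ {x : S d | (x : E d) ∈ chamber R (refl v b)} from hx)]
    rw [Set.indicator_of_mem ((hR.mem_chamber_refl hv).1 hx)]
    have e2 : ewt R k (refl v x) = ewt R k x := by rw [ewt, hR.wt_refl hv, ewt]
    have h2 := enorm_add_sq_le (F (refl v x) - c) (F x - F (refl v x))
    rw [show F (refl v x) - c + (F x - F (refl v x)) = F x - c by ring] at h2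
    have h3 : ‖F x - F (refl v x)‖ₑ ^ 2 ≤ ∑ v ∈ R, ‖F x - F (refl v x)‖ₑ ^ 2 :=
      Finset.single_le_sum (f := fun v => ‖F x - F (refl v x)‖ₑ ^ 2) (fun _ _ => zero_le) hv
    rw [e2]
    calc _ ≤ ewt R k x * (2 * ‖F (refl v x) - c‖ₑ ^ 2 +
          2 * ∑ v ∈ R, ‖F x - F (refl v x)‖ₑ ^ 2) := by
          gcongr
          exact h2.trans (by gcongr)
      _ = _ := by ring
  · rw [Set.indicator_of_notMem (show x ∉ {x : S d | (x : E d) ∈ chamber R (refl v b)} from hx)]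
    exact zero_le

theorem chamber_eq_of_mem {a b : E d} (h : b ∈ chamber R a) : chamber R b = chamber R a := by
  ext x
  refine forall₂_congr fun v hv => ?_
  have hb := h v hv
  rcases lt_trichotomy ⟪a, v⟫ 0 with ha | ha | ha
  · have : ⟪b, v⟫ < 0 := by nlinarith
    simp [mul_pos_iff, ha, ha.not_gt, this, this.not_gt]
  · rw [ha, mul_zero] at hb
    exact absurd hb (lt_irrefl _)
  · have : 0 < ⟪b, v⟫ := by nlinarith
    rw [mul_pos_iff_of_pos_right this, mul_pos_iff_of_pos_right ha]

theorem IsWeighted.norm_refl_sub_sq (hR : IsWeighted R k) {v : E d} (hv : v ∈ R) (a b : E d) :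
    ‖refl v b - a‖ ^ 2 = ‖b - a‖ ^ 2 + 2 * (⟪b, v⟫ * ⟪a, v⟫) := by
  rw [norm_sub_sq_real, norm_sub_sq_real, LinearIsometryEquiv.norm_map, hR.refl_eq hv,
    inner_sub_left, inner_smul_left, conj_trivial, real_inner_comm v a]
  ring

theorem IsWeighted.exists_chamber_le (hR : IsWeighted R k) (hd : 0 < d) {a : E d}
    (ha : a ∈ regular R) {b : E d} (hb : b ∈ regular R) :
    ∃ C : ENNReal, C ≠ ⊤ ∧ ∀ F : E d → 𝕜, IsZeroHom F → ∀ c : 𝕜,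
      ∫⁻ x in {x : S d | (x : E d) ∈ chamber R b}, ewt R k x * ‖F x - c‖ₑ ^ 2 ∂surfaceMeasure d ≤
      C * ((∫⁻ x in {x : S d | (x : E d) ∈ chamber R a}, ewt R k x * ‖F x - c‖ₑ ^ 2
          ∂surfaceMeasure d) +
        ∫⁻ x : S d, ewt R k x * ∑ v ∈ R, ‖F x - F (refl v x)‖ₑ ^ 2 ∂surfaceMeasure d) := by
  obtain ⟨η, hη, hη'⟩ := exists_pos_le_finset R (fun v => min |⟪a, v⟫| |⟪b, v⟫|) fun v hv =>
    lt_min (abs_pos.2 (ha v hv)) (abs_pos.2 (hb v hv))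
  obtain ⟨n, hn⟩ := exists_nat_ge (‖b - a‖ ^ 2 / (2 * η ^ 2))
  rw [div_le_iff₀ (by positivity)] at hn
  have hbη : ∀ v ∈ R, η ≤ |⟪b, v⟫| := fun v hv => (hη' v hv).trans (min_le_right _ _)
  have haη : ∀ v ∈ R, η ≤ |⟪a, v⟫| := fun v hv => (hη' v hv).trans (min_le_left _ _)
  clear hη' hb
  induction n generalizing b with
  | zero =>
    have : b = a := by
      rw [Nat.cast_zero, zero_mul] at hn
      have : ‖b - a‖ = 0 := by nlinarith [norm_nonneg (b - a)]
      exact sub_eq_zero.1 (norm_eq_zero.1 this)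
    subst this
    exact ⟨1, ENNReal.one_ne_top, fun F _ c => by rw [one_mul]; exact le_self_add⟩
  | succ n ih =>
    by_cases hba : b ∈ chamber R a
    · rw [chamber_eq_of_mem hba]
      exact ⟨1, ENNReal.one_ne_top, fun F _ c => by rw [one_mul]; exact le_self_add⟩
    · obtain ⟨v, hv, hv0⟩ : ∃ v ∈ R, ⟪b, v⟫ * ⟪a, v⟫ ≤ 0 := by
        by_contra! h
        exact hba h
      have h1 : ⟪b, v⟫ * ⟪a, v⟫ ≤ -η ^ 2 := by
        have h2 : η * η ≤ |⟪b, v⟫| * |⟪a, v⟫| :=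
          mul_le_mul (hbη v hv) (haη v hv) hη.le (abs_nonneg _)
        rw [← abs_mul, abs_of_nonpos hv0] at h2
        linarith
      obtain ⟨C, hC, h⟩ := ih (b := refl v b) (by
        rw [hR.norm_refl_sub_sq hv]
        push_cast at hn
        linarith) fun u hu => by
          rw [inner_refl_left]
          exact hbη _ (hR.refl_mem v hv u hu)
      refine ⟨2 * C + 2, by finiteness, fun F hF c => ?_⟩
      have h2 := hR.lintegral_chamber_refl_le hd hv (refl v b) hF c
      rw [refl_refl] at h2
      refine h2.trans ?_
      have h3 := h F hF c
      rw [add_mul, mul_assoc]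
      exact add_le_add (mul_le_mul' le_rfl h3) (mul_le_mul' le_rfl le_add_self)

/-- The Poincaré inequality for the Dunkl energy on the sphere, for a nontrivial multiplicity. -/
theorem IsWeighted.poincare (hR : IsWeighted R k) (hd : 2 ≤ d) (hne : R.Nonempty) :
    ∃ C : ENNReal, C ≠ ⊤ ∧ ∀ F : E d → 𝕜, IsZeroHom F → ∃ c : 𝕜,
      ∫⁻ x : S d, ewt R k x * ‖F x - c‖ₑ ^ 2 ∂surfaceMeasure d ≤
        C * ∫⁻ x : S d, ewt R k x * (‖fderiv ℝ F x‖ₑ ^ 2 +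
          ∑ v ∈ R, ‖F x - F (refl v x)‖ₑ ^ 2) ∂surfaceMeasure d := by
  have hd0 : 0 < d := by omega
  obtain ⟨a, ha⟩ := (ae_mem_regular fun v hv => hR.ne_zero hv).exists
  obtain ⟨C₀, hC₀, h₀⟩ := poincare_chamber (𝕜 := 𝕜) hR.pos hd hne ha
  obtain ⟨B, hB, hBc⟩ := exists_finset_chamber R
  choose! C hC h using fun b (hb : b ∈ regular R) =>
    hR.exists_chamber_le (𝕜 := 𝕜) hd0 ha hb
  have hs : ∑ b ∈ B, C b ≠ ⊤ := (ENNReal.sum_lt_top.2 fun b hb => (hC b (hB b hb)).lt_top).ne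
  refine ⟨(∑ b ∈ B, C b) * (C₀ + 1), by finiteness, fun F hF => ?_⟩
  obtain ⟨c, hc⟩ := h₀ F hF
  refine ⟨c, ?_⟩
  have hsub : Set.univ ≤ᵐ[surfaceMeasure d]
      (⋃ b ∈ B, {x : S d | (x : E d) ∈ chamber R b} : Set (S d)) := by
    filter_upwards [ae_sphere_mem_regular fun v hv => hR.ne_zero hv] with x hx _
    obtain ⟨b, hb, hxb⟩ := hBc x hx
    exact Set.mem_biUnion (Finset.mem_coe.2 hb) hxb
  rw [← setLIntegral_univ]
  refine (lintegral_mono_set' hsub).trans ((lintegral_biUnion_finset_le _ _ _).trans ?_)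
  rw [mul_assoc, Finset.sum_mul]
  refine Finset.sum_le_sum fun b hb => (h b (hB b hb) F hF c).trans (mul_le_mul' le_rfl ?_)
  rw [add_mul, one_mul]
  refine add_le_add (hc.trans (mul_le_mul' le_rfl ?_)) ?_
  · exact lintegral_mono fun x => mul_le_mul' le_rfl le_self_add
  · exact lintegral_mono fun x => mul_le_mul' le_rfl le_add_self

end Reflections

end DunklSphere
namespace DunklSphere

variable {d : ℕ}

section Sphere

variable {𝕜 : Type*} [RCLike 𝕜]

theorem ofReal_inner_sq_le_one {b : E d} (hb : ‖b‖ = 1) (x : S d) :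
    ENNReal.ofReal ⟪(x : E d), b⟫ ^ 2 ≤ 1 := by
  refine pow_le_one₀ zero_le ?_
  rw [← ENNReal.ofReal_one]
  refine ENNReal.ofReal_le_ofReal ((real_inner_le_norm _ _).trans ?_)
  rw [hb, norm_eq_of_mem_sphere, one_mul]

theorem poincare_halfspace (hd : 2 ≤ d) {b : E d} (hb : ‖b‖ = 1) :
    ∃ C : ENNReal, C ≠ ⊤ ∧ ∀ F : E d → 𝕜, IsZeroHom F → ∃ c : 𝕜,
      ∫⁻ x : S d, ENNReal.ofReal ⟪(x : E d), b⟫ ^ 2 * ‖F x - c‖ₑ ^ 2 ∂surfaceMeasure d ≤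
        C * ∫⁻ x : S d, ‖fderiv ℝ F x‖ₑ ^ 2 ∂surfaceMeasure d := by
  have hbb : ⟪b, b⟫ = 1 := by rw [real_inner_self_eq_norm_sq, hb, one_pow]
  have hreg : b ∈ regular ({b} : Finset (E d)) := fun v hv => by
    rw [Finset.mem_singleton.1 hv, hbb]
    exact one_ne_zero
  obtain ⟨C, hC, h⟩ := poincare_chamber (𝕜 := 𝕜) (k := fun _ => 1) (fun _ _ => one_pos) hd
    (Finset.singleton_nonempty b) hreg
  refine ⟨C, hC, fun F hF => ?_⟩
  obtain ⟨c, hc⟩ := h F hF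
  refine ⟨c, ?_⟩
  have hmem : ∀ x : E d, x ∈ chamber {b} b ↔ 0 < ⟪x, b⟫ := fun x => by simp [chamber, hb]
  have hw : ∀ x : E d, ewt {b} (fun _ => 1) x = ENNReal.ofReal (⟪x, b⟫ ^ 2) := fun x => by
    simp [ewt, wt]
  have hm : MeasurableSet {x : S d | (x : E d) ∈ chamber {b} b} :=
    (isOpen_chamber _ _).measurableSet.preimage measurable_subtype_coe
  calc _ = ∫⁻ x in {x : S d | (x : E d) ∈ chamber {b} b},
        ewt {b} (fun _ => 1) x * ‖F x - c‖ₑ ^ 2 ∂surfaceMeasure d := by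
        rw [← lintegral_indicator hm]
        refine lintegral_congr fun x => ?_
        by_cases hx : (x : E d) ∈ chamber {b} b
        · rw [Set.indicator_of_mem (show x ∈ {x : S d | (x : E d) ∈ chamber {b} b} from hx), hw,
            ENNReal.ofReal_pow ((hmem _).1 hx).le]
        · rw [Set.indicator_of_notMem (show x ∉ {x : S d | (x : E d) ∈ chamber {b} b} from hx),
            ENNReal.ofReal_of_nonpos (not_lt.1 fun h => hx ((hmem _).2 h))]
          simp
    _ ≤ _ := hc
    _ ≤ _ := by
        refine mul_le_mul' le_rfl (lintegral_mono fun x => mul_le_of_le_one_left' ?_)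
        rw [hw, ← sq_abs, ENNReal.ofReal_pow (abs_nonneg _)]
        refine pow_le_one₀ zero_le ?_
        rw [← ENNReal.ofReal_one]
        refine ENNReal.ofReal_le_ofReal ((abs_real_inner_le_norm _ _).trans ?_)
        rw [hb, norm_eq_of_mem_sphere, one_mul]

instance (d : ℕ) : (surfaceMeasure d).IsOpenPosMeasure :=
  inferInstanceAs (volume : Measure (E d)).toSphere.IsOpenPosMeasure

theorem lintegral_min_halfspace_ne_zero {a b : E d} (ha : ‖a‖ = 1) (hb : ‖b‖ = 1)
    (hab : 0 < 1 + ⟪a, b⟫) :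
    ∫⁻ x : S d, min (ENNReal.ofReal ⟪(x : E d), a⟫ ^ 2) (ENNReal.ofReal ⟪(x : E d), b⟫ ^ 2)
      ∂surfaceMeasure d ≠ 0 := by
  have hma : Measurable fun x : S d => ENNReal.ofReal ⟪(x : E d), a⟫ ^ 2 := by fun_prop
  have hmb : Measurable fun x : S d => ENNReal.ofReal ⟪(x : E d), b⟫ ^ 2 := by fun_prop
  rw [ne_eq, lintegral_eq_zero_iff (hma.min hmb)]
  intro h
  have hop : IsOpen {x : S d | 0 < ⟪(x : E d), a⟫ ∧ 0 < ⟪(x : E d), b⟫} :=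
    (isOpen_lt continuous_const (by fun_prop : Continuous fun x : S d => ⟪(x : E d), a⟫)).inter
      (isOpen_lt continuous_const (by fun_prop : Continuous fun x : S d => ⟪(x : E d), b⟫))
  have h1 : 0 < ⟪a + b, a⟫ := by
    rw [inner_add_left, real_inner_self_eq_norm_sq, ha, real_inner_comm]
    linarith
  have h2 : 0 < ⟪a + b, b⟫ := by
    rw [inner_add_left, real_inner_self_eq_norm_sq, hb]
    linarith
  have hne0 : a + b ≠ 0 := fun h => by simp [h] at h1
  have hn : 0 < ‖a + b‖⁻¹ := inv_pos.2 (norm_pos_iff.2 hne0)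
  refine hop.measure_ne_zero (surfaceMeasure d)
    ⟨⟨‖a + b‖⁻¹ • (a + b), by
      rw [mem_sphere_zero_iff_norm, norm_smul, norm_inv, norm_norm,
        inv_mul_cancel₀ (norm_ne_zero_iff.2 hne0)]⟩, ?_, ?_⟩ ?_
  · rw [inner_smul_left, conj_trivial]
    positivity
  · rw [inner_smul_left, conj_trivial]
    positivity
  · refine measure_mono_null (fun x hx => ?_) (ae_iff.1 h)
    have h3 : ENNReal.ofReal ⟪(x : E d), a⟫ ≠ 0 := (ENNReal.ofReal_pos.2 hx.1).ne'
    have h4 : ENNReal.ofReal ⟪(x : E d), b⟫ ≠ 0 := (ENNReal.ofReal_pos.2 hx.2).ne'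
    simp only [Set.mem_ofPred_eq, Pi.zero_apply]
    rcases min_choice (ENNReal.ofReal ⟪(x : E d), a⟫ ^ 2) (ENNReal.ofReal ⟪(x : E d), b⟫ ^ 2) with
      h5 | h5 <;> rw [h5]
    · exact pow_ne_zero 2 h3
    · exact pow_ne_zero 2 h4

theorem exists_halfspace_le_of_pos (hd : 2 ≤ d) {a b : E d} (ha : ‖a‖ = 1) (hb : ‖b‖ = 1)
    (hab : 0 < 1 + ⟪a, b⟫) : ∃ C : ENNReal, C ≠ ⊤ ∧ ∀ F : E d → 𝕜, IsZeroHom F → ∀ c : 𝕜,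
      ∫⁻ x : S d, ENNReal.ofReal ⟪(x : E d), b⟫ ^ 2 * ‖F x - c‖ₑ ^ 2 ∂surfaceMeasure d ≤
        C * ((∫⁻ x : S d, ENNReal.ofReal ⟪(x : E d), a⟫ ^ 2 * ‖F x - c‖ₑ ^ 2 ∂surfaceMeasure d) +
          ∫⁻ x : S d, ‖fderiv ℝ F x‖ₑ ^ 2 ∂surfaceMeasure d) := by
  have hM0 := lintegral_min_halfspace_ne_zero ha hb hab
  obtain ⟨Cb, hCb, h⟩ := poincare_halfspace (𝕜 := 𝕜) hd hb
  set M := ∫⁻ x : S d, min (ENNReal.ofReal ⟪(x : E d), a⟫ ^ 2) (ENNReal.ofReal ⟪(x : E d), b⟫ ^ 2)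
      ∂surfaceMeasure d with hM
  set N := surfaceMeasure d Set.univ with hN
  have hNt : N ≠ ⊤ := measure_ne_top _ _
  have hMt : M ≠ ⊤ := by
    refine ne_top_of_le_ne_top hNt ?_
    rw [hN, ← lintegral_one]
    exact lintegral_mono fun x => (min_le_left _ _).trans (ofReal_inner_sq_le_one ha x)
  have hMi : M⁻¹ ≠ ⊤ := ENNReal.inv_ne_top.2 hM0
  refine ⟨2 * Cb + 2 * N * (M⁻¹ * (2 * Cb + 2)), by finiteness, fun F hF c => ?_⟩
  borelize 𝕜
  have hFm := hF.measurable
  obtain ⟨c', hc'⟩ := h F hF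
  have hma : Measurable fun x : S d => ENNReal.ofReal ⟪(x : E d), a⟫ ^ 2 := by fun_prop
  have hmb : Measurable fun x : S d => ENNReal.ofReal ⟪(x : E d), b⟫ ^ 2 := by fun_prop
  have hmbF : Measurable fun x : S d => ENNReal.ofReal ⟪(x : E d), b⟫ ^ 2 * ‖F x - c'‖ₑ ^ 2 :=
    hmb.mul (((hFm.sub_const c').enorm.pow_const 2).comp measurable_subtype_coe)
  set A := ∫⁻ x : S d, ‖fderiv ℝ F x‖ₑ ^ 2 ∂surfaceMeasure d with hA
  set X := ∫⁻ x : S d, ENNReal.ofReal ⟪(x : E d), a⟫ ^ 2 * ‖F x - c‖ₑ ^ 2 ∂surfaceMeasure d with hX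
  have hlink : ‖c' - c‖ₑ ^ 2 ≤ M⁻¹ * (2 * (Cb * A) + 2 * X) := by
    rw [← ENNReal.mul_le_iff_le_inv hM0 hMt, hM, mul_comm, ← lintegral_const_mul _ (hma.min hmb)]
    calc _ ≤ ∫⁻ x : S d, (2 * (ENNReal.ofReal ⟪(x : E d), b⟫ ^ 2 * ‖F x - c'‖ₑ ^ 2) +
          2 * (ENNReal.ofReal ⟪(x : E d), a⟫ ^ 2 * ‖F x - c‖ₑ ^ 2)) ∂surfaceMeasure d := by
          refine lintegral_mono fun x => ?_
          have h1 := enorm_add_sq_le (-(F x - c')) (F x - c)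
          rw [enorm_neg, show -(F x - c') + (F x - c) = c' - c by ring] at h1
          calc _ ≤ (2 * ‖F x - c'‖ₑ ^ 2 + 2 * ‖F x - c‖ₑ ^ 2) *
                min (ENNReal.ofReal ⟪(x : E d), a⟫ ^ 2) (ENNReal.ofReal ⟪(x : E d), b⟫ ^ 2) := by
                  gcongr
            _ = 2 * (min (ENNReal.ofReal ⟪(x : E d), a⟫ ^ 2) (ENNReal.ofReal ⟪(x : E d), b⟫ ^ 2) *
                ‖F x - c'‖ₑ ^ 2) + 2 * (min (ENNReal.ofReal ⟪(x : E d), a⟫ ^ 2)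
                (ENNReal.ofReal ⟪(x : E d), b⟫ ^ 2) * ‖F x - c‖ₑ ^ 2) := by ring
            _ ≤ _ := by
                gcongr
                · exact min_le_right _ _
                · exact min_le_left _ _
      _ = 2 * (∫⁻ x : S d, ENNReal.ofReal ⟪(x : E d), b⟫ ^ 2 * ‖F x - c'‖ₑ ^ 2
          ∂surfaceMeasure d) + 2 * X := by
          rw [lintegral_add_left (hmbF.const_mul 2), lintegral_const_mul _ hmbF,
            lintegral_const_mul' 2 _ (by norm_num)]
      _ ≤ _ := by gcongr
  calc _ ≤ ∫⁻ x : S d, (2 * (ENNReal.ofReal ⟪(x : E d), b⟫ ^ 2 * ‖F x - c'‖ₑ ^ 2) +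
        2 * ‖c' - c‖ₑ ^ 2) ∂surfaceMeasure d := by
        refine lintegral_mono fun x => ?_
        have h1 := enorm_add_sq_le (F x - c') (c' - c)
        rw [sub_add_sub_cancel] at h1
        calc _ ≤ ENNReal.ofReal ⟪(x : E d), b⟫ ^ 2 *
              (2 * ‖F x - c'‖ₑ ^ 2 + 2 * ‖c' - c‖ₑ ^ 2) := by gcongr
          _ = 2 * (ENNReal.ofReal ⟪(x : E d), b⟫ ^ 2 * ‖F x - c'‖ₑ ^ 2) +
              ENNReal.ofReal ⟪(x : E d), b⟫ ^ 2 * (2 * ‖c' - c‖ₑ ^ 2) := by ring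
          _ ≤ _ := by
              refine add_le_add le_rfl ?_
              exact mul_le_of_le_one_left' (ofReal_inner_sq_le_one hb x)
    _ = 2 * (∫⁻ x : S d, ENNReal.ofReal ⟪(x : E d), b⟫ ^ 2 * ‖F x - c'‖ₑ ^ 2
        ∂surfaceMeasure d) + 2 * ‖c' - c‖ₑ ^ 2 * N := by
        rw [lintegral_add_left (hmbF.const_mul 2), lintegral_const_mul _ hmbF, lintegral_const]
    _ ≤ 2 * (Cb * A) + 2 * (M⁻¹ * (2 * (Cb * A) + 2 * X)) * N := by gcongr
    _ = 2 * Cb * A + 2 * N * (M⁻¹ * (2 * Cb * A + 2 * X)) := by ring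
    _ ≤ 2 * Cb * (X + A) + 2 * N * (M⁻¹ * (2 * Cb * (X + A) + 2 * (X + A))) := by
        gcongr
        · exact le_add_self
        · exact le_add_self
        · exact le_self_add
    _ = _ := by ring

theorem exists_halfspace_le (hd : 2 ≤ d) {a b : E d} (ha : ‖a‖ = 1) (hb : ‖b‖ = 1) :
    ∃ C : ENNReal, C ≠ ⊤ ∧ ∀ F : E d → 𝕜, IsZeroHom F → ∀ c : 𝕜,
      ∫⁻ x : S d, ENNReal.ofReal ⟪(x : E d), b⟫ ^ 2 * ‖F x - c‖ₑ ^ 2 ∂surfaceMeasure d ≤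
        C * ((∫⁻ x : S d, ENNReal.ofReal ⟪(x : E d), a⟫ ^ 2 * ‖F x - c‖ₑ ^ 2 ∂surfaceMeasure d) +
          ∫⁻ x : S d, ‖fderiv ℝ F x‖ₑ ^ 2 ∂surfaceMeasure d) := by
  rcases (neg_le_of_abs_le ((abs_real_inner_le_norm a b).trans (by rw [ha, hb, one_mul]))).eq_or_lt
    with h | h
  · obtain ⟨e, he, hae⟩ := exists_orthogonal_unit hd a
    have hba : b = -a := by
      have : ‖a + b‖ ^ 2 = 0 := by
        rw [norm_add_sq_real, ha, hb, ← h]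
        norm_num
      rw [sq_eq_zero_iff, norm_eq_zero] at this
      exact (neg_eq_of_add_eq_zero_right this).symm
    obtain ⟨C₁, hC₁, h₁⟩ := exists_halfspace_le_of_pos (𝕜 := 𝕜) hd ha he (by simp [hae])
    obtain ⟨C₂, hC₂, h₂⟩ := exists_halfspace_le_of_pos (𝕜 := 𝕜) hd he hb
      (by rw [hba, inner_neg_right, real_inner_comm, hae]; simp)
    refine ⟨C₂ * (C₁ + 1), by finiteness, fun F hF c => (h₂ F hF c).trans ?_⟩
    rw [mul_assoc, add_mul, one_mul]
    exact mul_le_mul' le_rfl (add_le_add (h₁ F hF c) le_add_self)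
  · exact exists_halfspace_le_of_pos hd ha hb (by linarith)

/-- The Poincaré inequality on the sphere. -/
theorem poincare_sphere (hd : 2 ≤ d) :
    ∃ C : ENNReal, C ≠ ⊤ ∧ ∀ F : E d → 𝕜, IsZeroHom F → ∃ c : 𝕜,
      ∫⁻ x : S d, ‖F x - c‖ₑ ^ 2 ∂surfaceMeasure d ≤
        C * ∫⁻ x : S d, ‖fderiv ℝ F x‖ₑ ^ 2 ∂surfaceMeasure d := by
  obtain ⟨a, ha, -⟩ := exists_orthogonal_unit hd 0
  obtain ⟨C₀, hC₀, h₀⟩ := poincare_halfspace (𝕜 := 𝕜) hd ha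
  have he : ∀ i : Fin d, ‖(EuclideanSpace.single i 1 : E d)‖ = 1 := fun i => by simp
  choose C hC h using fun i => exists_halfspace_le (𝕜 := 𝕜) hd ha (he i)
  choose C' hC' h' using fun i => exists_halfspace_le (𝕜 := 𝕜) hd ha
    (b := -EuclideanSpace.single i 1) (by rw [norm_neg, he i])
  have hs : ∑ i, (C i + C' i) ≠ ⊤ :=
    (ENNReal.sum_lt_top.2 fun i _ => (ENNReal.add_ne_top.2 ⟨hC i, hC' i⟩).lt_top).ne
  refine ⟨(∑ i, (C i + C' i)) * (C₀ + 1), by finiteness, fun F hF => ?_⟩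
  obtain ⟨c, hc⟩ := h₀ F hF
  refine ⟨c, ?_⟩
  borelize 𝕜
  have hFm := hF.measurable
  have hmF : Measurable fun x : S d => ‖F x - c‖ₑ ^ 2 :=
    ((hFm.sub_const c).enorm.pow_const 2).comp measurable_subtype_coe
  have hm : ∀ b : E d, Measurable fun x : S d => ENNReal.ofReal ⟪(x : E d), b⟫ ^ 2 * ‖F x - c‖ₑ ^ 2 :=
    fun b => (by fun_prop : Measurable fun x : S d => ENNReal.ofReal ⟪(x : E d), b⟫ ^ 2).mul hmF
  have hone : ∀ x : S d, ∑ i, (ENNReal.ofReal ⟪(x : E d), EuclideanSpace.single i 1⟫ ^ 2 +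
      ENNReal.ofReal ⟪(x : E d), -EuclideanSpace.single i 1⟫ ^ 2) = 1 := by
    intro x
    have h1 : ∀ t : ℝ, ENNReal.ofReal t ^ 2 + ENNReal.ofReal (-t) ^ 2 = ENNReal.ofReal (t ^ 2) := by
      intro t
      rcases le_total 0 t with ht | ht
      · rw [ENNReal.ofReal_of_nonpos (neg_nonpos.2 ht), ENNReal.ofReal_pow ht]
        simp
      · rw [ENNReal.ofReal_of_nonpos ht, ← neg_sq t, ENNReal.ofReal_pow (neg_nonneg.2 ht)]
        simp
    simp only [inner_neg_right, h1]
    rw [← ENNReal.ofReal_sum_of_nonneg fun _ _ => sq_nonneg _, ← ENNReal.ofReal_one]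
    congr 1
    have h2 : ‖(x : E d)‖ ^ 2 = 1 := by simp
    rw [EuclideanSpace.real_norm_sq_eq] at h2
    simpa [EuclideanSpace.inner_single_right] using h2
  calc _ = ∫⁻ x : S d, ∑ i, (ENNReal.ofReal ⟪(x : E d), EuclideanSpace.single i 1⟫ ^ 2 *
        ‖F x - c‖ₑ ^ 2 + ENNReal.ofReal ⟪(x : E d), -EuclideanSpace.single i 1⟫ ^ 2 *
        ‖F x - c‖ₑ ^ 2) ∂surfaceMeasure d := by
        refine lintegral_congr fun x => ?_
        simp only [← add_mul]
        rw [← Finset.sum_mul, hone, one_mul]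
    _ = ∑ i, ((∫⁻ x : S d, ENNReal.ofReal ⟪(x : E d), EuclideanSpace.single i 1⟫ ^ 2 *
        ‖F x - c‖ₑ ^ 2 ∂surfaceMeasure d) + ∫⁻ x : S d,
        ENNReal.ofReal ⟪(x : E d), -EuclideanSpace.single i 1⟫ ^ 2 *
        ‖F x - c‖ₑ ^ 2 ∂surfaceMeasure d) := by
        rw [lintegral_finsetSum _ fun i _ => by exact (hm _).add (hm _)]
        exact Finset.sum_congr rfl fun i _ => lintegral_add_left (hm _) _
    _ ≤ ∑ i, (C i + C' i) * ((C₀ + 1) * ∫⁻ x : S d, ‖fderiv ℝ F x‖ₑ ^ 2 ∂surfaceMeasure d) := by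
        refine Finset.sum_le_sum fun i _ => ?_
        rw [add_mul]
        have h3 := add_le_add hc (le_refl (∫⁻ x : S d, ‖fderiv ℝ F x‖ₑ ^ 2 ∂surfaceMeasure d))
        rw [add_mul C₀, one_mul]
        exact add_le_add ((h i F hF c).trans (mul_le_mul' le_rfl h3))
          ((h' i F hF c).trans (mul_le_mul' le_rfl h3))
    _ = _ := by rw [← Finset.sum_mul, mul_assoc]

end Sphere

end DunklSphere
namespace DunklSphere

variable {d : ℕ}

section Uncertainty

variable {R P : Finset (E d)} {κ : E d → ℝ} {𝕜 : Type*} [RCLike 𝕜]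

/-- The Poincaré inequality for the Dunkl energy on the sphere. -/
theorem exists_poincare (hR : IsRootSystem R) (hκ : IsMultiplicity R κ) (hd : 2 ≤ d) :
    ∃ C : ENNReal, C ≠ ⊤ ∧ ∀ F : E d → 𝕜, IsZeroHom F → ∃ c : 𝕜,
      ∫⁻ x : S d, ewt (activeRoots R κ) (fun v => κ v / 2) x * ‖F x - c‖ₑ ^ 2 ∂surfaceMeasure d ≤
        C * ∫⁻ x : S d, ewt (activeRoots R κ) (fun v => κ v / 2) x * (‖fderiv ℝ F x‖ₑ ^ 2 +
          ∑ v ∈ activeRoots R κ, ENNReal.ofReal (κ v / 4) * ‖F x - F (refl v x)‖ₑ ^ 2)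
          ∂surfaceMeasure d := by
  have hW := isWeighted_activeRoots hR hκ
  rcases (activeRoots R κ).eq_empty_or_nonempty with h | h
  · obtain ⟨C, hC, hP⟩ := poincare_sphere (𝕜 := 𝕜) hd
    refine ⟨C, hC, fun F hF => ?_⟩
    simpa [h, ewt, wt] using hP F hF
  · obtain ⟨C, hC, hP⟩ := hW.poincare (𝕜 := 𝕜) hd h
    obtain ⟨η, hη, hη'⟩ := exists_pos_le_finset (activeRoots R κ) (fun v => κ v / 4) fun v hv => by
      have := hW.pos v hv
      linarith
    refine ⟨C * (1 + ENNReal.ofReal η⁻¹), by finiteness, fun F hF => ?_⟩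
    obtain ⟨c, hc⟩ := hP F hF
    refine ⟨c, hc.trans ?_⟩
    rw [mul_assoc, ← lintegral_const_mul' (1 + ENNReal.ofReal η⁻¹) _ (by finiteness)]
    refine mul_le_mul' le_rfl (lintegral_mono fun x => ?_)
    rw [mul_left_comm]
    refine mul_le_mul' le_rfl ?_
    rw [mul_add, Finset.mul_sum]
    refine add_le_add (le_mul_of_one_le_left' le_self_add) (Finset.sum_le_sum fun v hv => ?_)
    rw [← mul_assoc]
    refine le_mul_of_one_le_left' ?_
    calc (1 : ENNReal) = ENNReal.ofReal (η⁻¹ * η) := by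
          rw [inv_mul_cancel₀ hη.ne', ENNReal.ofReal_one]
      _ = ENNReal.ofReal η⁻¹ * ENNReal.ofReal η := ENNReal.ofReal_mul (by positivity)
      _ ≤ _ := mul_le_mul' le_add_self (ENNReal.ofReal_le_ofReal (hη' v hv))

/-- Among all constants, the mean is the best approximation in quadratic mean. -/
theorem lintegral_enorm_sq_le_of_integral_eq_zero {α : Type*} [MeasurableSpace α] {μ : Measure α}
    [IsFiniteMeasure μ] {w : α → ℝ} {f : α → 𝕜} (hw0 : ∀ x, 0 ≤ w x) (hw : Integrable w μ)
    (hf : AEStronglyMeasurable f μ) {L : ℝ} (hL : ∀ x, ‖f x‖ ≤ L) (h0 : ∫ x, w x • f x ∂μ = 0)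
    (c : 𝕜) : ∫⁻ x, ENNReal.ofReal (w x) * ‖f x‖ₑ ^ 2 ∂μ ≤
      ∫⁻ x, ENNReal.ofReal (w x) * ‖f x - c‖ₑ ^ 2 ∂μ := by
  have hint : ∀ g : α → 𝕜, AEStronglyMeasurable g μ → (∃ B, ∀ x, ‖g x‖ ≤ B) →
      Integrable (fun x => w x * ‖g x‖ ^ 2) μ := by
    rintro g hg ⟨B, hB⟩
    refine hw.mul_bdd (c := B ^ 2) (hg.norm.pow 2) (Filter.Eventually.of_forall fun x => ?_)
    rw [norm_pow, norm_norm]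
    gcongr
    exact hB x
  have i1 := hint f hf ⟨L, hL⟩
  have i2 := hint (fun x => f x - c) (hf.sub aestronglyMeasurable_const)
    ⟨L + ‖c‖, fun x => (norm_sub_le _ _).trans (by linarith [hL x])⟩
  have i3 : Integrable (fun x => w x • f x) μ := by
    exact hw.smul_bdd L hf (Filter.Eventually.of_forall hL)
  have i4 : Integrable (fun x => RCLike.re (w x • f x * (starRingEnd 𝕜) c)) μ :=
    (i3.mul_const _).re
  have hz : ∫ x, RCLike.re (w x • f x * (starRingEnd 𝕜) c) ∂μ = 0 := by
    rw [integral_re (i3.mul_const _), integral_mul_const, h0, zero_mul, map_zero]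
  have hconv : ∀ g : α → 𝕜, Integrable (fun x => w x * ‖g x‖ ^ 2) μ →
      ∫⁻ x, ENNReal.ofReal (w x) * ‖g x‖ₑ ^ 2 ∂μ = ENNReal.ofReal (∫ x, w x * ‖g x‖ ^ 2 ∂μ) := by
    intro g hg
    rw [ofReal_integral_eq_lintegral_ofReal hg (Filter.Eventually.of_forall fun x =>
      mul_nonneg (hw0 x) (sq_nonneg _))]
    refine lintegral_congr fun x => ?_
    rw [ENNReal.ofReal_mul (hw0 x), ENNReal.ofReal_pow (norm_nonneg _), ofReal_norm]
  rw [hconv f i1, hconv _ i2]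
  refine ENNReal.ofReal_le_ofReal ?_
  have hle : ∫ x, (w x * ‖f x‖ ^ 2 - 2 * RCLike.re (w x • f x * (starRingEnd 𝕜) c)) ∂μ ≤
      ∫ x, w x * ‖f x - c‖ ^ 2 ∂μ := by
    refine integral_mono (i1.sub (i4.const_mul 2)) i2 fun x => ?_
    have h1 := norm_sub_sq (𝕜 := 𝕜) c (f x)
    rw [norm_sub_rev, RCLike.inner_apply] at h1
    dsimp only
    rw [h1, smul_mul_assoc, RCLike.smul_re]
    nlinarith [mul_nonneg (hw0 x) (sq_nonneg ‖c‖)]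
  rwa [integral_sub i1 (i4.const_mul 2), integral_const_mul, hz, mul_zero, sub_zero] at hle

/-- The uncertainty principle for the Dunkl energy on the sphere. -/
theorem exists_uncertainty (hR : IsRootSystem R) (hκ : IsMultiplicity R κ) (hd : 2 ≤ d) :
    ∃ C : ℝ, 0 < C ∧ ∀ P : Finset (E d), IsPositiveSubsystem R P → ∀ f : S d → 𝕜,
      IsZeroHom (radialExt f) →
      ∫ x : S d, (weight P κ x ^ 2) • f x ∂surfaceMeasure d = 0 →
      ∫ x : S d, ‖f x‖ ^ 2 * weight P κ x ^ 2 ∂surfaceMeasure d = 1 → ∀ y : S d,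
      C ≤ (∫ x : S d, (1 - ⟪(x : E d), y⟫) * ‖f x‖ ^ 2 * weight P κ x ^ 2 ∂surfaceMeasure d) *
        ∫ x : S d, ‖sphereGrad P κ f x‖ ^ 2 * weight P κ x ^ 2 ∂surfaceMeasure d := by
  have hW := isWeighted_activeRoots hR hκ
  obtain ⟨c₁, hc₁, h₁⟩ := variance_or_energy (𝕜 := 𝕜) hW.pos (fun v hv => hW.ne_zero hv) hd
  obtain ⟨D, hD, h₂⟩ := exists_poincare (𝕜 := 𝕜) hR hκ hd
  obtain ⟨C₂, hC₂, hDC⟩ : ∃ C : ℝ, 0 < C ∧ D ≤ ENNReal.ofReal C :=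
    ⟨D.toReal + 1, by positivity, by
      rw [← ENNReal.ofReal_toReal hD]
      exact ENNReal.ofReal_le_ofReal (by simp)⟩
  refine ⟨min c₁ (c₁ * C₂⁻¹), by positivity, fun P hP f hF h0 h1 y => ?_⟩
  set w : E d → ℝ := wt (activeRoots R κ) fun v => κ v / 2 with hw
  have hwc : Continuous w := continuous_wt hW.pos
  have hw0 : ∀ x, 0 ≤ w x := wt_nonneg _ _
  have hwt : ∀ x, weight P κ x ^ 2 = w x := weight_sq hR hκ hP
  have hen := sphereGrad_energy hR hκ hP hd hF
  set F := radialExt f with hFdef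
  have hFf : ∀ x : S d, F x = f x := radialExt_coe f
  set e := ∫ x : S d, ‖sphereGrad P κ f x‖ ^ 2 * weight P κ x ^ 2 ∂surfaceMeasure d with he
  have he0 : 0 ≤ e := integral_nonneg fun x => by positivity
  set m := ∫ x : S d, (1 - ⟪(x : E d), y⟫) * ‖f x‖ ^ 2 * weight P κ x ^ 2 ∂surfaceMeasure d with hm
  have hpos : ∀ x : S d, 0 ≤ 1 - ⟪(x : E d), y⟫ := fun x => by
    rw [one_sub_inner_sphere]
    positivity
  have hm0 : 0 ≤ m := integral_nonneg fun x => by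
    have := hpos x
    positivity
  borelize 𝕜
  obtain ⟨L, hL0, hL, -⟩ := hF.exists_bound
  have hFm := hF.measurable
  have hL1 : ∀ x : E d, 1 ≤ ‖x‖ → |‖F x‖ ^ 2| ≤ L ^ 2 := fun x hx => by
    rw [abs_of_nonneg (sq_nonneg _)]
    gcongr
    exact hL x (norm_pos_iff.1 (one_pos.trans_le hx))
  have i1 := hW.integrable_sphere (hFm.norm.pow_const 2) hL1
  have i0 : Integrable (fun x : S d => w x) (surfaceMeasure d) := by
    simpa using hW.integrable_sphere (h := fun _ => 1) measurable_const (C := 1) (by simp)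
  have i2 : Integrable (fun x : S d => (1 - ⟪(x : E d), y⟫) * (w x * ‖F x‖ ^ 2))
      (surfaceMeasure d) := by
    refine i1.bdd_mul (c := 2) (by fun_prop) (Filter.Eventually.of_forall fun x => ?_)
    rw [Real.norm_of_nonneg (hpos x)]
    have := neg_le_of_abs_le ((abs_real_inner_le_norm (x : E d) y).trans (by
      rw [norm_eq_of_mem_sphere, norm_eq_of_mem_sphere, one_mul]))
    linarith
  have hofReal : ∀ x : E d, ENNReal.ofReal (w x * ‖F x‖ ^ 2) = ewt _ _ x * ‖F x‖ₑ ^ 2 := fun x => by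
    rw [ENNReal.ofReal_mul (hw0 x), ENNReal.ofReal_pow (norm_nonneg _), ofReal_norm, ewt, hw]
  have n1 : ∫⁻ x : S d, ewt (activeRoots R κ) (fun v => κ v / 2) x * ‖F x‖ₑ ^ 2
      ∂surfaceMeasure d = 1 := by
    refine Eq.trans ?_ ((congrArg ENNReal.ofReal h1).trans ENNReal.ofReal_one)
    simp only [hwt, ← hFf, mul_comm (‖F _‖ ^ 2)]
    rw [ofReal_integral_eq_lintegral_ofReal i1 (Filter.Eventually.of_forall fun x =>
      mul_nonneg (hw0 x) (sq_nonneg _))]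
    exact lintegral_congr fun x => (hofReal x).symm
  have n2 : ∫⁻ x : S d, ENNReal.ofReal (1 - ⟪(x : E d), y⟫) *
      (ewt (activeRoots R κ) (fun v => κ v / 2) x * ‖F x‖ₑ ^ 2) ∂surfaceMeasure d ≤
      ENNReal.ofReal m := by
    rw [hm]
    simp only [hwt, ← hFf, mul_assoc, mul_comm (‖F _‖ ^ 2)]
    rw [ofReal_integral_eq_lintegral_ofReal i2 (Filter.Eventually.of_forall fun x =>
      mul_nonneg (hpos x) (mul_nonneg (hw0 x) (sq_nonneg _)))]
    refine le_of_eq (lintegral_congr fun x => ?_)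
    rw [ENNReal.ofReal_mul (hpos x), hofReal]
  have n3 : ∫⁻ x : S d, ewt (activeRoots R κ) (fun v => κ v / 2) x * ‖fderiv ℝ F x‖ₑ ^ 2
      ∂surfaceMeasure d ≤ ENNReal.ofReal e :=
    (lintegral_mono fun x => mul_le_mul' le_rfl le_self_add).trans hen
  have n4 : C₂⁻¹ ≤ e := by
    obtain ⟨c, hc⟩ := h₂ F hF
    have h5 := lintegral_enorm_sq_le_of_integral_eq_zero (μ := surfaceMeasure d)
      (w := fun x : S d => w x) (f := fun x : S d => F x) (fun x => hw0 x) i0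
      (hFm.comp measurable_subtype_coe).aestronglyMeasurable
      (fun x => hL x (coe_sphere_ne_zero x)) (by simpa only [hwt, ← hFf] using h0) c
    have h6 : (1 : ENNReal) ≤ ENNReal.ofReal (C₂ * e) := by
      rw [ENNReal.ofReal_mul hC₂.le, ← n1]
      exact h5.trans (hc.trans (mul_le_mul' hDC hen))
    rw [← ENNReal.ofReal_one, ENNReal.ofReal_le_ofReal_iff (by positivity)] at h6
    rwa [inv_le_iff_one_le_mul₀ hC₂, mul_comm]
  rcases h₁ y F hF n1 m e hm0 he0 n2 n3 with h | h
  · exact (min_le_right _ _).trans (mul_le_mul h n4 (by positivity) hm0)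
  · exact (min_le_left _ _).trans h

/-- The variance about a point of the sphere attains its minimum. -/
theorem exists_isLeast_variance (hd : 2 ≤ d) {g : S d → ℝ} (hg : Integrable g (surfaceMeasure d)) :
    ∃ y : S d, ∀ z : S d, ∫ x : S d, (1 - ⟪(x : E d), y⟫) * g x ∂surfaceMeasure d ≤
      ∫ x : S d, (1 - ⟪(x : E d), z⟫) * g x ∂surfaceMeasure d := by
  have hc : Continuous fun y : S d => ∫ x : S d, (1 - ⟪(x : E d), y⟫) * g x ∂surfaceMeasure d := by
    refine continuous_of_dominated (bound := fun x => 2 * ‖g x‖) (fun y => ?_) (fun y => ?_)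
      (hg.norm.const_mul 2) (Filter.Eventually.of_forall fun x => by fun_prop)
    · exact (by fun_prop : Continuous fun x : S d => 1 - ⟪(x : E d), y⟫).aestronglyMeasurable.mul hg.1
    · refine Filter.Eventually.of_forall fun x => ?_
      rw [norm_mul]
      gcongr
      have h1 := abs_le.1 ((abs_real_inner_le_norm (x : E d) y).trans (by
        rw [norm_eq_of_mem_sphere, norm_eq_of_mem_sphere, one_mul]))
      rw [Real.norm_eq_abs, abs_le]
      constructor <;> linarith [h1.1, h1.2]
  obtain ⟨e, he, -⟩ := exists_orthogonal_unit hd 0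
  obtain ⟨y, -, hy⟩ := isCompact_univ.exists_isMinOn ⟨⟨e, by simpa using he⟩, Set.mem_univ _⟩
    hc.continuousOn
  exact ⟨y, fun z => hy (Set.mem_univ z)⟩

end Uncertainty

end DunklSphere
/-- The ambient space is `ℝ^d` with `d = n + 1 ≥ 2`, so the sphere `S^{d-1}` has dimension `n`. -/
theorem corollary1p2 (𝕜 : Type*) [RCLike 𝕜] (n : ℕ) (hn : 1 ≤ n)
    (R : Finset (DunklSphere.E (n + 1))) (hR : DunklSphere.IsRootSystem R)
    (κ : DunklSphere.E (n + 1) → ℝ) (hκ : DunklSphere.IsMultiplicity R κ) :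
    ∃ C : ℝ, 0 < C ∧
      ∀ P : Finset (DunklSphere.E (n + 1)), DunklSphere.IsPositiveSubsystem R P →
      ∀ f : DunklSphere.S (n + 1) → 𝕜, ContMDiff (𝓡 n) 𝓘(ℝ, 𝕜) 1 f →
        ∫ x, (DunklSphere.weight P κ x ^ 2) • f x ∂(DunklSphere.surfaceMeasure (n + 1)) = 0 →
        ∫ x, ‖f x‖ ^ 2 * DunklSphere.weight P κ x ^ 2
          ∂(DunklSphere.surfaceMeasure (n + 1)) = 1 →
        ∃ m : ℝ,
          IsLeast (Set.range fun y : DunklSphere.S (n + 1) =>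
            ∫ x : DunklSphere.S (n + 1), (1 - ⟪(x : DunklSphere.E (n + 1)), y⟫) * ‖f x‖ ^ 2 *
              DunklSphere.weight P κ x ^ 2 ∂(DunklSphere.surfaceMeasure (n + 1))) m ∧
          C ≤ m * ∫ x, ‖DunklSphere.sphereGrad P κ f x‖ ^ 2 * DunklSphere.weight P κ x ^ 2
            ∂(DunklSphere.surfaceMeasure (n + 1)) := by
  have hd : 2 ≤ n + 1 := by omega
  obtain ⟨C, hC, h⟩ := DunklSphere.exists_uncertainty (𝕜 := 𝕜) hR hκ hd
  refine ⟨C, hC, fun P hP f hf h0 h1 => ?_⟩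
  have hint : Integrable (fun x => ‖f x‖ ^ 2 * DunklSphere.weight P κ x ^ 2)
      (DunklSphere.surfaceMeasure (n + 1)) :=
    Integrable.of_integral_ne_zero (by rw [h1]; exact one_ne_zero)
  obtain ⟨y, hy⟩ := DunklSphere.exists_isLeast_variance hd hint
  simp only [← mul_assoc] at hy
  refine ⟨_, ⟨⟨y, rfl⟩, ?_⟩, h P hP f (DunklSphere.isZeroHom_radialExt hf) h0 h1 y⟩
  rintro _ ⟨z, rfl⟩
  exact hy z
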